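/- **Setting.** Let $X$ be a finite set of $k$ variables and $\Gamma_X=\{\vdash_x,\dashv_x \mid x\in X\}$ the set of *variable operations* (opening and closing of $x$). An *extraction grammar* $G$ associated with $X$ is a context-free grammar with finitely many non-terminals and rules, start symbol $S$, and terminal alphabet $\Sigma\cup\Gamma_X$ (disjoint union); the words it produces are *ref-words*. It is in *CNF* if every rule has the form $A\to BC$ or $A\to t$, with $B,C$ non-terminals and $t\in\Sigma\cup\Gamma_X$. A ref-word is *valid* if for each $x\in X$ it has exactly one occurrence of $\vdash_x$ and exactly one of $\dashv_x$, the former before the latter. Let $\mathsf{clean}$ erase the variable operations. A valid ref-word $\mathbf r=\mathbf r'_x\vdash_x\mathbf r_x\dashv_x\mathbf r''_x$ with $\mathsf{clean}(\mathbf r)=\mathbf d$ defines the mapping $\mu^{\mathbf r}$ with $\mu^{\mathbf r}(x)=[i,j\rangle$, $i=|\mathsf{clean}(\mathbf r'_x)|+1$, $j=i+|\mathsf{clean}(\mathbf r_x)|$; and $[\![G]\!](\mathbf d)$ is the set of all $\mu^{\mathbf r}$ for valid ref-words $\mathbf r$ produced by $G$ with $\mathsf{clean}(\mathbf r)=\mathbf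 d$. $G$ is *functional* if every ref-word it produces is valid. $G$ is *unambiguous* if for every document $\mathbf d$ and every $\mu\in[\![G]\!](\mathbf d)$ there is a unique valid ref-word $\mathbf r$ produced by $G$ with $\mathsf{clean}(\mathbf r)=\mathbf d$ and $\mu^{\mathbf r}=\mu$, and this $\mathbf r$ has a unique parse-tree. **The decorated grammar.** Let $G$ be functional and in CNF, $\mathbf d=\sigma_1\cdots\sigma_n$ with $n\ge1$. The grammar $G_{\mathbf d}$ has initial non-terminal $S_{1,n}$ and, for $A\to\sigma_i$, $A\to\tau$ ($\tau\in\Gamma_X$) and $A\to BC$ in $G$, the rules $A_{i,i}\to\sigma_i$; $A_\epsilon\to\tau$; $A_\epsilon\to B_\epsilon C_\epsilon$; $A_{i,j}\to B_{i,j}C_\epsilon$ and $A_{i,j}\to B_\epsilon C_{i,j}$ ($1\le i\le j\le n$); $A_{i,j}\to B_{i,i'}C_{i'+1,j}$ ($1\le i\le i'<j\le n$); useless non-terminals (those in no derivation $S_{1,n}\Rightarrow^*\alpha A\beta\Rightarrow^* w$ of a terminal word $w$) are removed. Let $\mathbf x_A\subseteq\Gamma_X$ be the set of variable operations in ref-words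 derivable from $A$ in $G$. The grammar $\mathsf{dec}(G_{\mathbf d})$ is obtained in three steps. 1. For all pairwise disjoint $\mathbf x,\mathbf y,\mathbf z,\mathbf w\subseteq\Gamma_X$, take $A^{\emptyset,\emptyset}_{i,i}\to\sigma_i$ for $A_{i,i}\to\sigma_i$; $A_\epsilon\to\epsilon$ for $A_\epsilon\to\tau$; $A_\epsilon\to B_\epsilon C_\epsilon$ for the same rule; $A^{\mathbf x,\mathbf y\cup\mathbf x_C}_{i,j}\to B^{\mathbf x,\mathbf y}_{i,j}C_\epsilon$ for $A_{i,j}\to B_{i,j}C_\epsilon$ if $\mathbf x,\mathbf y$ are disjoint from $\mathbf x_C$; $A^{\mathbf x\cup\mathbf x_B,\mathbf y}_{i,j}\to B_\epsilon C^{\mathbf x,\mathbf y}_{i,j}$ for $A_{i,j}\to B_\epsilon C_{i,j}$ if $\mathbf x,\mathbf y$ are disjoint from $\mathbf x_B$; $A^{\mathbf x,\mathbf w}_{i,j}\to B^{\mathbf x,\mathbf y}_{i,i'}C^{\mathbf z,\mathbf w}_{i'+1,j}$ for $A_{i,j}\to B_{i,i'}C_{i'+1,j}$. The initial non-terminals are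 all $S_{1,n}^{\mathbf x,\mathbf y}$. 2. Eliminate useless non-terminals; then epsilon-productions (and the non-terminals $A_\epsilon$, which are useless from then on); then unit productions, i.e. add $A\to\alpha$ whenever $B$ is reachable from $A$ by unit productions and $B\to\alpha$ is not a unit production, and discard all unit productions. 3. Replace each $A^{\mathbf x,\mathbf y}_{i,i}\to\sigma_i$ by $A^{\mathbf x,\mathbf y}_{i,i}\to(\mathbf x,i,\mathbf y)$, and add a fresh start symbol with a rule to each remaining initial non-terminal $S_{1,n}^{\mathbf x,\mathbf y}$. **Stable non-terminals and JUMP.** $A^{\mathbf x,\mathbf y}_{i,j}$ is *stable* if $\mathbf x_A=\mathbf x\cup\mathbf y$. A rule $A^{\mathbf x,\mathbf y}_{i,j}\to B^{\mathbf x',\mathbf z}_{i,i'}C^{\mathbf z',\mathbf y'}_{i'+1,j}$ of $\mathsf{dec}(G_{\mathbf d})$ is *skippable* if its left-hand side is non-stable, $\mathbf z=\mathbf z'=\emptyset$, and exactly one of the two non-terminals on the right is stable. (Because of the elimination of unit productions, $\mathbf x'$ and $\mathbf y'$ may differ from $\mathbf x$ and $\mathbf y$.) $\textsc{jump}(N)$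 is the set of those $M$ that are the left-hand side of at least one non-skippable rule and that are reached from $N$ by a (possibly empty) sequence of skippable rules, each step passing from the left-hand side to the non-stable non-terminal on the right-hand side. **The algorithm.** $\textsc{enumerate}(\alpha,\mathsf{map})$, for a sequence $\alpha$ of non-stable non-terminals and a set $\mathsf{map}$ of pairs, outputs $\mathsf{map}$ if $\alpha=\epsilon$; otherwise $\alpha=A\cdot\alpha'$, and for each $M\in\textsc{jump}(A)$ and each non-skippable rule $M\to B^{\mathbf x',\mathbf z}_{i,i'}C^{\mathbf z',\mathbf y'}_{i'+1,j}$ it calls $\textsc{enumerate}(\beta\alpha',\mathsf{map}\cup\{(\tau,i'+1)\mid\tau\in\mathbf z\cup\mathbf z'\})$, where $\beta$ is the sequence of the non-stable non-terminals among the two on the right. The main algorithm calls, for each $S_{1,n}^{\mathbf x,\mathbf y}$ in $\mathsf{dec}(G_{\mathbf d})$, $\textsc{enumerate}(\alpha,\{(\tau,1)\mid\tau\in\mathbf x\}\cup\{(\tau,n+1)\mid\tau\in\mathbf y\})$ with $\alpha=S_{1,n}^{\mathbf x,\mathbf y}$ if this non-terminal is non-stable and $\alpha=\epsilon$ if it is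 stable. A mapping $\mu$ is output as the set of the pairs $(\vdash_x,i),(\dashv_x,j)$ with $\mu(x)=[i,j\rangle$. **Cost.** After the preprocessing, the list of the $S_{1,n}^{\mathbf x,\mathbf y}$, each list $\textsc{jump}(N)$ and each list of the non-skippable rules $N\to LR$ are available, without repetitions and in an arbitrary order, and stability is known. Entering a call, advancing or leaving a loop, adding one pair to $\mathsf{map}$, and writing one pair of an output cost one step each. **Theorem.** There is a constant $c$ such that for every functional unambiguous extraction grammar $G$ in CNF associated with $k$ variables and every non-empty document $\mathbf d$, for every order of the precomputed lists, the main algorithm halts, and it outputs exactly the mappings in $[\![G]\!](\mathbf d)$, each exactly once. There are at most $c\,k$ steps from each output to the next one, and at most $c\,(k+1)$ steps before the first output, after the last output until the algorithm halts, and in total if there is no output. -/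

import Mathlib

universe u v

/-! ### Documents, spans, ref-words -/

/-- The variable operations of a set `X` of variables: opening and closing of `x`. -/
inductive VarOp (X : Type v) : Type v
  | op (x : X) : VarOp X
  | cl (x : X) : VarOp X
  deriving DecidableEq, Fintype

/-- The extended alphabet: letters (`Sum.inl`) and variable operations (`Sum.inr`). -/
abbrev ExtLetter (T : Type u) (X : Type v) : Type (max u v) := T ⊕ VarOp X

/-- An extraction grammar over the terminals `T`, associated with the variables `X`. -/
abbrev ExtractionGrammar (T : Type u) (X : Type v) := ContextFreeGrammar (ExtLetter T X)

/-- A span `[left, right⟩` of the document `d`, with `1 ≤ left ≤ right ≤ |d| + 1`. -/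
@[ext]
structure Span {T : Type u} (d : List T) where
  left : ℕ
  right : ℕ
  one_le_left : 1 ≤ left
  left_le_right : left ≤ right
  right_le : right ≤ d.length + 1

/-- `(X, d)`-mappings. -/
abbrev SpanMapping (X : Type v) {T : Type u} (d : List T) := X → Span d

namespace RefWord

variable {T : Type u} {X : Type v}

/-- The morphism that erases the variable operations. -/
def clean (r : List (ExtLetter T X)) : List T := r.filterMap Sum.getLeft?

/-- Every variable is opened exactly once and closed exactly once, the former before the latter. -/
def Valid (r : List (ExtLetter T X)) : Prop :=
  ∀ x : X, ∃ r₁ r₂ r₃ : List (ExtLetter T X),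
    r = r₁ ++ Sum.inr (VarOp.op x) :: (r₂ ++ Sum.inr (VarOp.cl x) :: r₃) ∧
    Sum.inr (VarOp.op x) ∉ r₁ ++ r₂ ++ r₃ ∧ Sum.inr (VarOp.cl x) ∉ r₁ ++ r₂ ++ r₃

/-- For a valid ref-word `r` of `d`: the `(X, d)`-mapping `μ^r` is `μ`. -/
def Encodes {d : List T} (r : List (ExtLetter T X)) (μ : SpanMapping X d) : Prop :=
  ∀ x : X, ∃ r₁ r₂ r₃ : List (ExtLetter T X),
    r = r₁ ++ Sum.inr (VarOp.op x) :: (r₂ ++ Sum.inr (VarOp.cl x) :: r₃) ∧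
    (μ x).left = (clean r₁).length + 1 ∧ (μ x).right = (μ x).left + (clean r₂).length

end RefWord

/-! ### Parse trees -/

/-- Finite ordered forests of ordered trees, whose leaves are terminals or childless nodes. -/
inductive Forest (T : Type*) (N : Type*)
  | nil : Forest T N
  | leaf (t : T) (rest : Forest T N) : Forest T N
  | node (A : N) (children : Forest T N) (rest : Forest T N) : Forest T N

namespace Forest

variable {T : Type*} {N : Type*}

/-- The labels of the roots of the trees of the forest, from left to right. -/
def roots : Forest T N → List (Symbol T N)
  | nil => []
  | leaf t rest => Symbol.terminal t :: rest.roots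
  | node A _ rest => Symbol.nonterminal A :: rest.roots

/-- The word of the terminals at the leaves, from left to right. -/
def yield : Forest T N → List T
  | nil => []
  | leaf t rest => t :: rest.yield
  | node _ children rest => children.yield ++ rest.yield

/-- Every inner node together with its children is an instance of a production rule. -/
def Follows (rules : Set (ContextFreeRule T N)) : Forest T N → Prop
  | nil => True
  | leaf _ rest => rest.Follows rules
  | node A children rest =>
      ⟨A, children.roots⟩ ∈ rules ∧ children.Follows rules ∧ rest.Follows rules

end Forest

/-- `t` is a parse-tree of the word `w` with respect to the grammar `G`. -/
def IsParseTree {T : Type*} (G : ContextFreeGrammar T) (w : List T) (t : Forest T G.NT) : Prop :=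
  t.roots = [Symbol.nonterminal G.initial] ∧ t.Follows (↑G.rules) ∧ t.yield = w

/-! ### Extraction grammars -/

namespace ExtractionGrammar

variable {T : Type u} {X : Type v}

/-- `Ref(G, d)`: the valid ref-words produced by `G` that `clean` maps to `d`. -/
def refWords (G : ExtractionGrammar T X) (d : List T) : Set (List (ExtLetter T X)) :=
  {r | r ∈ G.language ∧ RefWord.Valid r ∧ RefWord.clean r = d}

/-- `⟦G⟧(d)`. -/
def eval (G : ExtractionGrammar T X) (d : List T) : Set (SpanMapping X d) :=
  {μ | ∃ r ∈ refWords G d, RefWord.Encodes r μ}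

/-- Chomsky normal form over the extended alphabet. -/
def IsCNF (G : ExtractionGrammar T X) : Prop :=
  ∀ ρ ∈ G.rules,
    (∃ B C : G.NT, ρ.output = [Symbol.nonterminal B, Symbol.nonterminal C]) ∨
    (∃ t : ExtLetter T X, ρ.output = [Symbol.terminal t])

/-- Every ref-word produced by `G` is valid. -/
def IsFunctional (G : ExtractionGrammar T X) : Prop :=
  ∀ r ∈ G.language, RefWord.Valid r

/-- For every document `d`, every mapping of `⟦G⟧(d)` is the mapping of a unique ref-word, and this
ref-word has a unique parse-tree. -/
def IsUnambiguous (G : ExtractionGrammar T X) : Prop :=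
  ∀ (d : List T) (μ : SpanMapping X d), μ ∈ eval G d →
    ∃ r : List (ExtLetter T X), (r ∈ refWords G d ∧ RefWord.Encodes r μ) ∧
      (∀ r' : List (ExtLetter T X), r' ∈ refWords G d → RefWord.Encodes r' μ → r' = r) ∧
      ∃! t : Forest (ExtLetter T X) G.NT, IsParseTree G r t

end ExtractionGrammar

/-! ### Transformations of context-free grammars -/

/-- A context-free grammar given by a set of rules and a set of initial non-terminals. -/
structure RuleSystem (T : Type*) (N : Type*) where
  starts : Set N
  rules : Set (ContextFreeRule T N)

namespace RuleSystem

variable {T : Type*} {N : Type*}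

def Produces (g : RuleSystem T N) (α β : List (Symbol T N)) : Prop :=
  ∃ ρ ∈ g.rules, ρ.Rewrites α β

def Derives (g : RuleSystem T N) : List (Symbol T N) → List (Symbol T N) → Prop :=
  Relation.ReflTransGen g.Produces

/-- `A` is useful: `S ⇒* α A β ⇒* w` for an initial non-terminal `S` and a terminal word `w`. -/
def Useful (g : RuleSystem T N) (A : N) : Prop :=
  ∃ S ∈ g.starts, ∃ (α β : List (Symbol T N)) (w : List T),
    g.Derives [Symbol.nonterminal S] (α ++ Symbol.nonterminal A :: β) ∧
    g.Derives (α ++ Symbol.nonterminal A :: β) (w.map Symbol.terminal)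

/-- Elimination of the useless non-terminals, with all the rules in which they occur. -/
def removeUseless (g : RuleSystem T N) : RuleSystem T N where
  starts := {S | S ∈ g.starts ∧ g.Useful S}
  rules := {ρ | ρ ∈ g.rules ∧ g.Useful ρ.input ∧
    ∀ A : N, Symbol.nonterminal A ∈ ρ.output → g.Useful A}

/-- `A ⇒* ε`. -/
def Nullable (g : RuleSystem T N) (A : N) : Prop := g.Derives [Symbol.nonterminal A] []

/-- `g.DropNullable α β`: `β` is `α` without some (possibly none) of the occurrences of nullable
non-terminals. -/
inductive DropNullable (g : RuleSystem T N) : List (Symbol T N) → List (Symbol T N) → Prop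
  | nil : DropNullable g [] []
  | keep (s : Symbol T N) {α β : List (Symbol T N)} :
      DropNullable g α β → DropNullable g (s :: α) (s :: β)
  | drop {A : N} {α β : List (Symbol T N)} :
      g.Nullable A → DropNullable g α β → DropNullable g (Symbol.nonterminal A :: α) β

/-- Elimination of the epsilon-productions. -/
def removeEpsilon (g : RuleSystem T N) : RuleSystem T N where
  starts := g.starts
  rules := {ρ | ρ.output ≠ [] ∧
    ∃ α : List (Symbol T N), ⟨ρ.input, α⟩ ∈ g.rules ∧ g.DropNullable α ρ.output}

/-- `B` is reachable from `A` by a (possibly empty) sequence of unit productions. -/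
def UnitReachable (g : RuleSystem T N) : N → N → Prop :=
  Relation.ReflTransGen (fun A B => ⟨A, [Symbol.nonterminal B]⟩ ∈ g.rules)

/-- Elimination of the unit productions. -/
def removeUnit (g : RuleSystem T N) : RuleSystem T N where
  starts := g.starts
  rules := {ρ | (¬ ∃ C : N, ρ.output = [Symbol.nonterminal C]) ∧
    ∃ B : N, g.UnitReachable ρ.input B ∧ ⟨B, ρ.output⟩ ∈ g.rules}

end RuleSystem

/-! ### The grammar adjusted to a document -/

/-- The non-terminals `A_{i,j}` and `A_ε`. -/
inductive AdjNT (V : Type*)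
  | span (A : V) (i j : ℕ) : AdjNT V
  | eps (A : V) : AdjNT V

namespace ExtractionGrammar

open Symbol

variable {T : Type u} {X : Type v}

/-- The rules of `G_d` before the elimination of useless non-terminals; `d[i - 1]?` is the `i`-th
letter of `d`. -/
inductive AdjRule (G : ExtractionGrammar T X) (d : List T) :
    ContextFreeRule (ExtLetter T X) (AdjNT G.NT) → Prop
  | letter {A : G.NT} {σ : T} {i : ℕ} :
      ⟨A, [terminal (Sum.inl σ)]⟩ ∈ G.rules → 1 ≤ i → d[i - 1]? = some σ →
      AdjRule G d ⟨AdjNT.span A i i, [terminal (Sum.inl σ)]⟩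
  | varOp {A : G.NT} {τ : VarOp X} :
      ⟨A, [terminal (Sum.inr τ)]⟩ ∈ G.rules →
      AdjRule G d ⟨AdjNT.eps A, [terminal (Sum.inr τ)]⟩
  | epsEps {A B C : G.NT} :
      ⟨A, [nonterminal B, nonterminal C]⟩ ∈ G.rules →
      AdjRule G d ⟨AdjNT.eps A, [nonterminal (AdjNT.eps B), nonterminal (AdjNT.eps C)]⟩
  | spanEps {A B C : G.NT} {i j : ℕ} :
      ⟨A, [nonterminal B, nonterminal C]⟩ ∈ G.rules → 1 ≤ i → i ≤ j → j ≤ d.length →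
      AdjRule G d ⟨AdjNT.span A i j, [nonterminal (AdjNT.span B i j), nonterminal (AdjNT.eps C)]⟩
  | epsSpan {A B C : G.NT} {i j : ℕ} :
      ⟨A, [nonterminal B, nonterminal C]⟩ ∈ G.rules → 1 ≤ i → i ≤ j → j ≤ d.length →
      AdjRule G d ⟨AdjNT.span A i j, [nonterminal (AdjNT.eps B), nonterminal (AdjNT.span C i j)]⟩
  | split {A B C : G.NT} {i i' j : ℕ} :
      ⟨A, [nonterminal B, nonterminal C]⟩ ∈ G.rules → 1 ≤ i → i ≤ i' → i' < j → j ≤ d.length →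
      AdjRule G d ⟨AdjNT.span A i j,
        [nonterminal (AdjNT.span B i i'), nonterminal (AdjNT.span C (i' + 1) j)]⟩

/-- The grammar `G_d`. -/
def adjusted (G : ExtractionGrammar T X) (d : List T) :
    RuleSystem (ExtLetter T X) (AdjNT G.NT) :=
  RuleSystem.removeUseless
    { starts := {AdjNT.span G.initial 1 d.length}
      rules := {ρ | AdjRule G d ρ} }

end ExtractionGrammar

/-! ### The decorated grammar -/

/-- The non-terminals of the decorated grammar: the fresh start symbol, `A_{i,j}^{x,y}`, and `A_ε`
(the latter occurs only in intermediate steps). -/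
inductive DecNT (V : Type) (X : Type v) : Type v
  | start : DecNT V X
  | span (A : V) (i j : ℕ) (x y : Finset (VarOp X)) : DecNT V X
  | eps (A : V) : DecNT V X

/-- The terminals `(x, i, y)` of decorated words. -/
abbrev DecTerminal (X : Type v) := Finset (VarOp X) × ℕ × Finset (VarOp X)

namespace ExtractionGrammar

open Symbol

variable {T : Type u} {X : Type v} [Fintype X] [DecidableEq X]

open Classical in
/-- `x_A`: the variable operations that occur in ref-words `r` with `A ⇒* r`. If `G` is functional
and `A` is useful, then these are the variable operations of every such `r`. -/
noncomputable def opsOf (G : ExtractionGrammar T X) (A : G.NT) : Finset (VarOp X) :=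
  Finset.univ.filter fun τ => ∃ r : List (ExtLetter T X),
    G.Derives [nonterminal A] (r.map terminal) ∧ Sum.inr τ ∈ r

/-- The rules after step 1 of the construction of the decorated grammar. -/
inductive Step1Rule (G : ExtractionGrammar T X) (d : List T) :
    ContextFreeRule T (DecNT G.NT X) → Prop
  | letter {A : G.NT} {σ : T} {i : ℕ} :
      ⟨AdjNT.span A i i, [terminal (Sum.inl σ)]⟩ ∈ (adjusted G d).rules →
      Step1Rule G d ⟨DecNT.span A i i ∅ ∅, [terminal σ]⟩
  | varOp {A : G.NT} {τ : VarOp X} :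
      ⟨AdjNT.eps A, [terminal (Sum.inr τ)]⟩ ∈ (adjusted G d).rules →
      Step1Rule G d ⟨DecNT.eps A, []⟩
  | epsEps {A B C : G.NT} :
      ⟨AdjNT.eps A, [nonterminal (AdjNT.eps B), nonterminal (AdjNT.eps C)]⟩
        ∈ (adjusted G d).rules →
      Step1Rule G d ⟨DecNT.eps A, [nonterminal (DecNT.eps B), nonterminal (DecNT.eps C)]⟩
  | spanEps {A B C : G.NT} {i j : ℕ} {x y : Finset (VarOp X)} :
      ⟨AdjNT.span A i j, [nonterminal (AdjNT.span B i j), nonterminal (AdjNT.eps C)]⟩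
        ∈ (adjusted G d).rules →
      Disjoint x y → Disjoint x (opsOf G C) → Disjoint y (opsOf G C) →
      Step1Rule G d ⟨DecNT.span A i j x (y ∪ opsOf G C),
        [nonterminal (DecNT.span B i j x y), nonterminal (DecNT.eps C)]⟩
  | epsSpan {A B C : G.NT} {i j : ℕ} {x y : Finset (VarOp X)} :
      ⟨AdjNT.span A i j, [nonterminal (AdjNT.eps B), nonterminal (AdjNT.span C i j)]⟩
        ∈ (adjusted G d).rules →
      Disjoint x y → Disjoint x (opsOf G B) → Disjoint y (opsOf G B) →
      Step1Rule G d ⟨DecNT.span A i j (x ∪ opsOf G B) y,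
        [nonterminal (DecNT.eps B), nonterminal (DecNT.span C i j x y)]⟩
  | split {A B C : G.NT} {i i' j : ℕ} {x y z w : Finset (VarOp X)} :
      ⟨AdjNT.span A i j, [nonterminal (AdjNT.span B i i'), nonterminal (AdjNT.span C (i' + 1) j)]⟩
        ∈ (adjusted G d).rules →
      Disjoint x y → Disjoint x z → Disjoint x w → Disjoint y z → Disjoint y w → Disjoint z w →
      Step1Rule G d ⟨DecNT.span A i j x w,
        [nonterminal (DecNT.span B i i' x y), nonterminal (DecNT.span C (i' + 1) j z w)]⟩

/-- Step 1: the initial non-terminals are all the `S_{1,n}^{x,y}`. -/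
def step1 (G : ExtractionGrammar T X) (d : List T) : RuleSystem T (DecNT G.NT X) where
  starts := {N | ∃ x y : Finset (VarOp X), N = DecNT.span G.initial 1 d.length x y}
  rules := {ρ | Step1Rule G d ρ}

/-- Step 2: elimination of useless non-terminals, of epsilon-productions, together with the
non-terminals `A_ε`, which no longer produce a word then, and of unit productions. -/
def step2 (G : ExtractionGrammar T X) (d : List T) : RuleSystem T (DecNT G.NT X) :=
  (step1 G d).removeUseless.removeEpsilon.removeUseless.removeUnit

/-- The rules after step 3: the rules for the fresh start symbol, the rules
`A_{i,i}^{x,y} → (x, i, y)` in place of `A_{i,i}^{x,y} → σ_i`, and the other rules of step 2. -/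
inductive DecRule (G : ExtractionGrammar T X) (d : List T) :
    ContextFreeRule (DecTerminal X) (DecNT G.NT X) → Prop
  | start {N : DecNT G.NT X} :
      N ∈ (step2 G d).starts → DecRule G d ⟨DecNT.start, [nonterminal N]⟩
  | letter {A : G.NT} {i : ℕ} {x y : Finset (VarOp X)} {σ : T} :
      ⟨DecNT.span A i i x y, [terminal σ]⟩ ∈ (step2 G d).rules →
      DecRule G d ⟨DecNT.span A i i x y, [terminal (x, i, y)]⟩
  | other {N : DecNT G.NT X} {α : List (DecNT G.NT X)} :
      ⟨N, α.map nonterminal⟩ ∈ (step2 G d).rules → DecRule G d ⟨N, α.map nonterminal⟩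

/-- The decorated grammar of `G_d`. -/
def decorated (G : ExtractionGrammar T X) (d : List T) :
    RuleSystem (DecTerminal X) (DecNT G.NT X) where
  starts := {DecNT.start}
  rules := {ρ | DecRule G d ρ}

/-! ### Stable non-terminals and the function JUMP -/

/-- `A_{i,j}^{x,y}` is stable if `x_A = x ∪ y`. -/
def Stable (G : ExtractionGrammar T X) : DecNT G.NT X → Prop
  | DecNT.span A _ _ x y => opsOf G A = x ∪ y
  | _ => False

/-- Skippable production rules. The outer superscripts `x'`, `y'` of the right-hand side may be
smaller than the superscripts `x`, `y` of the left-hand side, by the elimination of units. -/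
def Skippable (G : ExtractionGrammar T X)
    (ρ : ContextFreeRule (DecTerminal X) (DecNT G.NT X)) : Prop :=
  ∃ (A B C : G.NT) (i i' j : ℕ) (x y x' z z' y' : Finset (VarOp X)),
    ρ = ⟨DecNT.span A i j x y,
      [nonterminal (DecNT.span B i i' x' z), nonterminal (DecNT.span C (i' + 1) j z' y')]⟩ ∧
    ¬ Stable G (DecNT.span A i j x y) ∧
    z = ∅ ∧ z' = ∅ ∧
    Xor (Stable G (DecNT.span B i i' x' z)) (Stable G (DecNT.span C (i' + 1) j z' y'))

/-- `M` is the non-stable non-terminal of the right-hand side of a skippable rule with left-hand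
side `N`. -/
def Skip (G : ExtractionGrammar T X) (d : List T) (N M : DecNT G.NT X) : Prop :=
  ∃ ρ ∈ (decorated G d).rules, Skippable G ρ ∧ ρ.input = N ∧
    nonterminal M ∈ ρ.output ∧ ¬ Stable G M

/-- `JUMP(N)`: the non-terminals that are reached from `N` by a (possibly empty) sequence of
skippable rules, each following the previous one, and that have a rule that is not skippable. -/
def jump (G : ExtractionGrammar T X) (d : List T) (N : DecNT G.NT X) : Set (DecNT G.NT X) :=
  {M | Relation.ReflTransGen (Skip G d) N M ∧
    ∃ ρ ∈ (decorated G d).rules, ρ.input = M ∧ ¬ Skippable G ρ}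

/-- The pairs `(L, R)` for which `N → L R` is a rule of the decorated grammar that is not
skippable; these are the rules over which APPLYPROD iterates. -/
def nonSkippable (G : ExtractionGrammar T X) (d : List T) (N : DecNT G.NT X) :
    Set (DecNT G.NT X × DecNT G.NT X) :=
  {p | ⟨N, [nonterminal p.1, nonterminal p.2]⟩ ∈ (decorated G d).rules ∧
    ¬ Skippable G ⟨N, [nonterminal p.1, nonterminal p.2]⟩}

/-! ### The algorithm ENUMERATE -/

/-- A pair `(τ, i)` of a variable operation and a position. -/
abbrev Entry (X : Type v) := VarOp X × ℕ

open Classical in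
/-- The subsequence of the non-stable non-terminals. -/
noncomputable def nonStable (G : ExtractionGrammar T X) (α : List (DecNT G.NT X)) :
    List (DecNT G.NT X) :=
  α.filter fun N => decide (¬ Stable G N)

/-- The set `{(τ, i' + 1) | τ ∈ z ∪ z'}` for a right-hand side `B_{i,i'}^{x,z} C_{i'+1,j}^{z',y}`. -/
noncomputable def prodEntries {V : Type} : DecNT V X × DecNT V X → List (Entry X)
  | (DecNT.span _ _ i' _ z, DecNT.span _ _ _ z' _) => (z ∪ z').toList.map fun τ => (τ, i' + 1)
  | _ => []

/-- The set `{(τ, 1) | τ ∈ x} ∪ {(τ, n + 1) | τ ∈ y}` for `S_{1,n}^{x,y}`. -/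
noncomputable def startEntries {V : Type} : DecNT V X → List (Entry X)
  | DecNT.span _ _ n x y =>
      x.toList.map (fun τ => (τ, 1)) ++ y.toList.map (fun τ => (τ, n + 1))
  | _ => []

/-- What ENUMERATE has random access to after the preprocessing: repetition-free lists, in an
arbitrary order, of the `S_{1,n}^{x,y}` in the decorated grammar, of the sets `JUMP(N)`, and of the
non-skippable rules with a given left-hand side. -/
structure Preprocessing (G : ExtractionGrammar T X) (d : List T) where
  starts : List (DecNT G.NT X)
  starts_nodup : starts.Nodup
  mem_starts : ∀ N : DecNT G.NT X, N ∈ starts ↔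
    (∃ x y : Finset (VarOp X), N = DecNT.span G.initial 1 d.length x y) ∧
    ⟨DecNT.start, [nonterminal N]⟩ ∈ (decorated G d).rules
  jumps : DecNT G.NT X → List (DecNT G.NT X)
  jumps_nodup : ∀ N : DecNT G.NT X, (jumps N).Nodup
  mem_jumps : ∀ N M : DecNT G.NT X, M ∈ jumps N ↔ M ∈ jump G d N
  prods : DecNT G.NT X → List (DecNT G.NT X × DecNT G.NT X)
  prods_nodup : ∀ N : DecNT G.NT X, (prods N).Nodup
  mem_prods : ∀ (N : DecNT G.NT X) (p : DecNT G.NT X × DecNT G.NT X),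
    p ∈ prods N ↔ p ∈ nonSkippable G d N

end ExtractionGrammar

namespace Enumerate

open ExtractionGrammar

/-- A suspended `for each` loop, with the elements that are still to be visited. `N` is the type of
non-terminals. -/
inductive Frame (N : Type v) (X : Type v)
  /-- The main loop, over the `S_{1,n}^{x,y}`. -/
  | starts (todo : List N) : Frame N X
  /-- The loop over `JUMP(A)` in the call with the arguments `A · α` and `map`. -/
  | jumps (todo : List N) (α : List N) (map : List (Entry X)) : Frame N X
  /-- The loop over the output of APPLYPROD within that call. -/
  | prods (todo : List (N × N)) (α : List N) (map : List (Entry X)) : Frame N X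

/-- The instruction that is carried out next. -/
inductive Control (N : Type v) (X : Type v)
  /-- Enter `ENUMERATE(α, map)`. -/
  | call (α : List N) (map : List (Entry X)) : Control N X
  /-- Add the pairs `todo` to `map` one by one, then enter `ENUMERATE(α, map)`. -/
  | insert (todo : List (Entry X)) (α : List N) (map : List (Entry X)) : Control N X
  /-- Write the pairs `todo` one by one; when none is left, `map` has been output. -/
  | write (todo : List (Entry X)) (map : List (Entry X)) : Control N X
  /-- Continue with the innermost suspended loop. -/
  | resume : Control N X

/-- A configuration: the next instruction and the stack of suspended loops. -/
structure Config (N : Type v) (X : Type v) where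
  control : Control N X
  stack : List (Frame N X)

variable {T : Type u} {X : Type v} [Fintype X] [DecidableEq X]
  {G : ExtractionGrammar T X} {d : List T}

/-- One elementary step of the algorithm, with the set of pairs that is output in this step, if
there is one. A step inspects and changes a bounded number of cells of linked lists, or starts an
iteration over a list that the preprocessing has stored. The result is `none` iff the algorithm has
halted. -/
noncomputable def step (P : Preprocessing G d) :
    Config (DecNT G.NT X) X → Option (Option (List (Entry X)) × Config (DecNT G.NT X) X)
  | ⟨.call [] map, K⟩ => some (none, ⟨.write map map, K⟩)
  | ⟨.call (A :: α) map, K⟩ => some (none, ⟨.resume, .jumps (P.jumps A) α map :: K⟩)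
  | ⟨.insert (e :: es) α map, K⟩ => some (none, ⟨.insert es α (e :: map), K⟩)
  | ⟨.insert [] α map, K⟩ => some (none, ⟨.call α map, K⟩)
  | ⟨.write (_ :: es) map, K⟩ => some (none, ⟨.write es map, K⟩)
  | ⟨.write [] map, K⟩ => some (some map, ⟨.resume, K⟩)
  | ⟨.resume, .starts (S :: Ss) :: K⟩ =>
      some (none, ⟨.insert (startEntries S) (nonStable G [S]) [], .starts Ss :: K⟩)
  | ⟨.resume, .jumps (B :: Bs) α map :: K⟩ =>
      some (none, ⟨.resume, .prods (P.prods B) α map :: .jumps Bs α map :: K⟩)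
  | ⟨.resume, .prods (p :: ps) α map :: K⟩ =>
      some (none,
        ⟨.insert (prodEntries p) (nonStable G [p.1, p.2] ++ α) map, .prods ps α map :: K⟩)
  | ⟨.resume, .starts [] :: K⟩ => some (none, ⟨.resume, K⟩)
  | ⟨.resume, .jumps [] _ _ :: K⟩ => some (none, ⟨.resume, K⟩)
  | ⟨.resume, .prods [] _ _ :: K⟩ => some (none, ⟨.resume, K⟩)
  | ⟨.resume, []⟩ => none

/-- The configuration in which the main algorithm starts. -/
def init (P : Preprocessing G d) : Config (DecNT G.NT X) X :=
  ⟨.resume, [.starts P.starts]⟩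

/-- `Run P c tr`: started in `c` the algorithm halts, after `tr.length` steps, and `tr` lists what
is output in each step. -/
inductive Run (P : Preprocessing G d) :
    Config (DecNT G.NT X) X → List (Option (List (Entry X))) → Prop
  | halt {c : Config (DecNT G.NT X) X} : step P c = none → Run P c []
  | step {c c' : Config (DecNT G.NT X) X} {o : Option (List (Entry X))}
      {tr : List (Option (List (Entry X)))} :
      step P c = some (o, c') → Run P c' tr → Run P c (o :: tr)

/-- The set of pairs `map` represents `μ`: it is
`{(⊢x, i), (x⊣, j) | x ∈ X, μ(x) = [i, j⟩}`. -/
def Represents {d : List T} (map : List (Entry X)) (μ : SpanMapping X d) : Prop :=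
  ∀ e : Entry X, e ∈ map ↔
    ∃ x : X, e = (VarOp.op x, (μ x).left) ∨ e = (VarOp.cl x, (μ x).right)

/-- A block of steps in which nothing is output. -/
def Silent {α : Type*} (gap : List (Option α)) : Prop := ∀ o ∈ gap, o = none

end Enumerate

/-! ### The data of the preprocessing exist -/

namespace RuleSystem

variable {T : Type*} {N : Type*}

def Within (g : RuleSystem T N) (s : Set N) : Prop :=
  ∀ ρ ∈ g.rules, ρ.input ∈ s ∧ ∀ A : N, Symbol.nonterminal A ∈ ρ.output → A ∈ s

lemma Within.removeUseless {g : RuleSystem T N} {s : Set N} (h : g.Within s) :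
    g.removeUseless.Within s := fun ρ hρ => h ρ hρ.1

lemma DropNullable.subset {g : RuleSystem T N} {α β : List (Symbol T N)}
    (h : g.DropNullable α β) : β ⊆ α := by
  induction h with
  | nil => simp
  | keep s _ ih => exact List.cons_subset_cons s ih
  | drop _ _ ih => exact List.subset_cons_of_subset _ ih

lemma Within.removeEpsilon {g : RuleSystem T N} {s : Set N} (h : g.Within s) :
    g.removeEpsilon.Within s := by
  rintro ρ ⟨-, α, hα, hd⟩
  exact ⟨(h _ hα).1, fun A hA => (h _ hα).2 A (hd.subset hA)⟩

lemma Within.removeUnit {g : RuleSystem T N} {s : Set N} (h : g.Within s) :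
    g.removeUnit.Within s := by
  rintro ρ ⟨-, B, hB, hr⟩
  refine ⟨?_, fun A hA => (h _ hr).2 A hA⟩
  rcases Relation.ReflTransGen.cases_head hB with h0 | ⟨C, hC, -⟩
  · rw [h0]; exact (h _ hr).1
  · exact (h _ hC).1

end RuleSystem

namespace ExtractionGrammar

open Symbol

variable {T : Type u} {X : Type v}

/-- The non-terminals with subscripts at most `n + 1`. -/
def bounded (V : Type) (X : Type v) (n : ℕ) : Set (DecNT V X) :=
  {N | match N with
    | DecNT.span _ i j _ _ => i ≤ n + 1 ∧ j ≤ n + 1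
    | _ => True}

lemma finite_bounded [Fintype X] (V : Type) [Finite V] (n : ℕ) : (bounded V X n).Finite := by
  have h : bounded V X n ⊆ {DecNT.start} ∪ (Set.range fun A : V => DecNT.eps A) ∪
      Set.range (fun p : V × Fin (n + 2) × Fin (n + 2) × Finset (VarOp X) × Finset (VarOp X) =>
        DecNT.span p.1 p.2.1 p.2.2.1 p.2.2.2.1 p.2.2.2.2) := by
    rintro (_ | ⟨A, i, j, x, y⟩ | A) hN
    · simp
    · obtain ⟨hi, hj⟩ : i ≤ n + 1 ∧ j ≤ n + 1 := hN
      exact Or.inr ⟨(A, ⟨i, by omega⟩, ⟨j, by omega⟩, x, y), rfl⟩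
    · simp
  exact (((Set.finite_singleton _).union (Set.finite_range _)).union
    (Set.finite_range _)).subset h

variable [Fintype X] [DecidableEq X]

lemma step1_within (G : ExtractionGrammar T X) (d : List T) :
    (step1 G d).Within (bounded G.NT X d.length) := by
  rintro ρ (hρ : Step1Rule G d ρ)
  cases hρ with
  | letter h =>
    cases h.1 with
    | letter _ h1 h2 =>
      have := (List.getElem?_eq_some_iff.1 h2).1
      simp [bounded]; omega
  | varOp h => simp [bounded]
  | epsEps h => simp [bounded]
  | spanEps h => cases h.1; simp [bounded]; omega
  | epsSpan h => cases h.1; simp [bounded]; omega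
  | split h => cases h.1; simp [bounded]; omega

lemma decorated_within (G : ExtractionGrammar T X) (d : List T) :
    (decorated G d).Within (bounded G.NT X d.length) := by
  have h2 : (step2 G d).Within (bounded G.NT X d.length) :=
    (step1_within G d).removeUseless.removeEpsilon.removeUseless.removeUnit
  rintro ρ (hρ : DecRule G d ρ)
  cases hρ with
  | start h =>
    refine ⟨trivial, fun A hA => ?_⟩
    obtain ⟨⟨⟨x, y, rfl⟩, -⟩, -⟩ := h
    obtain rfl : A = _ := by simpa using hA
    exact ⟨by omega, by omega⟩
  | letter h => exact ⟨(h2 _ h).1, by simp⟩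
  | other h => exact ⟨(h2 _ h).1, fun A hA => (h2 _ h).2 A (by simpa using hA)⟩

theorem preprocessing_nonempty (G : ExtractionGrammar T X) [Finite G.NT] (d : List T) :
    Nonempty (Preprocessing G d) := by
  have key : ∀ {α : Type v} (s : Set α), s.Finite → ∃ l : List α, l.Nodup ∧ ∀ a, a ∈ l ↔ a ∈ s :=
    fun s hs => ⟨hs.toFinset.toList, Finset.nodup_toList _, by simp⟩
  have fin := finite_bounded (X := X) G.NT d.length
  have within := decorated_within G d
  obtain ⟨l, hl, hl'⟩ := key {N : DecNT G.NT X |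
    (∃ x y : Finset (VarOp X), N = DecNT.span G.initial 1 d.length x y) ∧
    ⟨DecNT.start, [nonterminal N]⟩ ∈ (decorated G d).rules}
    (fin.subset fun N hN => (within _ hN.2).2 N (by simp))
  choose J hJ hJ' using fun N : DecNT G.NT X => key (jump G d N)
    (fin.subset fun M hM => by obtain ⟨-, ρ, hρ, rfl, -⟩ := hM; exact (within ρ hρ).1)
  choose R hR hR' using fun N : DecNT G.NT X => key (nonSkippable G d N)
    ((fin.prod fin).subset fun p hp =>
      ⟨(within _ hp.1).2 _ (by simp), (within _ hp.1).2 _ (by simp)⟩)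
  exact ⟨⟨l, hl, hl', J, hJ, hJ', R, hR, hR'⟩⟩

end ExtractionGrammar

/-!
A path of the algorithm is a parse tree in disguise. Consider a parse tree of a non-terminal `A` of
`G` whose ref-word contains the letters `i` to `j` of the document. The variable operations before
the first and after the last letter, `x` and `y`, are determined by the tree, so the tree has a
decorated non-terminal `A^{x,y}_{i,j}` (`dec`). If there is more than one letter, the topmost node
whose two subtrees both contain letters (`core`) splits the tree, and the decorated
non-terminals of the tree and of the two parts form a rule of `dec(G_d)` (`exists_rule`): the unit
productions that have been eliminated are the steps from the root to that node. Conversely, every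
rule whose right-hand side is `L R`, and every pair of trees for `L` and `R`, comes from a tree
(`exists_of_rule`). Hence the trees of `S_{1,n}^{x,y}` are obtained by choosing rules from the top
down, and the operations that such a choice places between two letters are those the algorithm
adds to its map (`between`).

Since `G` is functional, each variable operation occurs once in a produced ref-word. Therefore the
operations of a useful non-terminal do not depend on the derivation, a stable non-terminal has no
operation left to be placed, and a non-stable one has at least one (`remaining`). Since `G` is
unambiguous, a part of a parse tree is determined by its decorated non-terminal and the
operations placed inside it (`IsPart.unique`). The chain of skippable rules that leads from a tree
to its first non-skippable rule is determined by the tree as well (`exists_jumps`,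
`exists_of_jump`). Thus different iterations of the loops of ENUMERATE lead to disjoint sets of
mappings, and the outputs of a call are the mappings that extend `map` by a choice of trees for the
sequence `α`, each once (`lists_solutionsVia`, `exec_call`, `exec_init`).

Since every iteration of a loop leads to an output, the delay is bounded by the nesting depth. After
a sequence of skippable rules, which leaves the operations still to be placed unchanged, a
non-skippable rule either places an operation between its two parts or divides the remaining
operations among two non-stable non-terminals. In both cases the potential
`∑ (2 * remaining - 1)`, taken over the sequence `α`, decreases (`measure_of_jump`). As at most
`2 * k` operations remain, the nesting depth is linear in `k`. The pairs added along a path are at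
most `6 * k` in number, too. Between two outputs the run climbs out of one path and descends along
another, which takes a number of steps linear in `k` (`Paced`, `exec_loop`). For `k = 0` there is
only one mapping, so that no delay between outputs has to be bounded.
-/

/-! ### Productive and useful non-terminals -/

namespace RuleSystem

variable {T : Type*} {N : Type*} {g : RuleSystem T N}

lemma Derives.append_left {α β : List (Symbol T N)} (h : g.Derives α β) (γ : List (Symbol T N)) :
    g.Derives (γ ++ α) (γ ++ β) := by
  induction h with
  | refl => exact .refl
  | tail _ h ih =>
    obtain ⟨ρ, hρ, h⟩ := h
    exact ih.tail ⟨ρ, hρ, h.append_left γ⟩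

lemma Derives.append_right {α β : List (Symbol T N)} (h : g.Derives α β)
    (γ : List (Symbol T N)) : g.Derives (α ++ γ) (β ++ γ) := by
  induction h with
  | refl => exact .refl
  | tail _ h ih =>
    obtain ⟨ρ, hρ, h⟩ := h
    exact ih.tail ⟨ρ, hρ, h.append_right γ⟩

lemma Derives.of_rule {ρ : ContextFreeRule T N} (h : ρ ∈ g.rules) :
    g.Derives [Symbol.nonterminal ρ.input] ρ.output :=
  .single ⟨ρ, h, ContextFreeRule.rewrites_iff.2 ⟨[], [], by simp, by simp⟩⟩

/-- `A` derives a terminal word. -/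
def Productive (g : RuleSystem T N) (A : N) : Prop :=
  ∃ w : List T, g.Derives [Symbol.nonterminal A] (w.map Symbol.terminal)

/-- Properties of non-terminals that are inherited from the right-hand sides of the rules to their
left-hand sides hold throughout every sentential form that derives a terminal word. -/
lemma Derives.forall_of_terminal {P : N → Prop}
    (hP : ∀ ρ ∈ g.rules, (∀ A, Symbol.nonterminal A ∈ ρ.output → P A) → P ρ.input)
    {α : List (Symbol T N)} {w : List T} (h : g.Derives α (w.map Symbol.terminal)) :
    ∀ A, Symbol.nonterminal A ∈ α → P A := by
  induction h using Relation.ReflTransGen.head_induction_on with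
  | refl => simp
  | head h _ ih =>
    obtain ⟨ρ, hρ, h⟩ := h
    obtain ⟨p, q, rfl, rfl⟩ := ContextFreeRule.rewrites_iff.1 h
    intro A hA
    simp only [List.append_assoc, List.mem_append, List.mem_singleton,
      Symbol.nonterminal.injEq] at hA ih
    rcases hA with hA | rfl | hA
    · exact ih A (.inl hA)
    · exact hP ρ hρ fun B hB => ih B (.inr (.inl hB))
    · exact ih A (.inr (.inr hA))

lemma Productive.induction {P : N → Prop}
    (hP : ∀ ρ ∈ g.rules, (∀ A, Symbol.nonterminal A ∈ ρ.output → P A) → P ρ.input)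
    {A : N} (h : g.Productive A) : P A :=
  h.choose_spec.forall_of_terminal hP A (by simp)

lemma exists_derives_terminal {α : List (Symbol T N)}
    (h : ∀ A, Symbol.nonterminal A ∈ α → g.Productive A) :
    ∃ w : List T, g.Derives α (w.map Symbol.terminal) := by
  induction α with
  | nil => exact ⟨[], .refl⟩
  | cons s α ih =>
    obtain ⟨w, hw⟩ := ih fun A hA => h A (List.mem_cons_of_mem _ hA)
    have key : ∃ v : List T, g.Derives [s] (v.map Symbol.terminal) := by
      cases s with
      | terminal t => exact ⟨[t], .refl⟩
      | nonterminal A => exact h A (by simp)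
    obtain ⟨v, hv⟩ := key
    refine ⟨v ++ w, ?_⟩
    rw [List.map_append]
    exact (hv.append_right α).trans (hw.append_left _)

lemma productive_of_rule {ρ : ContextFreeRule T N} (hρ : ρ ∈ g.rules)
    (h : ∀ A, Symbol.nonterminal A ∈ ρ.output → g.Productive A) : g.Productive ρ.input := by
  obtain ⟨w, hw⟩ := exists_derives_terminal h
  exact ⟨w, (Derives.of_rule hρ).trans hw⟩

lemma Useful.productive {A : N} (h : g.Useful A) : g.Productive A := by
  obtain ⟨S, -, α, β, w, -, h⟩ := h
  exact h.forall_of_terminal (fun ρ => productive_of_rule) A (by simp)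

lemma useful_of_start {S : N} (hS : S ∈ g.starts) (h : g.Productive S) : g.Useful S := by
  obtain ⟨w, hw⟩ := h
  exact ⟨S, hS, [], [], w, .refl, hw⟩

lemma Useful.child {ρ : ContextFreeRule T N} (hρ : ρ ∈ g.rules) (hu : g.Useful ρ.input)
    (h : ∀ A, Symbol.nonterminal A ∈ ρ.output → g.Productive A) {A : N}
    (hA : Symbol.nonterminal A ∈ ρ.output) : g.Useful A := by
  obtain ⟨S, hS, α, β, w, h1, h2⟩ := hu
  obtain ⟨γ, δ, hγ⟩ := List.append_of_mem hA
  have h3 : g.Derives (α ++ Symbol.nonterminal ρ.input :: β)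
      ((α ++ γ) ++ Symbol.nonterminal A :: (δ ++ β)) := by
    refine .single ⟨ρ, hρ, ContextFreeRule.rewrites_iff.2 ⟨α, β, by simp, by simp [hγ]⟩⟩
  have h4 := h2.forall_of_terminal (g := g) (fun ρ => productive_of_rule)
  obtain ⟨w', hw'⟩ := exists_derives_terminal
    (g := g) (α := (α ++ γ) ++ Symbol.nonterminal A :: (δ ++ β)) (by
      intro B hB
      have hB' : Symbol.nonterminal B ∈ α ∨ Symbol.nonterminal B ∈ ρ.output ∨
          Symbol.nonterminal B ∈ β := by
        rw [hγ]
        simp only [List.mem_append, List.mem_cons] at hB ⊢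
        tauto
      rcases hB' with hB | hB | hB
      · exact h4 B (by simp [hB])
      · exact h B hB
      · exact h4 B (by simp [hB]))
  exact ⟨S, hS, _, _, w', h1.trans h3, hw'⟩

/-- Properties that hold for the initial non-terminals, and that are inherited from the left-hand
sides of rules to the non-terminals of productive right-hand sides, hold for all useful
non-terminals. -/
lemma Useful.induction {Q : N → Prop} (h0 : ∀ S ∈ g.starts, Q S)
    (hQ : ∀ ρ ∈ g.rules, (∀ A, Symbol.nonterminal A ∈ ρ.output → g.Productive A) → Q ρ.input →
      ∀ A, Symbol.nonterminal A ∈ ρ.output → Q A) {A : N} (h : g.Useful A) : Q A := by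
  obtain ⟨S, hS, α, β, w, h1, h2⟩ := h
  have h3 := h2.forall_of_terminal (g := g) (fun ρ => productive_of_rule)
  have key : ∀ γ, g.Derives [Symbol.nonterminal S] γ →
      (∀ A, Symbol.nonterminal A ∈ γ → g.Productive A) →
      ∀ A, Symbol.nonterminal A ∈ γ → Q A := by
    intro γ hγ
    induction hγ with
    | refl =>
      intro _ A hA
      obtain rfl : A = S := by simpa using hA
      exact h0 _ hS
    | tail _ h ih =>
      obtain ⟨ρ, hρ, h⟩ := h
      obtain ⟨p, q, rfl, rfl⟩ := ContextFreeRule.rewrites_iff.1 h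
      intro hp
      have hp' : ∀ A, Symbol.nonterminal A ∈ ρ.output → g.Productive A :=
        fun A hA => hp A (by simp [hA])
      have ih := ih fun A hA => by
        simp only [List.append_assoc, List.mem_append, List.mem_singleton,
          Symbol.nonterminal.injEq] at hA
        rcases hA with hA | rfl | hA
        · exact hp A (by simp [hA])
        · exact productive_of_rule hρ hp'
        · exact hp A (by simp [hA])
      intro A hA
      simp only [List.append_assoc, List.mem_append] at hA
      rcases hA with hA | hA | hA
      · exact ih A (by simp [hA])
      · exact hQ ρ hρ hp' (ih _ (by simp)) A hA
      · exact ih A (by simp [hA])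
  exact key _ h1 h3 A (by simp)

lemma mem_removeUseless {ρ : ContextFreeRule T N} (hρ : ρ ∈ g.rules) (hu : g.Useful ρ.input)
    (h : ∀ A, Symbol.nonterminal A ∈ ρ.output → g.Productive A) : ρ ∈ g.removeUseless.rules :=
  ⟨hρ, hu, fun _ hA => hu.child hρ h hA⟩

end RuleSystem

/-! ### Positions of the variable operations in a ref-word -/

namespace RefWord

open ExtractionGrammar

variable {T : Type u} {X : Type v}

@[simp] lemma clean_nil : clean ([] : List (ExtLetter T X)) = [] := rfl

@[simp] lemma clean_cons_inl (σ : T) (r : List (ExtLetter T X)) :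
    clean (Sum.inl σ :: r) = σ :: clean r := rfl

@[simp] lemma clean_cons_inr (τ : VarOp X) (r : List (ExtLetter T X)) :
    clean (Sum.inr τ :: r) = clean r := rfl

@[simp] lemma clean_append (r s : List (ExtLetter T X)) :
    clean (r ++ s) = clean r ++ clean s := List.filterMap_append

/-- The pairs `(τ, p)` of the variable operations `τ` in a ref-word and their positions `p`, which
are counted from `b` and increased by the letters only. -/
def entries : ℕ → List (ExtLetter T X) → List (Entry X)
  | _, [] => []
  | b, Sum.inl _ :: r => entries (b + 1) r
  | b, Sum.inr τ :: r => (τ, b) :: entries b r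

@[simp] lemma entries_append (b : ℕ) (r s : List (ExtLetter T X)) :
    entries b (r ++ s) = entries b r ++ entries (b + (clean r).length) s := by
  induction r generalizing b with
  | nil => simp [entries]
  | cons a r ih => cases a <;> simp [entries, ih, Nat.add_assoc, Nat.add_comm 1]

lemma entries_add (b c : ℕ) (r : List (ExtLetter T X)) :
    entries (b + c) r = (entries b r).map fun e => (e.1, e.2 + c) := by
  induction r generalizing b with
  | nil => simp [entries]
  | cons a r ih =>
    cases a with
    | inl σ =>
      simp only [entries]
      rw [← ih, Nat.add_right_comm]
    | inr τ => simp [entries, ih]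

lemma le_of_mem_entries {b : ℕ} {r : List (ExtLetter T X)} {e : Entry X}
    (h : e ∈ entries b r) : b ≤ e.2 ∧ e.2 ≤ b + (clean r).length := by
  induction r generalizing b with
  | nil => simp [entries] at h
  | cons a r ih =>
    cases a with
    | inl σ => have := ih h; simp; omega
    | inr τ =>
      simp only [entries, List.mem_cons] at h
      rcases h with rfl | h
      · simp
      · simpa using ih h

/-- The variable operations in a ref-word, from left to right. -/
def ops (r : List (ExtLetter T X)) : List (VarOp X) := r.filterMap Sum.getRight?

@[simp] lemma ops_nil : ops ([] : List (ExtLetter T X)) = [] := rfl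

@[simp] lemma ops_cons_inl (σ : T) (r : List (ExtLetter T X)) :
    ops (Sum.inl σ :: r) = ops r := rfl

@[simp] lemma ops_cons_inr (τ : VarOp X) (r : List (ExtLetter T X)) :
    ops (Sum.inr τ :: r) = τ :: ops r := rfl

@[simp] lemma ops_append (r s : List (ExtLetter T X)) :
    ops (r ++ s) = ops r ++ ops s := List.filterMap_append

@[simp] lemma mem_ops {τ : VarOp X} {r : List (ExtLetter T X)} : τ ∈ ops r ↔ Sum.inr τ ∈ r := by
  induction r with
  | nil => simp
  | cons a r ih => cases a <;> simp [ih]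

lemma map_fst_entries (b : ℕ) (r : List (ExtLetter T X)) :
    (entries b r).map Prod.fst = ops r := by
  induction r generalizing b with
  | nil => simp [entries]
  | cons a r ih => cases a <;> simp [entries, ih]

lemma mem_iff_exists_entries {b : ℕ} {τ : VarOp X} {r : List (ExtLetter T X)} :
    Sum.inr τ ∈ r ↔ ∃ p, (τ, p) ∈ entries b r := by
  rw [← mem_ops, ← map_fst_entries b]
  simp

lemma entries_unique {b p q : ℕ} {τ : VarOp X} {r : List (ExtLetter T X)} (h : (ops r).Nodup)
    (hp : (τ, p) ∈ entries b r) (hq : (τ, q) ∈ entries b r) : p = q := by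
  rw [← map_fst_entries b] at h
  exact congrArg Prod.snd (List.inj_on_of_nodup_map h hp hq rfl)

lemma Valid.nodup_ops {r : List (ExtLetter T X)} (h : Valid r) : (ops r).Nodup := by
  classical
  rw [List.nodup_iff_count_le_one]
  rintro (x | x)
  all_goals
    obtain ⟨r₁, r₂, r₃, rfl, h1, h2⟩ := h x
    simp only [List.mem_append, not_or, ← mem_ops] at h1 h2
    simp [List.count_eq_zero_of_not_mem h1.1.1, List.count_eq_zero_of_not_mem h1.1.2,
      List.count_eq_zero_of_not_mem h1.2, List.count_eq_zero_of_not_mem h2.1.1,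
      List.count_eq_zero_of_not_mem h2.1.2, List.count_eq_zero_of_not_mem h2.2]

lemma Valid.mem {r : List (ExtLetter T X)} (h : Valid r) (τ : VarOp X) : Sum.inr τ ∈ r := by
  cases τ with
  | op x => obtain ⟨r₁, r₂, r₃, rfl, -⟩ := h x; simp
  | cl x => obtain ⟨r₁, r₂, r₃, rfl, -⟩ := h x; simp

/-- The mapping of a valid ref-word is given by the positions of its variable operations. -/
lemma Valid.encodes_iff {d : List T} {r : List (ExtLetter T X)} (h : Valid r)
    (μ : SpanMapping X d) : Encodes r μ ↔ Enumerate.Represents (entries 1 r) μ := by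
  constructor
  · intro hμ
    have key : ∀ x, (VarOp.op x, (μ x).left) ∈ entries 1 r ∧
        (VarOp.cl x, (μ x).right) ∈ entries 1 r := by
      intro x
      obtain ⟨r₁, r₂, r₃, rfl, h1, h2⟩ := hμ x
      simp only [entries_append, entries, List.mem_append, List.mem_cons, Prod.mk.injEq, true_and]
      constructor
      · right; left; omega
      · right; right; right; left; omega
    intro e
    constructor
    · obtain ⟨τ | τ, p⟩ := e
      · intro he
        exact ⟨τ, .inl (by rw [entries_unique h.nodup_ops he (key τ).1])⟩
      · intro he
        exact ⟨τ, .inr (by rw [entries_unique h.nodup_ops he (key τ).2])⟩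
    · rintro ⟨x, rfl | rfl⟩
      exacts [(key x).1, (key x).2]
  · intro hμ x
    obtain ⟨r₁, r₂, r₃, rfl, -⟩ := h x
    have h1 := (hμ (VarOp.op x, 1 + (clean r₁).length)).1 (by simp [entries])
    have h2 := (hμ (VarOp.cl x, 1 + (clean r₁).length + (clean r₂).length)).1
      (by simp [entries])
    simp only [Prod.mk.injEq, VarOp.op.injEq, VarOp.cl.injEq, reduceCtorEq, false_and, or_false,
      false_or] at h1 h2
    obtain ⟨y, rfl, h1⟩ := h1
    obtain ⟨y, rfl, h2⟩ := h2
    exact ⟨r₁, r₂, r₃, rfl, by omega, by omega⟩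

lemma Valid.exists_encodes {r : List (ExtLetter T X)} (h : Valid r) {d : List T}
    (hd : clean r = d) : ∃ μ : SpanMapping X d, Encodes r μ := by
  have key : ∀ x, ∃ s : Span d, ∃ r₁ r₂ r₃ : List (ExtLetter T X),
      r = r₁ ++ Sum.inr (VarOp.op x) :: (r₂ ++ Sum.inr (VarOp.cl x) :: r₃) ∧
      s.left = (clean r₁).length + 1 ∧ s.right = s.left + (clean r₂).length := by
    intro x
    obtain ⟨r₁, r₂, r₃, rfl, -⟩ := h x
    subst hd
    exact ⟨⟨(clean r₁).length + 1, (clean r₁).length + 1 + (clean r₂).length, by omega, by omega,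
      by simp; omega⟩, r₁, r₂, r₃, rfl, rfl, rfl⟩
  choose μ hμ using key
  exact ⟨μ, hμ⟩

lemma _root_.Enumerate.Represents.injective {d : List T} {m m' : List (Entry X)}
    {μ μ' : SpanMapping X d} (h : Enumerate.Represents m μ) (h' : Enumerate.Represents m' μ')
    (hm : ∀ e, e ∈ m ↔ e ∈ m') : μ = μ' := by
  funext x
  have h1 := (h' _).1 ((hm _).1 ((h (VarOp.op x, (μ x).left)).2 ⟨x, .inl rfl⟩))
  have h2 := (h' _).1 ((hm _).1 ((h (VarOp.cl x, (μ x).right)).2 ⟨x, .inr rfl⟩))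
  simp only [Prod.mk.injEq, VarOp.op.injEq, VarOp.cl.injEq, reduceCtorEq, false_and, or_false,
      false_or] at h1 h2
  obtain ⟨y, rfl, h1⟩ := h1
  obtain ⟨y, rfl, h2⟩ := h2
  exact Span.ext h1 h2

lemma _root_.Enumerate.Represents.congr {d : List T} {m m' : List (Entry X)}
    {μ : SpanMapping X d} (h : Enumerate.Represents m μ)
    (hm : ∀ e, e ∈ m' ↔ e ∈ m) : Enumerate.Represents m' μ := fun e => (hm e).trans (h e)

end RefWord

/-! ### Binary parse trees -/

/-- Parse trees of a grammar in Chomsky normal form. -/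
inductive PTree (T : Type*) (V : Type*)
  | leaf (A : V) (t : T) : PTree T V
  | node (A : V) (l r : PTree T V) : PTree T V

namespace PTree

open Symbol

variable {T : Type*} {V : Type*}

/-- The label of the root. -/
def root : PTree T V → V
  | leaf A _ => A
  | node A _ _ => A

@[simp] lemma root_leaf (A : V) (t : T) : (leaf A t).root = A := rfl

@[simp] lemma root_node (A : V) (l r : PTree T V) : (node A l r).root = A := rfl

/-- The word of the terminals at the leaves. -/
def yield : PTree T V → List T
  | leaf _ t => [t]
  | node _ l r => l.yield ++ r.yield

/-- Every node together with its children is an instance of a production rule. -/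
def Follows (R : Set (ContextFreeRule T V)) : PTree T V → Prop
  | leaf A t => ⟨A, [terminal t]⟩ ∈ R
  | node A l r => ⟨A, [nonterminal l.root, nonterminal r.root]⟩ ∈ R ∧ l.Follows R ∧ r.Follows R

/-- The number of nodes. -/
def size : PTree T V → ℕ
  | leaf _ _ => 1
  | node _ l r => l.size + r.size + 1

/-- The forest that consists of a binary tree followed by a given forest. -/
def toForest : PTree T V → Forest T V → Forest T V
  | leaf A t, f => .node A (.leaf t .nil) f
  | node A l r, f => .node A (l.toForest (r.toForest .nil)) f

lemma roots_toForest (t : PTree T V) (f : Forest T V) :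
    (t.toForest f).roots = nonterminal t.root :: f.roots := by
  cases t <;> rfl

lemma yield_toForest (t : PTree T V) (f : Forest T V) :
    (t.toForest f).yield = t.yield ++ f.yield := by
  induction t generalizing f with
  | leaf A t => rfl
  | node A l r ihl ihr => simp [toForest, Forest.yield, ihl, ihr, yield]

lemma follows_toForest {R : Set (ContextFreeRule T V)} {t : PTree T V} {f : Forest T V} :
    (t.toForest f).Follows R ↔ t.Follows R ∧ f.Follows R := by
  induction t generalizing f with
  | leaf A t => simp [toForest, Forest.Follows, Follows, Forest.roots]
  | node A l r ihl ihr =>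
    simp [toForest, Forest.Follows, Follows, roots_toForest, ihl, ihr, Forest.roots, and_assoc]

lemma toForest_injective {s t : PTree T V} {f f' : Forest T V}
    (h : s.toForest f = t.toForest f') : s = t ∧ f = f' := by
  induction s generalizing t f f' with
  | leaf A a =>
    cases t with
    | leaf B b => simp [toForest] at h; simp [h]
    | node B l r => cases l <;> simp [toForest] at h
  | node A l r ihl ihr =>
    cases t with
    | leaf B b => cases l <;> simp [toForest] at h
    | node B l' r' =>
      simp only [toForest, Forest.node.injEq] at h
      obtain ⟨rfl, h, rfl⟩ := h
      obtain ⟨rfl, h'⟩ := ihl h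
      obtain ⟨rfl, -⟩ := ihr h'
      exact ⟨rfl, rfl⟩

lemma isParseTree {G : ContextFreeGrammar T} {t : PTree T G.NT} (h : t.Follows ↑G.rules)
    (hr : t.root = G.initial) : IsParseTree G t.yield (t.toForest .nil) :=
  ⟨by simp [roots_toForest, hr, Forest.roots], follows_toForest.2 ⟨h, trivial⟩,
    by simp [yield_toForest, Forest.yield]⟩

lemma derives {G : ContextFreeGrammar T} {t : PTree T G.NT} (h : t.Follows ↑G.rules) :
    G.Derives [nonterminal t.root] (t.yield.map terminal) := by
  induction t with
  | leaf A t => exact .single ⟨_, h, ContextFreeRule.Rewrites.input_output⟩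
  | node A l r ihl ihr =>
    obtain ⟨h, hl, hr⟩ := h
    refine .head (b := [nonterminal l.root, nonterminal r.root])
      ⟨_, h, ContextFreeRule.Rewrites.input_output⟩ ?_
    have h1 := (ihl hl).append_right [nonterminal r.root]
    have h2 := (ihr hr).append_left (l.yield.map terminal)
    simpa [yield] using h1.trans h2

lemma mem_language {G : ContextFreeGrammar T} {t : PTree T G.NT} (h : t.Follows ↑G.rules)
    (hr : t.root = G.initial) : t.yield ∈ G.language := by
  rw [ContextFreeGrammar.mem_language_iff, ← hr]
  exact derives h

/-- The word `w` is read off a sequence of terminals and of trees with the given roots. -/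
inductive Reads (R : Set (ContextFreeRule T V)) : List (Symbol T V) → List T → Prop
  | nil : Reads R [] []
  | terminal (t : T) {α w} : Reads R α w → Reads R (terminal t :: α) (t :: w)
  | nonterminal {t : PTree T V} {α w} : t.Follows R → Reads R α w →
      Reads R (nonterminal t.root :: α) (t.yield ++ w)

lemma Reads.append {R : Set (ContextFreeRule T V)} {α β : List (Symbol T V)} {w w' : List T}
    (h : Reads R α w) (h' : Reads R β w') : Reads R (α ++ β) (w ++ w') := by
  induction h with
  | nil => exact h'
  | terminal t _ ih => exact .terminal t ih
  | nonterminal ht _ ih => rw [List.append_assoc]; exact .nonterminal ht ih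

lemma Reads.exists_append {R : Set (ContextFreeRule T V)} {α β : List (Symbol T V)} {w : List T}
    (h : Reads R (α ++ β) w) : ∃ u v, w = u ++ v ∧ Reads R α u ∧ Reads R β v := by
  induction α generalizing w with
  | nil => exact ⟨[], w, rfl, .nil, h⟩
  | cons s α ih =>
    cases h with
    | terminal t h =>
      obtain ⟨u, v, rfl, h1, h2⟩ := ih h
      exact ⟨t :: u, v, rfl, .terminal t h1, h2⟩
    | nonterminal ht h =>
      obtain ⟨u, v, rfl, h1, h2⟩ := ih h
      exact ⟨_, v, (List.append_assoc ..).symm, .nonterminal ht h1, h2⟩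

lemma reads_terminal (R : Set (ContextFreeRule T V)) (w : List T) :
    Reads R (w.map Symbol.terminal) w := by
  induction w with
  | nil => exact .nil
  | cons a w ih => exact .terminal a ih

/-- Every rule produces two non-terminals or one terminal. -/
def Binary (R : Set (ContextFreeRule T V)) : Prop :=
  ∀ ρ ∈ R, (∃ B C, ρ.output = [nonterminal B, nonterminal C]) ∨ ∃ t, ρ.output = [terminal t]

lemma Reads.rule {R : Set (ContextFreeRule T V)} (hR : Binary R) {ρ : ContextFreeRule T V}
    (hρ : ρ ∈ R) {w : List T} (h : Reads R ρ.output w) :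
    ∃ t : PTree T V, t.Follows R ∧ t.root = ρ.input ∧ t.yield = w := by
  obtain ⟨A, α⟩ := ρ
  rcases hR _ hρ with ⟨B, C, hα⟩ | ⟨a, hα⟩
  · obtain rfl : α = _ := hα
    cases h with
    | @nonterminal l _ _ hl h =>
      cases h with
      | @nonterminal r _ _ hr h =>
        cases h
        exact ⟨.node A l r, ⟨hρ, hl, hr⟩, rfl, by simp [yield]⟩
  · obtain rfl : α = _ := hα
    cases h with
    | terminal _ h =>
      cases h
      exact ⟨.leaf A a, hρ, rfl, rfl⟩

lemma exists_of_derives {G : ContextFreeGrammar T}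
    (hG : Binary (↑G.rules : Set (ContextFreeRule T G.NT))) {A : G.NT} {w : List T}
    (h : G.Derives [nonterminal A] (w.map terminal)) :
    ∃ t : PTree T G.NT, t.Follows ↑G.rules ∧ t.root = A ∧ t.yield = w := by
  have key : ∀ α, G.Derives α (w.map terminal) → Reads ↑G.rules α w := by
    intro α h
    induction h using Relation.ReflTransGen.head_induction_on with
    | refl => exact reads_terminal _ w
    | head h _ ih =>
      obtain ⟨ρ, hρ, h⟩ := h
      obtain ⟨p, q, rfl, rfl⟩ := ContextFreeRule.rewrites_iff.1 h
      obtain ⟨u, v, rfl, h1, h2⟩ := ih.exists_append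
      obtain ⟨u, u', rfl, h0, h3⟩ := h1.exists_append
      obtain ⟨t, ht, htr, rfl⟩ := h3.rule hG hρ
      have h4 : Reads (↑G.rules) [Symbol.nonterminal ρ.input] t.yield := by
        rw [← htr]
        simpa using Reads.nonterminal ht .nil
      exact (h0.append h4).append h2
  have h' := key _ h
  clear h key
  cases h' with
  | @nonterminal t _ _ ht h =>
    cases h
    exact ⟨t, ht, rfl, by simp⟩

end PTree

/-! ### Functional and unambiguous grammars -/

namespace ExtractionGrammar

open Symbol RefWord

variable {T : Type u} {X : Type v}

/-- Parse trees of ref-words. -/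
abbrev RefTree (G : ExtractionGrammar T X) := PTree (ExtLetter T X) G.NT

/-- The letters at the leaves of a parse tree. -/
abbrev letters {G : ExtractionGrammar T X} (t : RefTree G) : List T := clean t.yield

/-- `S ⇒* u A v` for ref-words `u`, `v`, where the function `plug` completes a parse tree with root
`A` to a parse tree with root `S`. -/
def Reachable (G : ExtractionGrammar T X) (A : G.NT) : Prop :=
  ∃ (plug : RefTree G → RefTree G) (u v : List (ExtLetter T X)), plug.Injective ∧
    ∀ t : RefTree G, t.Follows ↑G.rules → t.root = A →
      (plug t).Follows ↑G.rules ∧ (plug t).root = G.initial ∧ (plug t).yield = u ++ t.yield ++ v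

variable {G : ExtractionGrammar T X}

@[simp] lemma letters_node (A : G.NT) (l r : RefTree G) :
    letters (.node A l r) = letters l ++ letters r := by
  simp [letters, PTree.yield]

lemma IsCNF.binary (h : IsCNF G) :
    PTree.Binary (↑G.rules : Set (ContextFreeRule (ExtLetter T X) G.NT)) := h

lemma reachable_initial : Reachable G G.initial :=
  ⟨id, [], [], Function.injective_id, fun t ht hr => ⟨ht, hr, by simp⟩⟩

lemma Reachable.left {A B : G.NT} {s : RefTree G} (h : Reachable G A)
    (hR : ⟨A, [nonterminal B, nonterminal s.root]⟩ ∈ G.rules) (hs : s.Follows ↑G.rules) :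
    Reachable G B := by
  obtain ⟨plug, u, v, hp, h⟩ := h
  refine ⟨fun t => plug (.node A t s), u, s.yield ++ v, fun t t' htt => ?_, fun t ht hr => ?_⟩
  · simpa using hp htt
  · subst hr
    simpa [PTree.yield] using h (.node A t s) ⟨hR, ht, hs⟩ rfl

lemma Reachable.right {A C : G.NT} {s : RefTree G} (h : Reachable G A)
    (hR : ⟨A, [nonterminal s.root, nonterminal C]⟩ ∈ G.rules) (hs : s.Follows ↑G.rules) :
    Reachable G C := by
  obtain ⟨plug, u, v, hp, h⟩ := h
  refine ⟨fun t => plug (.node A s t), u ++ s.yield, v, fun t t' htt => ?_, fun t ht hr => ?_⟩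
  · simpa using hp htt
  · subst hr
    simpa [PTree.yield] using h (.node A s t) ⟨hR, hs, ht⟩ rfl

lemma Reachable.nodup_ops (hf : IsFunctional G) {t : RefTree G} (h : Reachable G t.root)
    (ht : t.Follows ↑G.rules) : (ops t.yield).Nodup := by
  obtain ⟨plug, u, v, -, h⟩ := h
  obtain ⟨h1, h2, h3⟩ := h t ht rfl
  have := (hf _ (PTree.mem_language h1 h2)).nodup_ops
  simp only [h3, ops_append, List.nodup_append] at this
  exact this.1.2.1

lemma Reachable.mem_yield_iff (hf : IsFunctional G) {A : G.NT} (h : Reachable G A)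
    {t t' : RefTree G} (hA : t.root = A) (hA' : t'.root = A) (ht : t.Follows ↑G.rules)
    (ht' : t'.Follows ↑G.rules) {τ : VarOp X} (hτ : Sum.inr τ ∈ t.yield) :
    Sum.inr τ ∈ t'.yield := by
  obtain ⟨plug, u, v, -, h⟩ := h
  obtain ⟨h1, h2, h3⟩ := h t ht hA
  obtain ⟨h1', h2', h3'⟩ := h t' ht' hA'
  have hn := (hf _ (PTree.mem_language h1 h2)).nodup_ops
  have hm := (hf _ (PTree.mem_language h1' h2')).mem τ
  simp only [h3, ops_append, List.nodup_append] at hn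
  simp only [h3', List.mem_append] at hm
  rw [← mem_ops] at hτ
  rcases hm with (hm | hm) | hm
  · exact absurd rfl (hn.1.2.2 τ (mem_ops.2 hm) τ hτ)
  · exact hm
  · exact absurd rfl (hn.2.2 τ (List.mem_append_right _ hτ) τ (mem_ops.2 hm))

/-- In an unambiguous functional grammar, a parse tree of a reachable non-terminal is determined by
its letters and the positions of its variable operations. -/
lemma Reachable.tree_unique (hf : IsFunctional G) (hu : IsUnambiguous G) {t t' : RefTree G}
    (h : Reachable G t.root) (hr : t'.root = t.root) (ht : t.Follows ↑G.rules)
    (ht' : t'.Follows ↑G.rules) (hl : letters t = letters t') {b : ℕ}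
    (he : ∀ e, e ∈ entries b t.yield ↔ e ∈ entries b t'.yield) : t = t' := by
  obtain ⟨plug, u, v, hp, h⟩ := h
  obtain ⟨h1, h2, h3⟩ := h t ht rfl
  obtain ⟨h1', h2', h3'⟩ := h t' ht' hr
  have hL := PTree.mem_language h1 h2
  have hL' := PTree.mem_language h1' h2'
  have hc : clean (plug t').yield = clean (plug t).yield := by simp [h3, h3', hl]
  obtain ⟨μ, hμ⟩ := (hf _ hL).exists_encodes rfl
  -- Both completions have the same letters and the same positions of their variable operations.
  have hμ' : Encodes (plug t').yield μ := by
    rw [(hf _ hL').encodes_iff]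
    refine (((hf _ hL).encodes_iff μ).1 hμ).congr fun e => ?_
    have key : ∀ c e, e ∈ entries c t.yield ↔ e ∈ entries c t'.yield := by
      have h0 : ∀ e, e ∈ entries 0 t.yield ↔ e ∈ entries 0 t'.yield := by
        rintro ⟨τ, p⟩
        have := he (τ, p + b)
        rw [show b = 0 + b by simp, entries_add, entries_add] at this
        simpa using this
      intro c e
      rw [show c = 0 + c by simp, entries_add, entries_add]
      simp only [List.mem_map, h0]
    have hl : (clean t'.yield).length = (clean t.yield).length := congrArg List.length hl.symm
    simp [h3, h3', key, hl]
  have hmem : (plug t).yield ∈ refWords G (clean (plug t).yield) := ⟨hL, hf _ hL, rfl⟩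
  have hmem' : (plug t').yield ∈ refWords G (clean (plug t).yield) := ⟨hL', hf _ hL', hc⟩
  obtain ⟨r, -, hr, s, -, hs⟩ := hu _ μ ⟨_, hmem, hμ⟩
  have e1 := hr _ hmem hμ
  have e2 := hr _ hmem' hμ'
  have f1 := hs _ (e1 ▸ PTree.isParseTree h1 h2)
  have f2 := hs _ (e2 ▸ PTree.isParseTree h1' h2')
  exact hp (PTree.toForest_injective (f1.trans f2.symm)).1

variable [Fintype X] [DecidableEq X]

omit [DecidableEq X] in
lemma mem_opsOf_of_tree {t : RefTree G} (ht : t.Follows ↑G.rules) {τ : VarOp X}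
    (hτ : Sum.inr τ ∈ t.yield) : τ ∈ opsOf G t.root := by
  classical
  simp only [opsOf, Finset.mem_filter, Finset.mem_univ, true_and]
  exact ⟨_, PTree.derives ht, hτ⟩

omit [DecidableEq X] in
/-- If a reachable non-terminal of a functional grammar is the root of some parse tree, then each of
its variable operations occurs in this parse tree. -/
lemma Reachable.mem_opsOf (hc : IsCNF G) (hf : IsFunctional G) {t : RefTree G}
    (h : Reachable G t.root) (ht : t.Follows ↑G.rules) {τ : VarOp X} :
    τ ∈ opsOf G t.root ↔ Sum.inr τ ∈ t.yield := by
  classical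
  refine ⟨fun hτ => ?_, mem_opsOf_of_tree ht⟩
  simp only [opsOf, Finset.mem_filter, Finset.mem_univ, true_and] at hτ
  obtain ⟨r, hr, hτ⟩ := hτ
  obtain ⟨t', ht', hr', rfl⟩ := PTree.exists_of_derives hc.binary hr
  exact h.mem_yield_iff hf hr' rfl ht' ht hτ

/-! ### Positioned parse trees and their decorations -/

/-- The variable operations at position `p` of a ref-word whose positions are counted from `b`. -/
def opsAt (b p : ℕ) (r : List (ExtLetter T X)) : Finset (VarOp X) :=
  (((entries b r).filter fun e => e.2 = p).map Prod.fst).toFinset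

omit [Fintype X] in
@[simp] lemma mem_opsAt {b p : ℕ} {r : List (ExtLetter T X)} {τ : VarOp X} :
    τ ∈ opsAt b p r ↔ (τ, p) ∈ entries b r := by
  simp [opsAt]

/-- A parse tree together with the position in the document at which its first letter stands. -/
abbrev PosTree (G : ExtractionGrammar T X) := ℕ × RefTree G

/-- The position behind the last letter. -/
def endPos (p : PosTree G) : ℕ := p.1 + (letters p.2).length

/-- The non-terminal `A_{i,j}^{x,y}` of the root: `x` and `y` are the variable operations before the
first and after the last letter. It is meaningful only for trees that have letters; the others
belong to the non-terminals `A_ε`. -/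
def dec (p : PosTree G) : DecNT G.NT X :=
  .span p.2.root p.1 (endPos p - 1) (opsAt p.1 p.1 p.2.yield) (opsAt p.1 (endPos p) p.2.yield)

/-- The variable operations that are neither before the first nor after the last letter, with their
positions. -/
def inner (p : PosTree G) : Finset (Entry X) :=
  (entries p.1 p.2.yield).toFinset.filter fun e => p.1 < e.2 ∧ e.2 < endPos p

omit [Fintype X] in
@[simp] lemma mem_inner {p : PosTree G} {e : Entry X} :
    e ∈ inner p ↔ e ∈ entries p.1 p.2.yield ∧ p.1 < e.2 ∧ e.2 < endPos p := by
  simp [inner]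

/-- A parse tree for a non-empty factor of the document `d`, at its position in `d`. -/
structure IsPart (d : List T) (p : PosTree G) : Prop where
  follows : p.2.Follows ↑G.rules
  letters_ne : letters p.2 ≠ []
  factor : ∃ u v, d = u ++ letters p.2 ++ v ∧ u.length + 1 = p.1

/-- The two subtrees at the topmost node both of whose subtrees have letters, if there is such a
node. The tree is at position `i`, and the subtrees are returned with their positions. -/
def core : RefTree G → ℕ → Option (PosTree G × PosTree G)
  | .leaf _ _, _ => none
  | .node _ l r, i =>
    if letters l = [] then core r i
    else if letters r = [] then core l i
    else some ((i, l), (i + (letters l).length, r))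

omit [Fintype X] [DecidableEq X] in
lemma entries_of_clean_eq_nil {b : ℕ} {r : List (ExtLetter T X)} (h : clean r = []) {e : Entry X}
    (he : e ∈ entries b r) : e.2 = b := by
  have := le_of_mem_entries he
  simp [h] at this
  omega

omit [Fintype X] [DecidableEq X] in
lemma core_spec {t : RefTree G} {i : ℕ} {l r : PosTree G} (h : core t i = some (l, r))
    (ht : t.Follows ↑G.rules) :
    l.2.Follows ↑G.rules ∧ r.2.Follows ↑G.rules ∧ letters l.2 ≠ [] ∧ letters r.2 ≠ [] ∧
    letters t = letters l.2 ++ letters r.2 ∧ l.1 = i ∧ r.1 = endPos l ∧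
    l.2.size < t.size ∧ r.2.size < t.size ∧
    ∃ E E' : List (Entry X), (∀ e ∈ E, e.2 = i) ∧
      (∀ e ∈ E', e.2 = i + (letters t).length) ∧
      entries i t.yield = E ++ (entries l.1 l.2.yield ++ entries r.1 r.2.yield) ++ E' := by
  induction t with
  | leaf A a => simp [core] at h
  | node A s s' ihs ihs' =>
    obtain ⟨-, hs, hs'⟩ := ht
    rw [core] at h
    split_ifs at h with h1 h2
    · obtain ⟨a1, a2, a3, a4, a5, a6, a7, a8, a9, E, E', a10, a11, a12⟩ := ihs' h hs'
      refine ⟨a1, a2, a3, a4, by simp [h1, a5], a6, a7, by simp [PTree.size]; omega,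
        by simp [PTree.size]; omega, entries i s.yield ++ E, E', ?_, ?_, ?_⟩
      · intro e he
        rcases List.mem_append.1 he with he | he
        · exact entries_of_clean_eq_nil h1 he
        · exact a10 e he
      · simpa [h1] using a11
      · simp [PTree.yield, h1, a12]
    · obtain ⟨a1, a2, a3, a4, a5, a6, a7, a8, a9, E, E', a10, a11, a12⟩ := ihs h hs
      refine ⟨a1, a2, a3, a4, by simp [h2, a5], a6, a7, by simp [PTree.size]; omega,
        by simp [PTree.size]; omega, E,
        E' ++ entries (i + (letters s).length) s'.yield, a10, ?_, ?_⟩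
      · intro e he
        rcases List.mem_append.1 he with he | he
        · simpa [h2] using a11 e he
        · simpa [h2] using entries_of_clean_eq_nil h2 he
      · simp [PTree.yield, a12]
    · obtain ⟨rfl, rfl⟩ := by simpa using h
      exact ⟨hs, hs', h1, h2, by simp, rfl, rfl, by simp only [PTree.size]; omega,
        by simp only [PTree.size]; omega, [], [], by simp, by simp, by simp [PTree.yield]⟩

variable {d : List T}

omit [Fintype X] [DecidableEq X] in
lemma IsPart.lt_endPos {p : PosTree G} (h : IsPart d p) : p.1 < endPos p := by
  have := List.length_pos_of_ne_nil h.letters_ne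
  simp [endPos]; omega

omit [Fintype X] [DecidableEq X] in
lemma IsPart.core {p l r : PosTree G} (h : IsPart d p) (hc : core p.2 p.1 = some (l, r)) :
    IsPart d l ∧ IsPart d r := by
  obtain ⟨a1, a2, a3, a4, a5, a6, a7, -⟩ := core_spec hc h.follows
  obtain ⟨u, v, rfl, hu⟩ := h.factor
  exact ⟨⟨a1, a3, u, letters r.2 ++ v, by simp [a5], by omega⟩,
    ⟨a2, a4, u ++ letters l.2, v, by simp [a5], by simp [a7, endPos, a6]; omega⟩⟩

/-- The variable operations between the two factors of a split, with their position. -/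
def between (l r : PosTree G) : Finset (Entry X) :=
  (opsAt l.1 (endPos l) l.2.yield ∪ opsAt r.1 r.1 r.2.yield).image fun τ => (τ, endPos l)

omit [Fintype X] in
lemma mem_inner_core {p l r : PosTree G} (h : IsPart d p) (hc : core p.2 p.1 = some (l, r))
    (e : Entry X) : e ∈ inner p ↔ e ∈ inner l ∨ e ∈ inner r ∨ e ∈ between l r := by
  have hl := (h.core hc).1.lt_endPos
  have hr := (h.core hc).2.lt_endPos
  obtain ⟨a1, a2, a3, a4, a5, a6, a7, -, -, E, E', a8, a9, a10⟩ := core_spec hc h.follows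
  have hs : endPos p = endPos r := by simp [endPos, a5, a6, a7]; omega
  rw [show p.1 + (letters p.2).length = endPos p from rfl] at a9
  simp only [mem_inner, a10, List.mem_append, between, Finset.mem_image, Finset.mem_union,
    mem_opsAt]
  constructor
  · rintro ⟨(h1 | h1 | h1) | h1, h2, h3⟩
    · have := a8 e h1; omega
    · have := le_of_mem_entries h1
      rw [show l.1 + (clean l.2.yield).length = endPos l from rfl] at this
      rcases this.2.lt_or_eq with h4 | h4
      · exact .inl ⟨h1, by omega, h4⟩
      · exact .inr (.inr ⟨e.1, .inl (h4 ▸ h1), by rw [← h4]⟩)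
    · have := le_of_mem_entries h1
      rw [show r.1 + (clean r.2.yield).length = endPos r from rfl] at this
      rcases this.1.lt_or_eq with h4 | h4
      · exact .inr (.inl ⟨h1, h4, by omega⟩)
      · exact .inr (.inr ⟨e.1, .inr ((Prod.ext rfl h4 : (e.1, r.1) = e) ▸ h1), by rw [← a7, h4]⟩)
    · have := a9 e h1; omega
  · rintro (⟨h1, h2, h3⟩ | ⟨h1, h2, h3⟩ | ⟨τ, h1 | h1, rfl⟩)
    · exact ⟨.inl (.inr (.inl h1)), by omega, by omega⟩
    · exact ⟨.inl (.inr (.inr h1)), by omega, by omega⟩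
    · exact ⟨.inl (.inr (.inl h1)), by dsimp only; omega, by dsimp only; omega⟩
    · exact ⟨.inl (.inr (.inr (a7 ▸ h1))), by dsimp only; omega, by dsimp only; omega⟩

omit [Fintype X] in
lemma card_inner_core {p l r : PosTree G} (h : IsPart d p) (hc : core p.2 p.1 = some (l, r)) :
    (inner p).card = (inner l).card + (inner r).card +
      (opsAt l.1 (endPos l) l.2.yield ∪ opsAt r.1 r.1 r.2.yield).card := by
  have e : inner p = inner l ∪ inner r ∪ between l r := by
    ext e
    rw [mem_inner_core h hc]
    simp only [Finset.mem_union, or_assoc]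
  obtain ⟨-, -, -, -, -, -, a7, -⟩ := core_spec hc h.follows
  rw [e, Finset.card_union_of_disjoint, Finset.card_union_of_disjoint, between,
    Finset.card_image_of_injective]
  · intro τ τ' h
    exact congrArg Prod.fst h
  · rw [Finset.disjoint_left]
    intro e h1 h2
    rw [mem_inner] at h1 h2
    omega
  · rw [Finset.disjoint_left]
    intro e h1 h2
    simp only [between, Finset.mem_image] at h2
    obtain ⟨τ, -, rfl⟩ := h2
    rw [Finset.mem_union, mem_inner, mem_inner] at h1
    dsimp only at h1
    omega

/-- The number of variable operations in the words of `A_{i,j}^{x,y}` that are not in `x ∪ y`. -/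
noncomputable def remaining (G : ExtractionGrammar T X) : DecNT G.NT X → ℕ
  | .span A _ _ x y => (opsOf G A \ (x ∪ y)).card
  | _ => 0

lemma image_fst_inner (hc : IsCNF G) (hf : IsFunctional G) {p : PosTree G}
    (hp : p.2.Follows ↑G.rules) (h : Reachable G p.2.root) :
    (inner p).image Prod.fst = opsOf G p.2.root \
      (opsAt p.1 p.1 p.2.yield ∪ opsAt p.1 (endPos p) p.2.yield) := by
  ext τ
  simp only [Finset.mem_image, mem_inner, Finset.mem_sdiff, h.mem_opsOf hc hf hp,
    Finset.mem_union, mem_opsAt, not_or]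
  rw [mem_iff_exists_entries (b := p.1)]
  constructor
  · rintro ⟨⟨τ, q⟩, ⟨h1, h2, h3⟩, rfl⟩
    refine ⟨⟨q, h1⟩, fun h4 => ?_, fun h4 => ?_⟩
    · exact h2.ne' (entries_unique (h.nodup_ops hf hp) h1 h4)
    · exact h3.ne (entries_unique (h.nodup_ops hf hp) h1 h4)
  · rintro ⟨⟨q, h1⟩, h2, h3⟩
    have := le_of_mem_entries h1
    rw [show p.1 + (clean p.2.yield).length = endPos p from rfl] at this
    refine ⟨(τ, q), ⟨h1, this.1.lt_of_ne ?_, this.2.lt_of_ne ?_⟩, rfl⟩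
    · rintro rfl; exact h2 h1
    · rintro rfl; exact h3 h1

lemma remaining_dec (hc : IsCNF G) (hf : IsFunctional G) {p : PosTree G}
    (hp : p.2.Follows ↑G.rules) (h : Reachable G p.2.root) :
    remaining G (dec p) = (inner p).card := by
  rw [dec, remaining, ← image_fst_inner hc hf hp h, Finset.card_image_of_injOn]
  rintro ⟨τ, q⟩ h1 ⟨τ', q'⟩ h2 rfl
  rw [Finset.mem_coe, mem_inner] at h1 h2
  rw [entries_unique (h.nodup_ops hf hp) h1.1 h2.1]

/-- A part of a parse tree is stable if and only if it places no variable operation between two of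
its letters. -/
lemma stable_dec (hc : IsCNF G) (hf : IsFunctional G) {p : PosTree G}
    (hp : p.2.Follows ↑G.rules) (h : Reachable G p.2.root) :
    Stable G (dec p) ↔ inner p = ∅ := by
  rw [← Finset.image_eq_empty (f := Prod.fst), image_fst_inner hc hf hp h,
    Finset.sdiff_eq_empty_iff_subset, dec, Stable]
  refine ⟨fun h => h.le, fun h' => h'.antisymm ?_⟩
  intro τ hτ
  rw [h.mem_opsOf hc hf hp, mem_iff_exists_entries (b := p.1)]
  simp only [Finset.mem_union, mem_opsAt] at hτ
  rcases hτ with hτ | hτ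
  exacts [⟨_, hτ⟩, ⟨_, hτ⟩]

omit [Fintype X] in
lemma mem_entries_iff_inner {p : PosTree G} (e : Entry X) :
    e ∈ entries p.1 p.2.yield ↔ (e.1 ∈ opsAt p.1 p.1 p.2.yield ∧ e.2 = p.1) ∨
      (e.1 ∈ opsAt p.1 (endPos p) p.2.yield ∧ e.2 = endPos p) ∨ e ∈ inner p := by
  obtain ⟨τ, q⟩ := e
  simp only [mem_opsAt, mem_inner]
  constructor
  · intro h
    have := le_of_mem_entries h
    rw [show p.1 + (clean p.2.yield).length = endPos p from rfl] at this
    dsimp only at this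
    by_cases h1 : q = p.1
    · subst h1; exact .inl ⟨h, rfl⟩
    by_cases h2 : q = endPos p
    · subst h2; exact .inr (.inl ⟨h, rfl⟩)
    exact .inr (.inr ⟨h, by omega, by omega⟩)
  · rintro (⟨h, rfl⟩ | ⟨h, rfl⟩ | ⟨h, -⟩) <;> exact h

omit [Fintype X] in
/-- In an unambiguous grammar, a part of the document with a given decorated non-terminal is
determined by the inner variable operations. -/
lemma IsPart.unique (hf : IsFunctional G) (hu : IsUnambiguous G) {p p' : PosTree G}
    (hp : IsPart d p) (hp' : IsPart d p') (h : Reachable G p.2.root) (hd : dec p = dec p')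
    (hi : inner p = inner p') : p = p' := by
  have l1 := hp.lt_endPos
  have l2 := hp'.lt_endPos
  have he := mem_entries_iff_inner (p := p)
  have he' := mem_entries_iff_inner (p := p')
  obtain ⟨i, t⟩ := p
  obtain ⟨i', t'⟩ := p'
  simp only [dec, DecNT.span.injEq] at hd
  obtain ⟨hr, rfl, hs, hx, hy⟩ := hd
  dsimp only at l1 l2
  have hs : endPos (i, t) = endPos (i, t') := by omega
  obtain ⟨u, v, hd, h1⟩ := hp.factor
  obtain ⟨u', v', hd', h1'⟩ := hp'.factor
  dsimp only at h1 h1'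
  have hl : letters t = letters t' := by
    rw [hd, List.append_assoc, List.append_assoc] at hd'
    obtain ⟨-, h2⟩ := List.append_inj hd' (by omega)
    exact (List.append_inj h2 (by simpa [endPos] using hs)).1
  congr 1
  refine h.tree_unique hf hu hr.symm hp.follows hp'.follows hl (b := i) fun e => ?_
  have e1 := he e
  have e2 := he' e
  dsimp only at e1 e2 hx hy
  rw [e1, e2, hx, hy, hs, hi]

end ExtractionGrammar

/-! ### The rules of the decorated grammar in terms of parse trees -/

namespace ExtractionGrammar

open Symbol RefWord

variable {T : Type u} {X : Type v} {G : ExtractionGrammar T X} {d : List T}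

/-- The grammar `G_d` before the elimination of useless non-terminals. -/
def preAdjusted (G : ExtractionGrammar T X) (d : List T) :
    RuleSystem (ExtLetter T X) (AdjNT G.NT) where
  starts := {AdjNT.span G.initial 1 d.length}
  rules := {ρ | AdjRule G d ρ}

/-- The non-terminal of `G` that underlies a non-terminal of `G_d`. -/
def _root_.AdjNT.label {V : Type} : AdjNT V → V
  | .span A _ _ => A
  | .eps A => A

lemma exists_tree_of_productive {N : AdjNT G.NT} (h : (preAdjusted G d).Productive N) :
    ∃ t : RefTree G, t.Follows ↑G.rules ∧ t.root = N.label := by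
  refine h.induction (P := fun N => ∃ t : RefTree G, t.Follows ↑G.rules ∧ t.root = N.label) ?_
  rintro ρ (hρ : AdjRule G d ρ) h
  cases hρ with
  | letter hR => exact ⟨.leaf _ _, hR, rfl⟩
  | varOp hR => exact ⟨.leaf _ _, hR, rfl⟩
  | epsEps hR | spanEps hR | epsSpan hR | split hR =>
    obtain ⟨l, hl, rfl⟩ := h _ List.mem_cons_self
    obtain ⟨r, hr, rfl⟩ := h _ (List.mem_cons_of_mem _ List.mem_cons_self)
    exact ⟨.node _ l r, ⟨hR, hl, hr⟩, rfl⟩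

lemma reachable_of_useful {N : AdjNT G.NT} (h : (preAdjusted G d).Useful N) :
    Reachable G N.label := by
  refine h.induction (Q := fun N => Reachable G N.label) ?_ ?_
  · rintro _ rfl
    exact reachable_initial
  · rintro ρ (hρ : AdjRule G d ρ) h hQ A hA
    cases hρ with
    | letter hR => simp at hA
    | varOp hR => simp at hA
    | epsEps hR | spanEps hR | epsSpan hR | split hR =>
      obtain ⟨l, hl, hlr⟩ := exists_tree_of_productive (h _ List.mem_cons_self)
      obtain ⟨r, hr, hrr⟩ :=
        exists_tree_of_productive (h _ (List.mem_cons_of_mem _ List.mem_cons_self))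
      simp only [List.mem_cons, nonterminal.injEq, List.not_mem_nil, or_false] at hA
      rcases hA with rfl | rfl
      · exact hQ.left (hrr ▸ hR) hr
      · exact hQ.right (hlr ▸ hR) hl

/-- A parse tree for a possibly empty factor of the document `d`, at its position in `d`. -/
structure IsFactor (d : List T) (p : PosTree G) : Prop where
  follows : p.2.Follows ↑G.rules
  factor : ∃ u v, d = u ++ letters p.2 ++ v ∧ u.length + 1 = p.1

lemma IsPart.isFactor {p : PosTree G} (h : IsPart d p) : IsFactor d p := ⟨h.follows, h.factor⟩

lemma IsFactor.isPart {p : PosTree G} (h : IsFactor d p) (h' : letters p.2 ≠ []) : IsPart d p :=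
  ⟨h.follows, h', h.factor⟩

lemma IsFactor.bounds {p : PosTree G} (h : IsFactor d p) :
    1 ≤ p.1 ∧ endPos p ≤ d.length + 1 := by
  obtain ⟨u, v, rfl, hu⟩ := h.factor
  simp [endPos]
  omega

lemma IsFactor.left {A : G.NT} {l r : RefTree G} {i : ℕ} (h : IsFactor d (i, .node A l r)) :
    IsFactor d (i, l) := by
  obtain ⟨⟨-, hl, hr⟩, u, v, h, hu⟩ := h
  exact ⟨hl, u, letters r ++ v, by simp [h], hu⟩

lemma IsFactor.right {A : G.NT} {l r : RefTree G} {i : ℕ} (h : IsFactor d (i, .node A l r)) :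
    IsFactor d (i + (letters l).length, r) := by
  obtain ⟨⟨-, hl, hr⟩, u, v, h, hu⟩ := h
  exact ⟨hr, u ++ letters l, v, by simp [h], by dsimp only at *; simp; omega⟩

lemma IsFactor.node {A : G.NT} {l r : RefTree G} {i : ℕ} (hl : IsFactor d (i, l))
    (hr : IsFactor d (i + (letters l).length, r))
    (hR : ⟨A, [nonterminal l.root, nonterminal r.root]⟩ ∈ G.rules) :
    IsFactor d (i, .node A l r) := by
  obtain ⟨hl, u, v, h, hu⟩ := hl
  obtain ⟨hr, u', v', h', hu'⟩ := hr
  refine ⟨⟨hR, hl, hr⟩, u, v', ?_, hu⟩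
  dsimp only at *
  rw [h, List.append_assoc u'] at h'
  obtain ⟨h1, h2⟩ := List.append_inj h' (by simp; omega)
  rw [h, h2]
  simp

/-- The non-terminal of `G_d` at the root. -/
def adj (p : PosTree G) : AdjNT G.NT :=
  if letters p.2 = [] then .eps p.2.root else .span p.2.root p.1 (endPos p - 1)

@[simp] lemma label_adj (p : PosTree G) : (adj p).label = p.2.root := by
  rw [adj]
  split_ifs <;> rfl

lemma adj_node {A : G.NT} {l r : RefTree G} {i : ℕ} (h : IsFactor d (i, .node A l r)) :
    AdjRule G d ⟨adj (i, .node A l r),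
      [nonterminal (adj (i, l)), nonterminal (adj (i + (letters l).length, r))]⟩ := by
  have hR := h.follows.1
  have hb := h.bounds
  simp only [endPos, letters_node, List.length_append] at hb
  by_cases h1 : letters l = [] <;> by_cases h2 : letters r = [] <;>
    simp only [adj, letters_node, h1, h2, endPos, PTree.root_node, List.append_nil, List.nil_append,
      if_true, if_false, List.length_nil, Nat.add_zero, List.length_append,
      List.append_eq_nil_iff, and_self]
  · exact .epsEps hR
  · have := List.length_pos_of_ne_nil h2
    rw [h1, List.length_nil] at hb
    exact .epsSpan hR hb.1 (by omega) (by omega)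
  · have := List.length_pos_of_ne_nil h1
    rw [h2, List.length_nil] at hb
    exact .spanEps hR hb.1 (by omega) (by omega)
  · have h3 := List.length_pos_of_ne_nil h1
    have h4 := List.length_pos_of_ne_nil h2
    have := AdjRule.split (d := d) (i := i) (i' := i + (letters l).length - 1)
      (j := i + ((letters l).length + (letters r).length) - 1) hR hb.1 (by omega) (by omega)
      (by omega)
    rw [Nat.sub_add_cancel (by omega)] at this
    rwa [Nat.add_assoc]

lemma adj_leaf {A : G.NT} {a : ExtLetter T X} {i : ℕ} (h : IsFactor d (i, .leaf A a)) :
    AdjRule G d ⟨adj (i, .leaf A a), [terminal a]⟩ := by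
  obtain ⟨hR, u, v, h, hu⟩ := h
  cases a with
  | inl σ =>
    have e : letters (G := G) (.leaf A (Sum.inl σ)) = [σ] := rfl
    simp only [adj, e, endPos, List.length_singleton]
    refine .letter hR (by dsimp only at hu; omega) ?_
    rw [h, e]
    dsimp only at hu
    simp [← hu]
  | inr τ => exact .varOp hR

/-- If the nodes of parse trees give rules of a grammar, then parse trees give derivations of
terminal words. -/
lemma productive_of_tree {T' N : Type*} {g : RuleSystem T' N} {H : PosTree G → Prop}
    {nt : PosTree G → N}
    (hl : ∀ i A a, H (i, .leaf A a) → ∃ w : List T', ⟨nt (i, .leaf A a), w.map terminal⟩ ∈ g.rules)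
    (hn : ∀ i A l r, H (i, .node A l r) → H (i, l) ∧ H (i + (letters l).length, r) ∧
      ⟨nt (i, .node A l r), [nonterminal (nt (i, l)),
        nonterminal (nt (i + (letters l).length, r))]⟩ ∈ g.rules)
    {p : PosTree G} (h : H p) : g.Productive (nt p) := by
  obtain ⟨i, t⟩ := p
  induction t generalizing i with
  | leaf A a =>
    obtain ⟨w, hw⟩ := hl i A a h
    exact RuleSystem.productive_of_rule hw (by simp)
  | node A l r ihl ihr =>
    obtain ⟨h1, h2, h3⟩ := hn i A l r h
    refine RuleSystem.productive_of_rule h3 fun B hB => ?_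
    simp only [List.mem_cons, nonterminal.injEq, List.not_mem_nil, or_false] at hB
    rcases hB with rfl | rfl
    exacts [ihl _ h1, ihr _ h2]

lemma productive_adj {p : PosTree G} (h : IsFactor d p) : (preAdjusted G d).Productive (adj p) :=
  productive_of_tree (g := preAdjusted G d) (H := IsFactor d) (fun _ _ a h => ⟨[a], adj_leaf h⟩)
    (fun _ _ _ _ h => ⟨h.left, h.right, adj_node h⟩) h

lemma adjusted_node {A : G.NT} {l r : RefTree G} {i : ℕ} (h : IsFactor d (i, .node A l r))
    (hu : (preAdjusted G d).Useful (adj (i, .node A l r))) :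
    (preAdjusted G d).Useful (adj (i, l)) ∧
    (preAdjusted G d).Useful (adj (i + (letters l).length, r)) ∧
    ⟨adj (i, .node A l r), [nonterminal (adj (i, l)),
      nonterminal (adj (i + (letters l).length, r))]⟩ ∈ (adjusted G d).rules := by
  have hp : ∀ N, nonterminal N ∈ [nonterminal (adj (i, l)),
      nonterminal (T := ExtLetter T X) (adj (i + (letters l).length, r))] →
      (preAdjusted G d).Productive N := by
    intro N hN
    simp only [List.mem_cons, nonterminal.injEq, List.not_mem_nil, or_false] at hN
    rcases hN with rfl | rfl
    exacts [productive_adj h.left, productive_adj h.right]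
  have hR : (_ : ContextFreeRule _ _) ∈ (preAdjusted G d).rules := adj_node h
  exact ⟨hu.child hR hp (by simp), hu.child hR hp (by simp),
    RuleSystem.mem_removeUseless hR hu hp⟩

variable [Fintype X] [DecidableEq X]

/-! ### The decorations of the two subtrees at a node -/

omit [Fintype X] [DecidableEq X] in
lemma mem_entries_node {A : G.NT} {l r : RefTree G} {i : ℕ} {e : Entry X} :
    e ∈ entries i (PTree.node A l r).yield ↔
      e ∈ entries i l.yield ∨ e ∈ entries (i + (letters l).length) r.yield := by
  simp [PTree.yield]

lemma dec_node_eps_right (hc : IsCNF G) (hf : IsFunctional G) {A : G.NT} {l r : RefTree G}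
    {i : ℕ} (hl : letters l ≠ []) (hr : letters r = []) (h : Reachable G r.root)
    (ht : r.Follows ↑G.rules) :
    dec (i, .node A l r) = .span A i (endPos (i, l) - 1) (opsAt i i l.yield)
      (opsAt i (endPos (i, l)) l.yield ∪ opsOf G r.root) := by
  have := List.length_pos_of_ne_nil hl
  simp only [dec, PTree.root_node, endPos, letters_node, hr, List.append_nil, DecNT.span.injEq,
    true_and]
  refine ⟨?_, ?_⟩ <;> ext τ <;>
    simp only [mem_opsAt, mem_entries_node, Finset.mem_union, h.mem_opsOf hc hf ht]
  · refine ⟨fun h => h.resolve_right fun h' => ?_, .inl⟩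
    have := entries_of_clean_eq_nil hr h'
    dsimp only at this
    omega
  · rw [mem_iff_exists_entries (b := i + (letters l).length)]
    refine or_congr_right ⟨fun h => ⟨_, h⟩, ?_⟩
    rintro ⟨q, h⟩
    exact (entries_of_clean_eq_nil hr h) ▸ h

lemma dec_node_eps_left (hc : IsCNF G) (hf : IsFunctional G) {A : G.NT} {l r : RefTree G}
    {i : ℕ} (hl : letters l = []) (hr : letters r ≠ []) (h : Reachable G l.root)
    (ht : l.Follows ↑G.rules) :
    dec (i, .node A l r) = .span A i (endPos (i, r) - 1) (opsAt i i r.yield ∪ opsOf G l.root)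
      (opsAt i (endPos (i, r)) r.yield) := by
  have := List.length_pos_of_ne_nil hr
  simp only [dec, PTree.root_node, endPos, letters_node, hl, List.nil_append, DecNT.span.injEq,
    true_and]
  refine ⟨?_, ?_⟩ <;> ext τ <;>
    simp only [mem_opsAt, mem_entries_node, Finset.mem_union, h.mem_opsOf hc hf ht, hl,
      List.length_nil, Nat.add_zero]
  · rw [mem_iff_exists_entries (b := i), or_comm]
    refine or_congr_right ⟨fun h => ⟨_, h⟩, ?_⟩
    rintro ⟨q, h⟩
    exact (entries_of_clean_eq_nil hl h) ▸ h
  · refine ⟨fun h => h.resolve_left fun h' => ?_, .inr⟩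
    have := entries_of_clean_eq_nil hl h'
    dsimp only at this
    omega

omit [Fintype X] in
lemma dec_node_split {A : G.NT} {l r : RefTree G} {i : ℕ} (hl : letters l ≠ [])
    (hr : letters r ≠ []) :
    dec (i, .node A l r) = .span A i (endPos (endPos (i, l), r) - 1) (opsAt i i l.yield)
      (opsAt (endPos (i, l)) (endPos (endPos (i, l), r)) r.yield) := by
  have h1 := List.length_pos_of_ne_nil hl
  have h2 := List.length_pos_of_ne_nil hr
  simp only [dec, PTree.root_node, endPos, letters_node, List.length_append, DecNT.span.injEq,
    true_and]
  refine ⟨by omega, ?_, ?_⟩ <;> ext τ <;> simp only [mem_opsAt, mem_entries_node]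
  · refine ⟨fun h => h.resolve_right fun h' => ?_, .inl⟩
    have := le_of_mem_entries h'
    dsimp only at this
    omega
  · rw [Nat.add_assoc]
    refine ⟨fun h => h.resolve_left fun h' => ?_, .inr⟩
    have := le_of_mem_entries h'
    dsimp only [letters] at *
    omega

omit [Fintype X] in
lemma disjoint_opsAt {t : RefTree G} (h : (ops t.yield).Nodup) {i p q : ℕ} (hpq : p ≠ q) :
    Disjoint (opsAt i p t.yield) (opsAt i q t.yield) := by
  rw [Finset.disjoint_left]
  intro τ h1 h2
  rw [mem_opsAt] at h1 h2
  exact hpq (entries_unique h h1 h2)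

omit [Fintype X] [DecidableEq X] in
lemma disjoint_of_nodup_node {A : G.NT} {l r : RefTree G}
    (h : (ops (PTree.node A l r).yield).Nodup) {x y : Finset (VarOp X)}
    (hx : ∀ τ ∈ x, Sum.inr τ ∈ l.yield) (hy : ∀ τ ∈ y, Sum.inr τ ∈ r.yield) : Disjoint x y := by
  simp only [PTree.yield, ops_append, List.nodup_append] at h
  rw [Finset.disjoint_left]
  intro τ h1 h2
  exact h.2.2 τ (mem_ops.2 (hx τ h1)) τ (mem_ops.2 (hy τ h2)) rfl

omit [Fintype X] in
lemma mem_yield_of_mem_opsAt {t : RefTree G} {i p : ℕ} (τ : VarOp X)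
    (h : τ ∈ opsAt i p t.yield) : Sum.inr τ ∈ t.yield :=
  mem_iff_exists_entries.2 ⟨_, mem_opsAt.1 h⟩

/-- The non-terminal of the decorated grammar at the root, before the elimination of
epsilon-productions. -/
def preDec (p : PosTree G) : DecNT G.NT X :=
  if letters p.2 = [] then .eps p.2.root else dec p

omit [Fintype X] in
lemma IsPart.preDec {p : PosTree G} (h : IsPart d p) : preDec p = dec p := if_neg h.letters_ne

lemma step1_node (hc : IsCNF G) (hf : IsFunctional G) {A : G.NT} {l r : RefTree G} {i : ℕ}
    (h : IsFactor d (i, .node A l r)) (hu : (preAdjusted G d).Useful (adj (i, .node A l r))) :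
    Step1Rule G d ⟨preDec (i, .node A l r), [nonterminal (preDec (i, l)),
      nonterminal (preDec (i + (letters l).length, r))]⟩ := by
  obtain ⟨hul, hur, hR⟩ := adjusted_node h hu
  have hA := reachable_of_useful hu
  have hB := reachable_of_useful hul
  have hC := reachable_of_useful hur
  rw [label_adj] at hA hB hC
  dsimp only at hA hB hC
  have hl := h.left.follows
  have hr := h.right.follows
  have hn := hA.nodup_ops hf h.follows
  have hnl := hB.nodup_ops hf hl
  have hnr := hC.nodup_ops hf hr
  have hyl : ∀ q (τ : VarOp X), τ ∈ opsAt i q l.yield → Sum.inr τ ∈ l.yield :=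
    fun _ => mem_yield_of_mem_opsAt
  have hyr : ∀ k q (τ : VarOp X), τ ∈ opsAt k q r.yield → Sum.inr τ ∈ r.yield :=
    fun _ _ => mem_yield_of_mem_opsAt
  have hol : ∀ τ ∈ opsOf G l.root, Sum.inr τ ∈ l.yield := fun τ hτ => (hB.mem_opsOf hc hf hl).1 hτ
  have hor : ∀ τ ∈ opsOf G r.root, Sum.inr τ ∈ r.yield := fun τ hτ => (hC.mem_opsOf hc hf hr).1 hτ
  by_cases h1 : letters l = [] <;> by_cases h2 : letters r = []
  · simp only [adj, preDec, letters_node, h1, h2, List.append_nil, if_true, List.length_nil] at hR ⊢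
    exact .epsEps hR
  · have h3 := List.length_pos_of_ne_nil h2
    simp only [adj, preDec, letters_node, h1, h2, List.nil_append, if_true, if_false,
      List.length_nil, Nat.add_zero, endPos, PTree.root_node] at hR ⊢
    rw [dec_node_eps_left hc hf h1 h2 hB hl]
    exact .epsSpan hR (disjoint_opsAt hnr (by simp only [endPos]; omega))
      (disjoint_of_nodup_node hn hol (hyr _ _)).symm (disjoint_of_nodup_node hn hol (hyr _ _)).symm
  · have h3 := List.length_pos_of_ne_nil h1
    simp only [adj, preDec, letters_node, h1, h2, List.append_nil, if_true, if_false,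
      endPos, PTree.root_node] at hR ⊢
    rw [dec_node_eps_right hc hf h1 h2 hC hr]
    exact .spanEps hR (disjoint_opsAt hnl (by simp only [endPos]; omega))
      (disjoint_of_nodup_node hn (hyl _) hor) (disjoint_of_nodup_node hn (hyl _) hor)
  · have h3 := List.length_pos_of_ne_nil h1
    have h4 := List.length_pos_of_ne_nil h2
    simp only [adj, preDec, letters_node, h1, h2, if_false,
      List.append_eq_nil_iff, and_self] at hR ⊢
    rw [dec_node_split h1 h2]
    have e : i + (letters l).length = endPos (i, l) - 1 + 1 := by simp only [endPos]; omega
    have e' : endPos (i, PTree.node A l r) = endPos (i + (letters l).length, r) := by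
      simp [endPos, Nat.add_assoc]
    have hlt : i < endPos (i, l) := by simp only [endPos]; omega
    have hlt' : endPos (i, l) < endPos (endPos (i, l), r) := by simp only [endPos]; omega
    rw [e', e] at hR
    have hd := disjoint_of_nodup_node hn (hyl i) (hyr (endPos (i, l)) (endPos (i, l)))
    have := Step1Rule.split hR (x := opsAt i i l.yield) (y := opsAt i (endPos (i, l)) l.yield)
      (z := opsAt (endPos (i, l)) (endPos (i, l)) r.yield)
      (w := opsAt (endPos (i, l)) (endPos (endPos (i, l), r)) r.yield)
      (disjoint_opsAt hnl hlt.ne)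
      (disjoint_of_nodup_node hn (hyl _) (hyr _ _)) (disjoint_of_nodup_node hn (hyl _) (hyr _ _))
      (disjoint_of_nodup_node hn (hyl _) (hyr _ _)) (disjoint_of_nodup_node hn (hyl _) (hyr _ _))
      (disjoint_opsAt hnr hlt'.ne)
    rw [← e] at this
    exact this

lemma step1_leaf {A : G.NT} {a : ExtLetter T X} {i : ℕ} (h : IsFactor d (i, .leaf A a))
    (hu : (preAdjusted G d).Useful (adj (i, .leaf A a))) :
    Step1Rule G d ⟨preDec (i, .leaf A a), (clean [a]).map terminal⟩ := by
  have hR : (_ : ContextFreeRule _ _) ∈ (adjusted G d).rules :=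
    RuleSystem.mem_removeUseless (adj_leaf h) hu (by simp)
  cases a with
  | inl σ =>
    have e : letters (G := G) (.leaf A (Sum.inl σ)) = [σ] := rfl
    have e1 : endPos (G := G) (i, .leaf A (Sum.inl σ)) - 1 = i := by simp [endPos, e]
    simp only [adj, e, PTree.root_leaf, e1] at hR
    have := Step1Rule.letter (X := X) hR
    simpa [preDec, e, dec, opsAt, PTree.yield, entries, e1] using this
  | inr τ => exact .varOp hR

end ExtractionGrammar

/-! ### From parse trees to rules of the decorated grammar -/

namespace ExtractionGrammar

open Symbol RefWord

variable {T : Type u} {X : Type v} {G : ExtractionGrammar T X} {d : List T}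
  [Fintype X] [DecidableEq X]

/-- The decorated grammar after the first elimination of useless non-terminals. -/
def trimmed (G : ExtractionGrammar T X) (d : List T) : RuleSystem T (DecNT G.NT X) :=
  (step1 G d).removeUseless

/-- The decorated grammar after the elimination of epsilon-productions. -/
def epsFree (G : ExtractionGrammar T X) (d : List T) : RuleSystem T (DecNT G.NT X) :=
  (trimmed G d).removeEpsilon

/-- The decorated grammar before the elimination of unit productions. -/
def unitful (G : ExtractionGrammar T X) (d : List T) : RuleSystem T (DecNT G.NT X) :=
  (epsFree G d).removeUseless

/-- The non-terminal of `G_d` without decoration is useful. -/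
def UndecoratedUseful (G : ExtractionGrammar T X) (d : List T) : DecNT G.NT X → Prop
  | .span A i j _ _ => (preAdjusted G d).Useful (.span A i j)
  | .eps A => (preAdjusted G d).Useful (.eps A)
  | .start => True

lemma undecoratedUseful {N : DecNT G.NT X} (h : (step1 G d).Useful N) :
    UndecoratedUseful G d N := by
  refine h.productive.induction ?_
  rintro ρ (hρ : Step1Rule G d ρ) -
  cases hρ with
  | letter h | varOp h | epsEps h | spanEps h | epsSpan h | split h => exact h.2.1

lemma useful_adj {p : PosTree G} (h : (step1 G d).Useful (preDec p)) :
    (preAdjusted G d).Useful (adj p) := by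
  have := undecoratedUseful h
  rw [preDec] at this
  rw [adj]
  split_ifs at this ⊢ <;> exact this

lemma productive_step1 (hc : IsCNF G) (hf : IsFunctional G) {p : PosTree G} (h : IsFactor d p)
    (hu : (preAdjusted G d).Useful (adj p)) : (step1 G d).Productive (preDec p) :=
  productive_of_tree (g := step1 G d)
    (H := fun p => IsFactor d p ∧ (preAdjusted G d).Useful (adj p))
    (fun _ _ _ h => ⟨_, step1_leaf h.1 h.2⟩)
    (fun _ _ _ _ h => ⟨⟨h.1.left, (adjusted_node h.1 h.2).1⟩,
      ⟨h.1.right, (adjusted_node h.1 h.2).2.1⟩, step1_node hc hf h.1 h.2⟩) ⟨h, hu⟩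

lemma trimmed_node (hc : IsCNF G) (hf : IsFunctional G) {A : G.NT} {l r : RefTree G} {i : ℕ}
    (h : IsFactor d (i, .node A l r)) (hu : (step1 G d).Useful (preDec (i, .node A l r))) :
    (step1 G d).Useful (preDec (i, l)) ∧
    (step1 G d).Useful (preDec (i + (letters l).length, r)) ∧
    ⟨preDec (i, .node A l r), [nonterminal (preDec (i, l)),
      nonterminal (preDec (i + (letters l).length, r))]⟩ ∈ (trimmed G d).rules := by
  have hu' := adjusted_node h (useful_adj hu)
  have hp : ∀ N, nonterminal N ∈ [nonterminal (preDec (i, l)),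
      nonterminal (T := T) (preDec (i + (letters l).length, r))] →
      (step1 G d).Productive N := by
    intro N hN
    simp only [List.mem_cons, nonterminal.injEq, List.not_mem_nil, or_false] at hN
    rcases hN with rfl | rfl
    exacts [productive_step1 hc hf h.left hu'.1, productive_step1 hc hf h.right hu'.2.1]
  have hR : (_ : ContextFreeRule _ _) ∈ (step1 G d).rules := step1_node hc hf h (useful_adj hu)
  exact ⟨hu.child hR hp (by simp), hu.child hR hp (by simp),
    RuleSystem.mem_removeUseless hR hu hp⟩

lemma trimmed_leaf {A : G.NT} {a : ExtLetter T X} {i : ℕ}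
    (h : IsFactor d (i, .leaf A a)) (hu : (step1 G d).Useful (preDec (i, .leaf A a))) :
    ⟨preDec (i, .leaf A a), (clean [a]).map terminal⟩ ∈ (trimmed G d).rules :=
  RuleSystem.mem_removeUseless (step1_leaf h (useful_adj hu)) hu (by simp)

lemma productive_trimmed (hc : IsCNF G) (hf : IsFunctional G) {p : PosTree G} (h : IsFactor d p)
    (hu : (step1 G d).Useful (preDec p)) : (trimmed G d).Productive (preDec p) :=
  productive_of_tree (g := trimmed G d)
    (H := fun p => IsFactor d p ∧ (step1 G d).Useful (preDec p))
    (fun _ _ _ h => ⟨_, trimmed_leaf h.1 h.2⟩)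
    (fun _ _ _ _ h => ⟨⟨h.1.left, (trimmed_node hc hf h.1 h.2).1⟩,
      ⟨h.1.right, (trimmed_node hc hf h.1 h.2).2.1⟩, (trimmed_node hc hf h.1 h.2).2.2⟩) ⟨h, hu⟩

lemma derives_eps {α β : List (Symbol T (DecNT G.NT X))} (h : (trimmed G d).Derives α β)
    (hα : ∀ s ∈ α, ∃ A, s = nonterminal (.eps A)) : ∀ s ∈ β, ∃ A, s = nonterminal (.eps A) := by
  induction h with
  | refl => exact hα
  | tail _ h ih =>
    obtain ⟨ρ, ⟨hρ, -⟩, h⟩ := h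
    obtain ⟨p, q, rfl, rfl⟩ := ContextFreeRule.rewrites_iff.1 h
    simp only [List.mem_append, List.mem_singleton] at ih ⊢
    rintro s ((hs | hs) | hs)
    · exact ih s (.inl (.inl hs))
    · obtain ⟨A, hA⟩ := ih _ (.inl (.inr rfl))
      have hρ : Step1Rule G d ρ := hρ
      cases hρ <;> simp_all
      rcases hs with rfl | rfl <;> exact ⟨_, rfl⟩
    · exact ih s (.inr hs)

lemma nullable_of_tree (hc : IsCNF G) (hf : IsFunctional G) {p : PosTree G} (h : IsFactor d p)
    (hl : letters p.2 = []) (hu : (step1 G d).Useful (preDec p)) :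
    (trimmed G d).Nullable (preDec p) := by
  obtain ⟨w, hw⟩ := productive_trimmed hc hf h hu
  have := derives_eps hw (by simp [preDec, hl])
  cases w with
  | nil => exact hw
  | cons a w => simp at this

/-- The rule of the grammar without epsilon-productions at a node. -/
lemma epsFree_node (hc : IsCNF G) (hf : IsFunctional G) {A : G.NT} {l r : RefTree G} {i : ℕ}
    (h : IsPart d (i, .node A l r)) (hu : (step1 G d).Useful (dec (i, .node A l r))) :
    (letters l = [] ∧ IsPart d (i, r) ∧ (step1 G d).Useful (dec (i, r)) ∧
      ⟨dec (i, .node A l r), [nonterminal (dec (i, r))]⟩ ∈ (epsFree G d).rules) ∨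
    (letters l ≠ [] ∧ letters r = [] ∧ IsPart d (i, l) ∧ (step1 G d).Useful (dec (i, l)) ∧
      ⟨dec (i, .node A l r), [nonterminal (dec (i, l))]⟩ ∈ (epsFree G d).rules) ∨
    (letters l ≠ [] ∧ letters r ≠ [] ∧ IsPart d (i, l) ∧ IsPart d (i + (letters l).length, r) ∧
      (step1 G d).Useful (dec (i, l)) ∧ (step1 G d).Useful (dec (i + (letters l).length, r)) ∧
      ⟨dec (i, .node A l r), [nonterminal (dec (i, l)),
        nonterminal (dec (i + (letters l).length, r))]⟩ ∈ (epsFree G d).rules) := by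
  have h' := h.isFactor
  rw [← h.preDec] at hu ⊢
  obtain ⟨hl, hr, hR⟩ := trimmed_node hc hf h' hu
  by_cases h1 : letters l = []
  · have h2 : letters r ≠ [] := fun h2 => h.letters_ne (by simp [h1, h2])
    have e : i + (letters l).length = i := by simp [h1]
    have hp : IsPart d (i, r) := by
      have := h'.right.isPart h2
      rwa [e] at this
    rw [e, hp.preDec] at hr hR
    exact .inl ⟨h1, hp, hr, by simp, _, hR,
      .drop (nullable_of_tree hc hf h'.left h1 hl) (.keep _ .nil)⟩
  · have hp := h'.left.isPart h1
    rw [hp.preDec] at hl hR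
    by_cases h2 : letters r = []
    · exact .inr (.inl ⟨h1, h2, hp, hl, by simp, _, hR,
        .keep _ (.drop (nullable_of_tree hc hf h'.right h2 hr) .nil)⟩)
    · have hp' := h'.right.isPart h2
      rw [hp'.preDec] at hr hR
      exact .inr (.inr ⟨h1, h2, hp, hp', hl, hr, by simp, _, hR, .keep _ (.keep _ .nil)⟩)

lemma productive_epsFree (hc : IsCNF G) (hf : IsFunctional G) {p : PosTree G} (h : IsPart d p)
    (hu : (step1 G d).Useful (dec p)) : (epsFree G d).Productive (dec p) := by
  obtain ⟨i, t⟩ := p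
  induction t generalizing i with
  | leaf A a =>
    cases a with
    | inl σ =>
      rw [← h.preDec] at hu ⊢
      have hR : ⟨preDec (i, .leaf A (Sum.inl σ)), [terminal σ]⟩ ∈ (epsFree G d).rules :=
        ⟨by simp, _, trimmed_leaf h.isFactor hu, .keep _ .nil⟩
      exact RuleSystem.productive_of_rule hR (by simp)
    | inr τ => exact absurd rfl h.letters_ne
  | node A l r ihl ihr =>
    rcases epsFree_node hc hf h hu with ⟨-, h1, h2, hR⟩ | ⟨-, -, h1, h2, hR⟩ |
      ⟨-, -, h1, h2, h3, h4, hR⟩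
    · refine RuleSystem.productive_of_rule hR fun N hN => ?_
      obtain rfl : N = _ := by simpa using hN
      exact ihr _ h1 h2
    · refine RuleSystem.productive_of_rule hR fun N hN => ?_
      obtain rfl : N = _ := by simpa using hN
      exact ihl _ h1 h2
    · refine RuleSystem.productive_of_rule hR fun N hN => ?_
      simp only [List.mem_cons, nonterminal.injEq, List.not_mem_nil, or_false] at hN
      rcases hN with rfl | rfl
      exacts [ihl _ h1 h3, ihr _ h2 h4]

/-- The non-terminal is useful after the elimination of epsilon-productions. -/
def Occurs (G : ExtractionGrammar T X) (d : List T) (N : DecNT G.NT X) : Prop :=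
  (epsFree G d).Useful N

lemma Occurs.useful_step1 {N : DecNT G.NT X} (h : Occurs G d N) : (step1 G d).Useful N := by
  refine h.productive.induction ?_
  rintro ρ ⟨-, α, hα, -⟩ -
  exact hα.2.1

lemma Occurs.reachable {p : PosTree G} (h : Occurs G d (dec p)) : Reachable G p.2.root :=
  reachable_of_useful (undecoratedUseful h.useful_step1 :)

/-- From the root of a parse tree, unit productions lead to the topmost node both of whose subtrees
have letters. -/
lemma exists_unitReachable (hc : IsCNF G) (hf : IsFunctional G) {p l r : PosTree G}
    (h : IsPart d p) (ho : Occurs G d (dec p)) (hs : core p.2 p.1 = some (l, r)) :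
    Occurs G d (dec l) ∧ Occurs G d (dec r) ∧ ∃ N, (unitful G d).UnitReachable (dec p) N ∧
      ⟨N, [nonterminal (dec l), nonterminal (dec r)]⟩ ∈ (unitful G d).rules := by
  obtain ⟨i, t⟩ := p
  dsimp only at hs
  induction t generalizing i with
  | leaf A a => simp [core] at hs
  | node A s s' ihl ihr =>
    rw [core] at hs
    rcases epsFree_node hc hf h ho.useful_step1 with ⟨h0, h1, h2, hR⟩ | ⟨h0, h0', h1, h2, hR⟩ |
      ⟨h0, h0', h1, h2, h3, h4, hR⟩
    · rw [if_pos h0] at hs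
      have hp : ∀ N, nonterminal N ∈ [nonterminal (T := T) (dec (i, s'))] →
          (epsFree G d).Productive N := by
        intro N hN
        obtain rfl : N = _ := by simpa using hN
        exact productive_epsFree hc hf h1 h2
      obtain ⟨a1, a2, N, a3, a4⟩ := ihr i h1 (RuleSystem.Useful.child hR ho hp (by simp)) hs
      exact ⟨a1, a2, N, .head (RuleSystem.mem_removeUseless hR ho hp) a3, a4⟩
    · rw [if_neg h0, if_pos h0'] at hs
      have hp : ∀ N, nonterminal N ∈ [nonterminal (T := T) (dec (i, s))] →
          (epsFree G d).Productive N := by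
        intro N hN
        obtain rfl : N = _ := by simpa using hN
        exact productive_epsFree hc hf h1 h2
      obtain ⟨a1, a2, N, a3, a4⟩ := ihl i h1 (RuleSystem.Useful.child hR ho hp (by simp)) hs
      exact ⟨a1, a2, N, .head (RuleSystem.mem_removeUseless hR ho hp) a3, a4⟩
    · rw [if_neg h0, if_neg h0'] at hs
      obtain ⟨rfl, rfl⟩ := by simpa using hs
      have hp : ∀ N, nonterminal N ∈ [nonterminal (T := T) (dec (i, s)),
          nonterminal (dec (i + (letters s).length, s'))] → (epsFree G d).Productive N := by
        intro N hN
        simp only [List.mem_cons, nonterminal.injEq, List.not_mem_nil, or_false] at hN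
        rcases hN with rfl | rfl
        exacts [productive_epsFree hc hf h1 h3, productive_epsFree hc hf h2 h4]
      exact ⟨RuleSystem.Useful.child hR ho hp (by simp),
        RuleSystem.Useful.child hR ho hp (by simp), _, .refl,
        RuleSystem.mem_removeUseless hR ho hp⟩

/-- Every split of a parse tree into two subtrees with letters is an instance of a rule of the
decorated grammar. -/
lemma exists_rule (hc : IsCNF G) (hf : IsFunctional G) {p l r : PosTree G}
    (h : IsPart d p) (ho : Occurs G d (dec p)) (hs : core p.2 p.1 = some (l, r)) :
    Occurs G d (dec l) ∧ Occurs G d (dec r) ∧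
      ⟨dec p, [nonterminal (dec l), nonterminal (dec r)]⟩ ∈ (decorated G d).rules := by
  obtain ⟨h1, h2, N, h3, h4⟩ := exists_unitReachable hc hf h ho hs
  have hR : ⟨dec p, [dec l, dec r].map nonterminal⟩ ∈ (step2 G d).rules :=
    ⟨by simp, N, h3, h4⟩
  exact ⟨h1, h2, DecRule.other hR⟩

/-- The decorated root of a parse tree of the whole document is an initial non-terminal. -/
lemma IsPart.start_mem (hc : IsCNF G) (hf : IsFunctional G) {t : RefTree G}
    (h : IsPart d (1, t)) (hl : letters t = d) (hr : t.root = G.initial) :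
    Occurs G d (dec (1, t)) ∧ (∃ x y, dec (1, t) = .span G.initial 1 d.length x y) ∧
    ⟨.start, [nonterminal (dec (1, t))]⟩ ∈ (decorated G d).rules := by
  have e : endPos (1, t) - 1 = d.length := by simp [endPos, hl]
  have e0 : ∃ x y, dec (1, t) = .span G.initial 1 d.length x y := by
    rw [dec, e, hr]
    exact ⟨_, _, rfl⟩
  have h0 : (preAdjusted G d).Useful (adj (1, t)) := by
    refine RuleSystem.useful_of_start ?_ (productive_adj h.isFactor)
    rw [adj, if_neg h.letters_ne, e, hr]
    rfl
  have h1 : (step1 G d).Useful (dec (1, t)) := by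
    refine RuleSystem.useful_of_start e0 ?_
    rw [← h.preDec]
    exact productive_step1 hc hf h.isFactor h0
  have h2 : dec (1, t) ∈ (epsFree G d).starts := ⟨e0, h1⟩
  have h3 : Occurs G d (dec (1, t)) :=
    RuleSystem.useful_of_start h2 (productive_epsFree hc hf h h1)
  exact ⟨h3, e0, DecRule.start ⟨h2, h3⟩⟩

/-! ### From rules of the decorated grammar to parse trees -/

lemma exists_tree_of_productive_eps {A : G.NT} (h : (trimmed G d).Productive (.eps A)) :
    ∃ t : RefTree G, t.Follows ↑G.rules ∧ t.root = A ∧ letters t = [] := by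
  refine h.induction (P := fun N => ∀ A, N = .eps A →
    ∃ t : RefTree G, t.Follows ↑G.rules ∧ t.root = A ∧ letters t = []) ?_ A rfl
  rintro ρ ⟨hρ : Step1Rule G d ρ, -⟩ h A hA
  cases hρ with
  | letter hR | spanEps hR | epsSpan hR | split hR => simp at hA
  | varOp hR =>
    cases hA
    cases hR.1 with
    | varOp hR => exact ⟨.leaf _ _, hR, rfl, rfl⟩
  | epsEps hR =>
    cases hA
    cases hR.1 with
    | epsEps hR =>
      obtain ⟨l, hl, rfl, hl'⟩ := h _ List.mem_cons_self _ rfl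
      obtain ⟨r, hr, rfl, hr'⟩ := h _ (List.mem_cons_of_mem _ List.mem_cons_self) _ rfl
      exact ⟨.node _ l r, ⟨hR, hl, hr⟩, rfl, by simp [hl', hr']⟩

lemma exists_of_derives_nil {α : List (Symbol T (DecNT G.NT X))}
    (h : (trimmed G d).Derives α []) : ∀ s ∈ α, ∃ A, s = nonterminal (.eps A) := by
  induction h using Relation.ReflTransGen.head_induction_on with
  | refl => simp
  | head h _ ih =>
    obtain ⟨ρ, ⟨hρ, -⟩, h⟩ := h
    obtain ⟨p, q, rfl, rfl⟩ := ContextFreeRule.rewrites_iff.1 h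
    simp only [List.mem_append, List.mem_singleton] at ih ⊢
    rintro s ((hs | rfl) | hs)
    · exact ih s (.inl (.inl hs))
    · have hρ : Step1Rule G d ρ := hρ
      have ih : ∀ s ∈ ρ.output, ∃ A, s = nonterminal (.eps A) :=
        fun s hs => ih s (.inl (.inr hs))
      cases hρ with
      | varOp | epsEps => exact ⟨_, rfl⟩
      | letter | spanEps | split => simpa using ih _ List.mem_cons_self
      | epsSpan => simpa using ih _ (List.mem_cons_of_mem _ List.mem_cons_self)
    · exact ih s (.inr hs)

lemma exists_of_nullable {N : DecNT G.NT X} (h : (trimmed G d).Nullable N) :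
    ∃ t : RefTree G, N = .eps t.root ∧ t.Follows ↑G.rules ∧ letters t = [] := by
  obtain ⟨A, hA⟩ := exists_of_derives_nil h _ (List.mem_singleton_self _)
  obtain rfl : N = .eps A := by simpa using hA
  obtain ⟨t, ht, rfl, hl⟩ := exists_tree_of_productive_eps ⟨[], h⟩
  exact ⟨t, rfl, ht, hl⟩

/-- Parse trees for the right-hand side of the rule can be combined to a parse tree for its
left-hand side. -/
inductive Sound (G : ExtractionGrammar T X) (d : List T) :
    DecNT G.NT X → List (Symbol T (DecNT G.NT X)) → Prop
  | letter {p : PosTree G} {σ : T} : IsPart d p → core p.2 p.1 = none →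
      Sound G d (dec p) [terminal σ]
  | unit {N M : DecNT G.NT X} :
      (∀ q : PosTree G, IsPart d q → dec q = M →
        ∃ p : PosTree G, IsPart d p ∧ dec p = N ∧ core p.2 p.1 = core q.2 q.1) →
      Sound G d N [nonterminal M]
  | split {N L R : DecNT G.NT X} :
      (∀ l r : PosTree G, IsPart d l → IsPart d r → dec l = L → dec r = R →
        ∃ p : PosTree G, IsPart d p ∧ dec p = N ∧ core p.2 p.1 = some (l, r)) →
      Sound G d N [nonterminal L, nonterminal R]

lemma sound_spanEps (hc : IsCNF G) (hf : IsFunctional G) {A B : G.NT} {s : RefTree G} {i j : ℕ}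
    {x y : Finset (VarOp X)} (hs : s.Follows ↑G.rules) (hl : letters s = [])
    (h : ⟨AdjNT.span A i j, [nonterminal (AdjNT.span B i j), nonterminal (AdjNT.eps s.root)]⟩
        ∈ (adjusted G d).rules) :
    Sound G d (.span A i j x (y ∪ opsOf G s.root)) [nonterminal (.span B i j x y)] := by
  have hs' := reachable_of_useful (h.2.2 (.eps s.root) (by simp))
  have hR : ⟨A, [nonterminal B, nonterminal s.root]⟩ ∈ G.rules := by
    cases h.1; assumption
  refine .unit ?_
  rintro ⟨i', t⟩ hq hM
  simp only [dec, DecNT.span.injEq] at hM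
  obtain ⟨rfl, rfl, rfl, rfl, rfl⟩ := hM
  obtain ⟨ht, hne, u, v, hd, hu⟩ := hq
  refine ⟨(i', .node A t s), ⟨⟨hR, ht, hs⟩, by simp [hl, hne], u, v, by simp [hl, hd], hu⟩,
    dec_node_eps_right hc hf hne hl hs' hs, ?_⟩
  dsimp only at hne
  simp [core, hl, hne]

lemma sound_epsSpan (hc : IsCNF G) (hf : IsFunctional G) {A C : G.NT} {s : RefTree G} {i j : ℕ}
    {x y : Finset (VarOp X)} (hs : s.Follows ↑G.rules) (hl : letters s = [])
    (h : ⟨AdjNT.span A i j, [nonterminal (AdjNT.eps s.root), nonterminal (AdjNT.span C i j)]⟩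
        ∈ (adjusted G d).rules) :
    Sound G d (.span A i j (x ∪ opsOf G s.root) y) [nonterminal (.span C i j x y)] := by
  have hs' := reachable_of_useful (h.2.2 (.eps s.root) (by simp))
  have hR : ⟨A, [nonterminal s.root, nonterminal C]⟩ ∈ G.rules := by
    cases h.1; assumption
  refine .unit ?_
  rintro ⟨i', t⟩ hq hM
  simp only [dec, DecNT.span.injEq] at hM
  obtain ⟨rfl, rfl, rfl, rfl, rfl⟩ := hM
  obtain ⟨ht, hne, u, v, hd, hu⟩ := hq
  refine ⟨(i', .node A s t), ⟨⟨hR, hs, ht⟩, by simp [hl, hne], u, v, by simp [hl, hd], hu⟩,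
    dec_node_eps_left hc hf hl hne hs' hs, ?_⟩
  simp [core, hl]

omit [Fintype X] in
lemma sound_split {A B C : G.NT} {i i' j : ℕ} {x y z w : Finset (VarOp X)}
    (h : ⟨AdjNT.span A i j, [nonterminal (AdjNT.span B i i'),
      nonterminal (AdjNT.span C (i' + 1) j)]⟩ ∈ (adjusted G d).rules) :
    Sound G d (.span A i j x w)
      [nonterminal (.span B i i' x y), nonterminal (.span C (i' + 1) j z w)] := by
  have hR : ⟨A, [nonterminal B, nonterminal C]⟩ ∈ G.rules := by
    cases h.1; assumption
  refine .split ?_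
  rintro ⟨k, l⟩ ⟨k', r⟩ hl hr hL hR'
  simp only [dec, DecNT.span.injEq] at hL hR'
  have h1 := hl.lt_endPos
  obtain ⟨rfl, rfl, rfl, rfl, rfl⟩ := hL
  obtain ⟨rfl, hk, rfl, rfl, rfl⟩ := hR'
  obtain rfl : k' = endPos (k, l) := by dsimp only at h1; omega
  have hp := hl.isFactor.node hr.isFactor hR
  have hl1 := hl.letters_ne
  have hr1 := hr.letters_ne
  dsimp only at hl1 hr1
  exact ⟨_, hp.isPart (by simp [hl1]), dec_node_split hl1 hr1, by simp [core, hl1, hr1, endPos]⟩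

/-- The rules without epsilon-productions are sound, as long as the right-hand side has no
non-terminal `A_ε`. -/
lemma epsFree_sound (hc : IsCNF G) (hf : IsFunctional G) {ρ : ContextFreeRule T (DecNT G.NT X)}
    (h : ρ ∈ (epsFree G d).rules) (hε : ∀ A, nonterminal (.eps A) ∉ ρ.output) :
    Sound G d ρ.input ρ.output := by
  obtain ⟨N, β⟩ := ρ
  obtain ⟨hne, α, hα, hdrop⟩ := h
  dsimp only at *
  have hstep : Step1Rule G d ⟨N, α⟩ := hα.1
  cases hstep with
  | @letter A σ i hR =>
    cases hdrop with
    | keep _ hdrop =>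
      cases hdrop
      have hR' := hR.1
      cases hR' with
      | letter hR' h1 h2 =>
        have e : letters (G := G) (.leaf A (Sum.inl σ)) = [σ] := rfl
        have hp : IsPart d ((i, .leaf A (Sum.inl σ)) : PosTree G) := by
          obtain ⟨h3, h4⟩ := List.getElem?_eq_some_iff.1 h2
          refine ⟨hR', by simp [e], d.take (i - 1), d.drop i, ?_, ?_⟩
          · have h5 := List.take_append_drop (i - 1) d
            rw [List.drop_eq_getElem_cons h3, Nat.sub_add_cancel h1, h4] at h5
            rw [e, List.append_assoc]
            exact h5.symm
          · rw [List.length_take]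
            dsimp only
            omega
        have := Sound.letter (σ := σ) hp rfl
        simpa [dec, endPos, e, opsAt, PTree.yield, entries] using this
  | varOp hR => cases hdrop; exact absurd rfl hne
  | @epsEps A B C hR =>
    cases hdrop with
    | keep => exact absurd (by simp) (hε B)
    | drop _ hdrop =>
      cases hdrop with
      | keep => exact absurd (by simp) (hε C)
      | drop _ hdrop => cases hdrop; exact absurd rfl hne
  | @spanEps A B C i j x y hR =>
    cases hdrop with
    | keep _ hdrop =>
      cases hdrop with
      | keep => exact absurd (by simp) (hε C)
      | drop hn hdrop =>
        cases hdrop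
        obtain ⟨t, hC, ht, hl⟩ := exists_of_nullable hn
        cases hC
        exact sound_spanEps hc hf ht hl hR
    | drop hn => obtain ⟨t, hC, -⟩ := exists_of_nullable hn; cases hC
  | @epsSpan A B C i j x y hR =>
    cases hdrop with
    | keep => exact absurd (by simp) (hε B)
    | drop hn hdrop =>
      cases hdrop with
      | keep _ hdrop =>
        cases hdrop
        obtain ⟨t, hC, ht, hl⟩ := exists_of_nullable hn
        cases hC
        exact sound_epsSpan hc hf ht hl hR
      | drop hn => obtain ⟨t, hC, -⟩ := exists_of_nullable hn; cases hC
  | split hR =>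
    cases hdrop with
    | keep _ hdrop =>
      cases hdrop with
      | keep _ hdrop =>
        cases hdrop
        exact sound_split hR
      | drop hn => obtain ⟨t, hC, -⟩ := exists_of_nullable hn; cases hC
    | drop hn => obtain ⟨t, hC, -⟩ := exists_of_nullable hn; cases hC

lemma Occurs.exists_part (hc : IsCNF G) (hf : IsFunctional G) {N : DecNT G.NT X}
    (h : Occurs G d N) : ∃ p : PosTree G, IsPart d p ∧ dec p = N := by
  refine h.productive.induction
    (P := fun N => ∃ p : PosTree G, IsPart d p ∧ dec p = N) ?_
  intro ρ hρ ih
  have hs := epsFree_sound hc hf hρ fun A hA => by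
    obtain ⟨p, -, hp⟩ := ih _ hA
    cases hp
  obtain ⟨N, α⟩ := ρ
  dsimp only at *
  cases hs with
  | letter h _ => exact ⟨_, h, rfl⟩
  | unit h =>
    obtain ⟨q, h1, h2⟩ := ih _ (List.mem_singleton_self _)
    obtain ⟨p, h3, h4, -⟩ := h q h1 h2
    exact ⟨p, h3, h4⟩
  | split h =>
    obtain ⟨l, h1, h2⟩ := ih _ List.mem_cons_self
    obtain ⟨r, h3, h4⟩ := ih _ (List.mem_cons_of_mem _ List.mem_cons_self)
    obtain ⟨p, h5, h6, -⟩ := h l r h1 h3 h2 h4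
    exact ⟨p, h5, h6⟩

lemma unitful_sound (hc : IsCNF G) (hf : IsFunctional G) {ρ : ContextFreeRule T (DecNT G.NT X)}
    (h : ρ ∈ (unitful G d).rules) : Sound G d ρ.input ρ.output := by
  refine epsFree_sound hc hf h.1 fun A hA => ?_
  obtain ⟨p, -, hp⟩ := Occurs.exists_part hc hf (h.2.2 _ hA)
  cases hp

lemma unitReachable_sound (hc : IsCNF G) (hf : IsFunctional G) {N M : DecNT G.NT X}
    (h : (unitful G d).UnitReachable N M) {q : PosTree G} (hq : IsPart d q) (hM : dec q = M) :
    ∃ p : PosTree G, IsPart d p ∧ dec p = N ∧ core p.2 p.1 = core q.2 q.1 := by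
  induction h using Relation.ReflTransGen.head_induction_on with
  | refl => exact ⟨q, hq, hM, rfl⟩
  | head h _ ih =>
    obtain ⟨p, h1, h2, h3⟩ := ih
    have hs := unitful_sound hc hf h
    cases hs with
    | unit hs =>
      obtain ⟨p', h4, h5, h6⟩ := hs p h1 h2
      exact ⟨p', h4, h5, h6.trans h3⟩

lemma occurs_of_unitReachable {N M : DecNT G.NT X} (h : (unitful G d).UnitReachable N M)
    (hM : Occurs G d M) : Occurs G d N := by
  rcases Relation.ReflTransGen.cases_head h with rfl | ⟨K, hK, -⟩
  exacts [hM, hK.2.1]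

lemma decorated_rule_cases {N : DecNT G.NT X} {α : List (Symbol (DecTerminal X) (DecNT G.NT X))}
    (h : ⟨N, α⟩ ∈ (decorated G d).rules) :
    (N = .start ∧ ∃ M ∈ (step2 G d).starts, α = [nonterminal M]) ∨
    (∃ t σ, α = [terminal t] ∧ ⟨N, [terminal σ]⟩ ∈ (step2 G d).rules) ∨
    ∃ β : List (DecNT G.NT X), α = β.map nonterminal ∧
      ⟨N, β.map nonterminal⟩ ∈ (step2 G d).rules := by
  generalize hρ : (⟨N, α⟩ : ContextFreeRule _ _) = ρ at h
  change DecRule G d ρ at h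
  cases h with
  | start h => cases hρ; exact .inl ⟨rfl, _, h, rfl⟩
  | letter h => cases hρ; exact .inr (.inl ⟨_, _, rfl, h⟩)
  | other h => cases hρ; exact .inr (.inr ⟨_, rfl, h⟩)

lemma map_nonterminal_eq {T' T'' N : Type*} {β : List N} {L R : N}
    (h : β.map nonterminal = [nonterminal L, nonterminal (T := T') R]) :
    β.map nonterminal = [nonterminal L, nonterminal (T := T'') R] := by
  rcases β with - | ⟨B, - | ⟨C, - | ⟨D, β⟩⟩⟩ <;> simp_all

/-- Parse trees for the right-hand side of a rule of the decorated grammar are the two parts of a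
parse tree for the left-hand side. -/
lemma exists_of_rule (hc : IsCNF G) (hf : IsFunctional G) {N L R : DecNT G.NT X}
    (h : ⟨N, [nonterminal L, nonterminal R]⟩ ∈ (decorated G d).rules) :
    Occurs G d N ∧ Occurs G d L ∧ Occurs G d R ∧
    ∀ l r : PosTree G, IsPart d l → IsPart d r → dec l = L → dec r = R →
      ∃ p : PosTree G, IsPart d p ∧ dec p = N ∧ core p.2 p.1 = some (l, r) := by
  have h2 : ⟨N, [nonterminal L, nonterminal R]⟩ ∈ (step2 G d).rules := by
    rcases decorated_rule_cases h with ⟨-, M, -, h⟩ | ⟨t, σ, h, -⟩ | ⟨β, hβ, h⟩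
    · simp at h
    · simp at h
    · rwa [map_nonterminal_eq hβ.symm] at h
  obtain ⟨-, M, h3, h4⟩ := h2
  refine ⟨occurs_of_unitReachable h3 h4.2.1, h4.2.2 _ (by simp), h4.2.2 _ (by simp), ?_⟩
  intro l r hl hr hL hR
  have hs := unitful_sound hc hf h4
  cases hs with
  | split hs =>
    obtain ⟨q, h5, h6, h7⟩ := hs l r hl hr hL hR
    obtain ⟨p, h8, h9, h10⟩ := unitReachable_sound hc hf h3 h5 h6
    exact ⟨p, h8, h9, h10.trans h7⟩

omit [Fintype X] [DecidableEq X] in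
lemma length_letters_of_core_eq_none {t : RefTree G} {i : ℕ} (h : core t i = none) :
    (letters t).length ≤ 1 := by
  induction t with
  | leaf A a => cases a <;> simp [letters, PTree.yield]
  | node A l r ihl ihr =>
    rw [core] at h
    split_ifs at h with h1 h2
    · simpa [h1] using ihr h
    · simpa [h2] using ihl h

omit [Fintype X] in
lemma inner_eq_empty_of_core_eq_none {p : PosTree G} (h : core p.2 p.1 = none) :
    inner p = ∅ := by
  have := length_letters_of_core_eq_none h
  ext e
  simp [endPos]
  omega

/-- The rules for the non-stable non-terminals produce two non-terminals. -/
lemma output_of_not_stable (hc : IsCNF G) (hf : IsFunctional G)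
    {ρ : ContextFreeRule (DecTerminal X) (DecNT G.NT X)} (h : ρ ∈ (decorated G d).rules)
    (ho : Occurs G d ρ.input) (hs : ¬ Stable G ρ.input) :
    ∃ L R, ρ.output = [nonterminal L, nonterminal R] := by
  obtain ⟨N, α⟩ := ρ
  dsimp only at *
  rcases decorated_rule_cases h with ⟨rfl, -⟩ | ⟨t, σ, rfl, h2⟩ | ⟨β, rfl, h2⟩
  · obtain ⟨p, -, hp⟩ := ho.exists_part hc hf
    cases hp
  · obtain ⟨-, M, h3, h4⟩ := h2
    have h5 := unitful_sound hc hf h4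
    cases h5 with
    | letter h5 h6 =>
      obtain ⟨p, h8, rfl, h10⟩ := unitReachable_sound hc hf h3 h5 rfl
      exact absurd ((stable_dec hc hf h8.follows ho.reachable).2
        (inner_eq_empty_of_core_eq_none (h10.trans h6))) hs
  · obtain ⟨hn, M, h3, h4⟩ := h2
    have h5 := unitful_sound hc hf h4
    dsimp only at h5 hn
    generalize hα : β.map nonterminal = α at h5 hn
    cases h5 with
    | letter => cases β <;> simp at hα
    | unit => exact absurd ⟨_, rfl⟩ hn
    | split => exact ⟨_, _, map_nonterminal_eq hα⟩

lemma exists_of_start (hc : IsCNF G) (hf : IsFunctional G) {N : DecNT G.NT X}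
    (h : ⟨.start, [nonterminal N]⟩ ∈ (decorated G d).rules) : Occurs G d N := by
  rcases decorated_rule_cases h with ⟨-, M, hM, h⟩ | ⟨t, σ, h, -⟩ | ⟨β, -, -, M, h3, h4⟩
  · obtain rfl : N = M := by simpa using h
    exact hM.2
  · simp at h
  · obtain ⟨p, -, hp⟩ := (occurs_of_unitReachable h3 h4.2.1).exists_part hc hf
    cases hp

end ExtractionGrammar

/-! ### Sequences of skippable rules along a parse tree -/

namespace ExtractionGrammar

open Symbol RefWord

variable {T : Type u} {X : Type v} {G : ExtractionGrammar T X} {d : List T}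
  [Fintype X] [DecidableEq X]

lemma Skippable.not_stable {N L R : DecNT G.NT X}
    (h : Skippable G ⟨N, [nonterminal L, nonterminal R]⟩) : ¬ Stable G N := by
  obtain ⟨A, B, C, i, i', j, x, y, x', z, z', y', h, hs, -⟩ := h
  cases h
  exact hs

lemma Skippable.xor {N L R : DecNT G.NT X}
    (h : Skippable G ⟨N, [nonterminal L, nonterminal R]⟩) : Xor (Stable G L) (Stable G R) := by
  obtain ⟨A, B, C, i, i', j, x, y, x', z, z', y', h, -, -, -, h'⟩ := h
  cases h
  exact h'

omit [Fintype X] in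
lemma between_eq_empty_iff {l r : PosTree G} : between l r = ∅ ↔
    opsAt l.1 (endPos l) l.2.yield = ∅ ∧ opsAt r.1 r.1 r.2.yield = ∅ := by
  simp [between, Finset.union_eq_empty]

lemma skippable_iff {p l r : PosTree G} (h : IsPart d p) (hs : core p.2 p.1 = some (l, r)) :
    Skippable G ⟨dec p, [nonterminal (dec l), nonterminal (dec r)]⟩ ↔
      ¬ Stable G (dec p) ∧ between l r = ∅ ∧ Xor (Stable G (dec l)) (Stable G (dec r)) := by
  constructor
  · refine fun h => ⟨h.not_stable, ?_, h.xor⟩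
    obtain ⟨A, B, C, i, i', j, x, y, x', z, z', y', h, -, rfl, rfl, -⟩ := h
    simp only [dec, ContextFreeRule.mk.injEq, List.cons.injEq, nonterminal.injEq,
      DecNT.span.injEq] at h
    exact between_eq_empty_iff.2 ⟨h.2.1.2.2.2.2, h.2.2.1.2.2.2.1⟩
  · rintro ⟨h1, h2, h3⟩
    rw [between_eq_empty_iff] at h2
    obtain ⟨-, -, -, -, h0, h4, h5, -⟩ := core_spec hs h.follows
    have h6 : r.1 = endPos l - 1 + 1 := by
      have := (h.core hs).1.lt_endPos
      omega
    have h7 : endPos p = endPos r := by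
      simp only [endPos, h0, h5, h4, List.length_append]
      omega
    refine ⟨p.2.root, l.2.root, r.2.root, p.1, endPos l - 1, endPos p - 1, _, _,
      opsAt l.1 l.1 l.2.yield, _, _, opsAt r.1 (endPos r) r.2.yield, ?_, h1, h2.1, h2.2, ?_⟩
    · simp only [dec, h4, ← h6, h7]
    · simpa only [dec, h4, ← h6, h7] using h3

/-- `Jumps p M a b`: along the parse tree `p`, a sequence of skippable rules leads to a subtree with
the decorated root `M`, and there a rule that is not skippable produces the subtrees `a` and `b`. -/
inductive Jumps : PosTree G → DecNT G.NT X → PosTree G → PosTree G → Prop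
  | here {p l r : PosTree G} : core p.2 p.1 = some (l, r) →
      ¬ Skippable G ⟨dec p, [nonterminal (dec l), nonterminal (dec r)]⟩ → Jumps p (dec p) l r
  | left {p l r a b : PosTree G} {M : DecNT G.NT X} : core p.2 p.1 = some (l, r) →
      Skippable G ⟨dec p, [nonterminal (dec l), nonterminal (dec r)]⟩ → ¬ Stable G (dec l) →
      Jumps l M a b → Jumps p M a b
  | right {p l r a b : PosTree G} {M : DecNT G.NT X} : core p.2 p.1 = some (l, r) →
      Skippable G ⟨dec p, [nonterminal (dec l), nonterminal (dec r)]⟩ → ¬ Stable G (dec r) →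
      Jumps r M a b → Jumps p M a b

/-- A parse tree determines the sequence of skippable rules and the rule that follows. -/
lemma Jumps.deterministic {p a b a' b' : PosTree G} {M M' : DecNT G.NT X} (h : Jumps p M a b)
    (h' : Jumps p M' a' b') : M = M' ∧ a = a' ∧ b = b' := by
  induction h generalizing M' a' b' with
  | here hc hs =>
    cases h' with
    | here hc' hs' => simp_all
    | left hc' hs' | right hc' hs' => simp_all
  | left hc hs hl _ ih =>
    cases h' with
    | here hc' hs' => simp_all
    | left hc' _ _ h' =>
      obtain ⟨rfl, rfl⟩ := by simpa [hc] using hc'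
      exact ih h'
    | right hc' hs' hr h' =>
      obtain ⟨rfl, rfl⟩ := by simpa [hc] using hc'
      rcases hs.xor with h | h
      exacts [absurd h.1 hl, absurd h.1 hr]
  | right hc hs hr _ ih =>
    cases h' with
    | here hc' hs' => simp_all
    | left hc' _ hl h' =>
      obtain ⟨rfl, rfl⟩ := by simpa [hc] using hc'
      rcases hs.xor with h | h
      exacts [absurd h.1 hl, absurd h.1 hr]
    | right hc' hs' _ h' =>
      obtain ⟨rfl, rfl⟩ := by simpa [hc] using hc'
      exact ih h'

/-- Along the parse tree of a non-stable non-terminal, the loops of ENUMERATE find the non-skippable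
rule that comes first. -/
lemma exists_jumps (hc : IsCNF G) (hf : IsFunctional G) {p : PosTree G} (h : IsPart d p)
    (ho : Occurs G d (dec p)) (hs : ¬ Stable G (dec p)) :
    ∃ M a b, Jumps p M a b ∧ M ∈ jump G d (dec p) ∧ (dec a, dec b) ∈ nonSkippable G d M := by
  obtain ⟨n, hn⟩ : ∃ n, p.2.size ≤ n := ⟨_, le_rfl⟩
  induction n generalizing p with
  | zero => obtain ⟨i, _ | _⟩ := p <;> simp [PTree.size] at hn
  | succ n ih =>
    cases hs' : core p.2 p.1 with
    | none =>
      exact absurd ((stable_dec hc hf h.follows ho.reachable).2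
        (inner_eq_empty_of_core_eq_none hs')) hs
    | some lr =>
      obtain ⟨l, r⟩ := lr
      obtain ⟨hol, hor, hR⟩ := exists_rule hc hf h ho hs'
      obtain ⟨-, -, -, -, -, -, -, hsl, hsr, -⟩ := core_spec hs' h.follows
      obtain ⟨hl, hr⟩ := h.core hs'
      by_cases hk : Skippable G ⟨dec p, [nonterminal (dec l), nonterminal (dec r)]⟩
      · rcases hk.xor with ⟨-, hx⟩ | ⟨-, hx⟩
        · obtain ⟨M, a, b, h1, ⟨h2, h2'⟩, h3⟩ := ih hr hor hx (by omega)
          exact ⟨M, a, b, .right hs' hk hx h1,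
            ⟨.head ⟨_, hR, hk, rfl, by simp, hx⟩ h2, h2'⟩, h3⟩
        · obtain ⟨M, a, b, h1, ⟨h2, h2'⟩, h3⟩ := ih hl hol hx (by omega)
          exact ⟨M, a, b, .left hs' hk hx h1,
            ⟨.head ⟨_, hR, hk, rfl, by simp, hx⟩ h2, h2'⟩, h3⟩
      · exact ⟨_, l, r, .here hs' hk, ⟨.refl, _, hR, rfl, hk⟩, hR, hk⟩

/-- Parse trees for the two non-terminals on the right-hand side of a non-skippable rule come from a
parse tree for every non-terminal from which the rule is reached. The stable non-terminals that
skippable rules split off have parse trees since they are useful. -/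
lemma exists_of_jump (hc : IsCNF G) (hf : IsFunctional G) {N M : DecNT G.NT X}
    (hM : M ∈ jump G d N) {a b : PosTree G} (ha : IsPart d a) (hb : IsPart d b)
    (hab : (dec a, dec b) ∈ nonSkippable G d M) :
    ∃ p : PosTree G, IsPart d p ∧ dec p = N ∧ Jumps p M a b := by
  obtain ⟨hM, -⟩ := hM
  induction hM using Relation.ReflTransGen.head_induction_on with
  | refl =>
    obtain ⟨-, -, -, h⟩ := exists_of_rule hc hf hab.1
    obtain ⟨p, h1, rfl, h2⟩ := h a b ha hb rfl rfl
    exact ⟨p, h1, rfl, .here h2 hab.2⟩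
  | @head N N' h _ ih =>
    obtain ⟨p', h1, rfl, h2⟩ := ih
    obtain ⟨⟨N₀, α⟩, hR, hk, rfl, hN', hs⟩ := h
    have hk' := hk
    obtain ⟨A, B, C, i, i', j, x, y, x', z, z', y', hρ, -⟩ := hk'
    injection hρ with hN hα
    subst hα
    obtain ⟨ho, hoL, hoR, h⟩ := exists_of_rule hc hf hR
    simp only [List.mem_cons, nonterminal.injEq, List.not_mem_nil, or_false] at hN'
    rcases hN' with hN' | hN'
    · obtain ⟨q, hq, hqR⟩ := hoR.exists_part hc hf
      obtain ⟨p, h3, h4, h5⟩ := h p' q h1 hq hN' hqR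
      exact ⟨p, h3, h4, .left h5 (by rw [h4, hN', hqR]; exact hk) hs h2⟩
    · obtain ⟨q, hq, hqL⟩ := hoL.exists_part hc hf
      obtain ⟨p, h3, h4, h5⟩ := h q p' hq h1 hqL hN'
      exact ⟨p, h3, h4, .right h5 (by rw [h4, hN', hqL]; exact hk) hs h2⟩

lemma Jumps.isPart {p a b : PosTree G} {M : DecNT G.NT X} (h : Jumps p M a b)
    (hp : IsPart d p) : IsPart d a ∧ IsPart d b := by
  induction h with
  | here hc => exact hp.core hc
  | left hc _ _ _ ih => exact ih (hp.core hc).1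
  | right hc _ _ _ ih => exact ih (hp.core hc).2

/-- The inner variable operations of a parse tree are recovered from those of the subtrees to which
a jump leads. -/
lemma Jumps.inner (hc : IsCNF G) (hf : IsFunctional G) {p a b : PosTree G} {M : DecNT G.NT X}
    (h : Jumps p M a b) (hp : IsPart d p) (ho : Occurs G d (dec p)) :
    Occurs G d (dec a) ∧ Occurs G d (dec b) ∧
    (∀ e, e ∈ inner p ↔ e ∈ inner a ∨ e ∈ inner b ∨ e ∈ between a b) ∧
    (inner p).card = (inner a).card + (inner b).card +
      (opsAt a.1 (endPos a) a.2.yield ∪ opsAt b.1 b.1 b.2.yield).card := by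
  induction h with
  | here hs =>
    obtain ⟨h1, h2, -⟩ := exists_rule hc hf hp ho hs
    exact ⟨h1, h2, mem_inner_core hp hs, card_inner_core hp hs⟩
  | @left p l r a b M hs hk hl _ ih =>
    obtain ⟨h1, h2, -⟩ := exists_rule hc hf hp ho hs
    obtain ⟨h3, h4, h5, h6⟩ := ih (hp.core hs).1 h1
    have he : ExtractionGrammar.inner p = ExtractionGrammar.inner l := by
      ext e
      have hr : Stable G (dec r) := by
        rcases hk.xor with h | h
        exacts [absurd h.1 hl, h.1]
      rw [mem_inner_core hp hs, ((skippable_iff hp hs).1 hk).2.1,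
        (stable_dec hc hf (hp.core hs).2.follows h2.reachable).1 hr]
      simp
    rw [he]
    exact ⟨h3, h4, h5, h6⟩
  | @right p l r a b M hs hk hr _ ih =>
    obtain ⟨h1, h2, -⟩ := exists_rule hc hf hp ho hs
    obtain ⟨h3, h4, h5, h6⟩ := ih (hp.core hs).2 h2
    have he : ExtractionGrammar.inner p = ExtractionGrammar.inner r := by
      ext e
      have hl : Stable G (dec l) := by
        rcases hk.xor with h | h
        exacts [h.1, absurd h.1 hr]
      rw [mem_inner_core hp hs, ((skippable_iff hp hs).1 hk).2.1,
        (stable_dec hc hf (hp.core hs).1.follows h1.reachable).1 hl]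
      simp
    rw [he]
    exact ⟨h3, h4, h5, h6⟩

omit [Fintype X] in
lemma mem_prodEntries {a b : PosTree G} (ha : IsPart d a) (e : Entry X) :
    e ∈ prodEntries (dec a, dec b) ↔ e ∈ between a b := by
  have h : endPos a - 1 + 1 = endPos a := by have := ha.lt_endPos; omega
  simp only [dec, prodEntries, between, h, List.mem_map, Finset.mem_toList, Finset.mem_image]

omit [Fintype X] in
lemma length_prodEntries {a b : PosTree G} : (prodEntries (dec a, dec b)).length =
    (opsAt a.1 (endPos a) a.2.yield ∪ opsAt b.1 b.1 b.2.yield).card := by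
  simp [dec, prodEntries]

/-- The subtrees with non-stable roots. -/
noncomputable def nonStableTrees (q : List (PosTree G)) : List (PosTree G) :=
  open Classical in q.filter fun p => decide (¬ Stable G (dec p))

lemma map_dec_nonStableTrees (q : List (PosTree G)) :
    (nonStableTrees q).map dec = nonStable G (q.map dec) := by
  rw [nonStableTrees, nonStable, List.filter_map]
  rfl

lemma mem_nonStableTrees {q : List (PosTree G)} {p : PosTree G} :
    p ∈ nonStableTrees q ↔ p ∈ q ∧ ¬ Stable G (dec p) := by
  simp [nonStableTrees]

lemma mem_nonStable {α : List (DecNT G.NT X)} {N : DecNT G.NT X} :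
    N ∈ nonStable G α ↔ N ∈ α ∧ ¬ Stable G N := by
  simp [nonStable]

/-- A choice of parse trees for the non-stable non-terminals of a sequence extends to a choice of
parse trees for the whole sequence. -/
lemma exists_nonStableTrees_eq (hc : IsCNF G) (hf : IsFunctional G) {α : List (DecNT G.NT X)}
    (ho : ∀ N ∈ α, Occurs G d N) {s : List (PosTree G)} (hs : s.map dec = nonStable G α)
    (hp : ∀ p ∈ s, IsPart d p) :
    ∃ q : List (PosTree G), q.map dec = α ∧ (∀ p ∈ q, IsPart d p) ∧ nonStableTrees q = s := by
  induction α generalizing s with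
  | nil => exact ⟨[], rfl, by simp, by simp_all [nonStable, nonStableTrees]⟩
  | cons N α ih =>
    simp only [List.forall_mem_cons] at ho
    by_cases hN : Stable G N
    · obtain ⟨q, h1, h2, h3⟩ := ih ho.2 (s := s) (by simpa [nonStable, hN] using hs) hp
      obtain ⟨p, h4, rfl⟩ := ho.1.exists_part hc hf
      exact ⟨p :: q, by simp [h1], List.forall_mem_cons.2 ⟨h4, h2⟩,
        by simpa [nonStableTrees, hN] using h3⟩
    · cases s with
      | nil => simp [nonStable, hN] at hs
      | cons p s =>
        simp only [List.forall_mem_cons] at hp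
        obtain ⟨rfl, hs'⟩ : dec p = N ∧ s.map dec = nonStable G α := by
          simpa [nonStable, hN] using hs
        obtain ⟨q, h1, h2, h3⟩ := ih ho.2 hs' hp.2
        exact ⟨p :: q, by simp [h1], List.forall_mem_cons.2 ⟨hp.1, h2⟩,
          by simpa [nonStableTrees, hN] using h3⟩

lemma exists_mem_nonStableTrees (hc : IsCNF G) (hf : IsFunctional G) {q : List (PosTree G)}
    (hq : ∀ p ∈ q, IsPart d p ∧ Occurs G d (dec p)) (e : Entry X) :
    (∃ p ∈ nonStableTrees q, e ∈ inner p) ↔ ∃ p ∈ q, e ∈ inner p := by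
  simp only [mem_nonStableTrees]
  constructor
  · rintro ⟨p, ⟨h1, -⟩, h2⟩
    exact ⟨p, h1, h2⟩
  · rintro ⟨p, h1, h2⟩
    refine ⟨p, ⟨h1, fun hs => ?_⟩, h2⟩
    rw [(stable_dec hc hf (hq p h1).1.follows (hq p h1).2.reachable).1 hs] at h2
    simp at h2

end ExtractionGrammar

/-! ### Gaps between the outputs of a trace -/

namespace Enumerate

/-- There is an output in the trace, at most `a` steps without output precede the first one, at most
`g` separate two successive ones, and at most `b` follow the last one. -/
inductive Paced {α : Type*} (g b : ℕ) : ℕ → List (Option α) → Prop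
  | tick {a : ℕ} {tr : List (Option α)} : Paced g b a tr → Paced g b (a + 1) (none :: tr)
  | out {a : ℕ} {m : α} {tr : List (Option α)} : Paced g b g tr → Paced g b a (some m :: tr)
  | last {a : ℕ} {m : α} {tr : List (Option α)} :
      Silent tr → tr.length ≤ b → Paced g b a (some m :: tr)

section Paced

variable {α : Type*} {g b a : ℕ} {tr : List (Option α)}

lemma Paced.mono (h : Paced g b a tr) {a' b' : ℕ} (ha : a ≤ a') (hb : b ≤ b') :
    Paced g b' a' tr := by
  induction h generalizing a' with
  | tick _ ih =>
    obtain ⟨a', rfl⟩ := Nat.exists_eq_succ_of_ne_zero (show a' ≠ 0 by omega)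
    exact .tick (ih (by omega))
  | out _ ih => exact .out (ih le_rfl)
  | last h1 h2 => exact .last h1 (h2.trans hb)

lemma Paced.replicate_append (h : Paced g b a tr) (n : ℕ) :
    Paced g b (a + n) (List.replicate n none ++ tr) := by
  induction n with
  | zero => exact h
  | succ n ih => exact ih.tick

lemma Paced.append (h : Paced g b a tr) {a' b' : ℕ} {tr' : List (Option α)}
    (h' : Paced g b' a' tr') (hab : b + a' ≤ g) : Paced g b' a (tr ++ tr') := by
  induction h with
  | tick _ ih => exact ih.tick
  | out _ ih => exact ih.out
  | @last a m tr h1 h2 =>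
    refine .out ?_
    rw [List.eq_replicate_iff.2 ⟨rfl, h1⟩]
    exact (h'.replicate_append _).mono (by omega) le_rfl

lemma Paced.append_replicate (h : Paced g b a tr) (n : ℕ) :
    Paced g (b + n) a (tr ++ List.replicate n none) := by
  induction h with
  | tick _ ih => exact ih.tick
  | out _ ih => exact ih.out
  | last h1 h2 =>
    refine .last ?_ (by simpa using h2)
    intro o ho
    rcases List.mem_append.1 ho with ho | ho
    exacts [h1 o ho, List.eq_of_mem_replicate ho]

lemma Paced.length_prefix_le (h : Paced g b a tr) {gap r : List (Option α)} (htr : tr = gap ++ r)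
    (hs : Silent gap) : gap.length ≤ a := by
  induction h generalizing gap with
  | tick _ ih =>
    cases gap with
    | nil => simp
    | cons o gap =>
      simp only [List.cons_append, List.cons.injEq] at htr
      simpa using ih htr.2 fun o ho => hs o (List.mem_cons_of_mem _ ho)
  | out | last =>
    cases gap with
    | nil => simp
    | cons o gap =>
      have := hs o List.mem_cons_self
      simp [this] at htr

lemma Paced.length_gap_le (h : Paced g b a tr) {n : ℕ} (ha : a ≤ n) (hg : g ≤ n) (hb : b ≤ n)
    {l gap r : List (Option α)} (htr : tr = l ++ gap ++ r) (hs : Silent gap) : gap.length ≤ n := by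
  induction h generalizing l with
  | tick h ih =>
    cases l with
    | nil => exact (h.tick.length_prefix_le htr hs).trans ha
    | cons o l =>
      simp only [List.cons_append, List.cons.injEq] at htr
      exact ih (by omega) htr.2
  | out h ih =>
    cases l with
    | nil => exact (h.out.length_prefix_le htr hs).trans ha
    | cons o l =>
      simp only [List.cons_append, List.cons.injEq] at htr
      exact ih hg htr.2
  | last h1 h2 =>
    cases l with
    | nil => exact ((Paced.last (g := g) h1 h2).length_prefix_le htr hs).trans ha
    | cons o l =>
      simp only [List.cons_append, List.cons.injEq] at htr
      have := congrArg List.length htr.2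
      simp at this
      omega

end Paced

/-! ### Repetition-free lists of outputs -/

/-- The outputs are, one for one, related to the elements of the set `S`. -/
def Lists {α σ : Type*} (R : α → σ → Prop) (S : Set σ) (outs : List α) : Prop :=
  ∃ ss : List σ, ss.Nodup ∧ (∀ s, s ∈ ss ↔ s ∈ S) ∧ List.Forall₂ R outs ss

section Lists

variable {α σ σ' : Type*} {R : α → σ → Prop} {S S' : Set σ} {outs outs' : List α}

lemma Lists.append (h : Lists R S outs) (h' : Lists R S' outs') (hd : Disjoint S S') :
    Lists R (S ∪ S') (outs ++ outs') := by
  obtain ⟨ss, h1, h2, h3⟩ := h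
  obtain ⟨ss', h1', h2', h3'⟩ := h'
  refine ⟨ss ++ ss', ?_, by simp [h2, h2'], List.rel_append h3 h3'⟩
  refine List.nodup_append.2 ⟨h1, h1', ?_⟩
  rintro s hs _ hs' rfl
  exact Set.disjoint_left.1 hd ((h2 s).1 hs) ((h2' s).1 hs')

/-- Transport along a one-to-one correspondence `J` between two sets. -/
lemma Lists.transport (h : Lists R S outs) {R' : α → σ' → Prop} {S' : Set σ'}
    (J : σ' → σ → Prop) (h1 : ∀ s ∈ S, ∃ s' ∈ S', J s' s) (h2 : ∀ s' ∈ S', ∃ s ∈ S, J s' s)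
    (func : ∀ s' ∈ S', ∀ s t, J s' s → J s' t → s = t)
    (inj : ∀ s' ∈ S', ∀ t' ∈ S', ∀ s, J s' s → J t' s → s' = t')
    (hR : ∀ o, ∀ s' ∈ S', ∀ s, J s' s → R o s → R' o s') : Lists R' S' outs := by
  obtain ⟨ss, h3, h4, h5⟩ := h
  rcases isEmpty_or_nonempty σ' with he | he
  · have hss : ss = [] := List.eq_nil_iff_forall_not_mem.2 fun s hs =>
      he.elim (h1 s ((h4 s).1 hs)).choose
    subst hss
    cases h5
    exact ⟨[], .nil, fun s => he.elim s, .nil⟩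
  choose! f hf using h1
  refine ⟨ss.map f, ?_, ?_, ?_⟩
  · refine h3.map_on ?_
    intro s hs t ht hst
    have hs := hf s ((h4 s).1 hs)
    have ht := hf t ((h4 t).1 ht)
    exact func (f s) hs.1 s t hs.2 (hst ▸ ht.2)
  · intro s'
    rw [List.mem_map]
    constructor
    · rintro ⟨s, hs, rfl⟩
      exact (hf s ((h4 s).1 hs)).1
    · intro hs'
      obtain ⟨s, hs, hJ⟩ := h2 s' hs'
      exact ⟨s, (h4 s).2 hs, inj _ (hf s hs).1 _ hs' s (hf s hs).2 hJ⟩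
  · rw [List.forall₂_map_right_iff]
    have h6 : ∀ s ∈ ss, s ∈ S := fun s => (h4 s).1
    clear h3 h4
    induction h5 with
    | nil => exact .nil
    | cons h _ ih =>
      simp only [List.forall_mem_cons] at h6
      exact .cons (hR _ _ (hf _ h6.1).1 _ (hf _ h6.1).2 h) (ih h6.2)

end Lists

/-! ### Executions -/

open ExtractionGrammar

variable {T : Type u} {X : Type v} [Fintype X] [DecidableEq X]
  {G : ExtractionGrammar T X} {d : List T}

/-- Started in the first configuration, the algorithm reaches the second one; the trace lists what
is output in each step. -/
inductive Exec (P : Preprocessing G d) : Config (DecNT G.NT X) X →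
    List (Option (List (Entry X))) → Config (DecNT G.NT X) X → Prop
  | refl (c : Config (DecNT G.NT X) X) : Exec P c [] c
  | step {c c' c'' : Config (DecNT G.NT X) X} {o : Option (List (Entry X))}
      {tr : List (Option (List (Entry X)))} :
      step P c = some (o, c') → Exec P c' tr c'' → Exec P c (o :: tr) c''

variable {P : Preprocessing G d}

lemma Exec.trans {c c' c'' : Config (DecNT G.NT X) X} {tr tr' : List (Option (List (Entry X)))}
    (h : Exec P c tr c') (h' : Exec P c' tr' c'') : Exec P c (tr ++ tr') c'' := by
  induction h with
  | refl => exact h'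
  | step h _ ih => exact .step h (ih h')

lemma Exec.single {c c' : Config (DecNT G.NT X) X} {o : Option (List (Entry X))}
    (h : Enumerate.step P c = some (o, c')) : Exec P c [o] c' := .step h (.refl _)

lemma Exec.run {c c' : Config (DecNT G.NT X) X} {tr : List (Option (List (Entry X)))}
    (h : Exec P c tr c') (h' : Enumerate.step P c' = none) : Run P c tr := by
  induction h with
  | refl => exact .halt h'
  | step h _ ih => exact .step h (ih h')

lemma exec_insert (es : List (Entry X)) (α : List (DecNT G.NT X)) (map : List (Entry X))
    (K : List (Frame (DecNT G.NT X) X)) :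
    Exec P ⟨.insert es α map, K⟩ (List.replicate (es.length + 1) none)
      ⟨.call α (es.reverse ++ map), K⟩ := by
  induction es generalizing map with
  | nil => exact .single rfl
  | cons e es ih =>
    have := ih (e :: map)
    rw [List.reverse_cons, List.append_assoc]
    exact .step rfl this

lemma exec_write (es map : List (Entry X)) (K : List (Frame (DecNT G.NT X) X)) :
    Exec P ⟨.write es map, K⟩ (List.replicate es.length none ++ [some map]) ⟨.resume, K⟩ := by
  induction es with
  | nil => exact .single rfl
  | cons e es ih => exact .step rfl ih

lemma reduceOption_replicate_append {α : Type*} (n : ℕ) (tr : List (Option α)) :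
    (List.replicate n none ++ tr).reduceOption = tr.reduceOption := by
  simp [List.reduceOption_append, List.reduceOption_replicate_none]

/-- The composition of the iterations of a loop. -/
lemma exec_loop {ι σ : Type*} {R : List (Entry X) → σ → Prop} {S : ι → Set σ} {g b a : ℕ}
    (f : List ι → Frame (DecNT G.NT X) X) {items : List ι} (hne : items ≠ [])
    (hnd : items.Nodup)
    (h : ∀ i ∈ items, ∃ tr, (∀ todo K, Exec P ⟨.resume, f (i :: todo) :: K⟩ tr
      ⟨.resume, f todo :: K⟩) ∧ Paced g b a tr ∧ Lists R (S i) tr.reduceOption)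
    (hd : ∀ i ∈ items, ∀ j ∈ items, i ≠ j → Disjoint (S i) (S j)) (hab : b + a ≤ g) :
    ∃ tr, (∀ K, Exec P ⟨.resume, f items :: K⟩ tr ⟨.resume, f [] :: K⟩) ∧
      Paced g b a tr ∧ Lists R {s | ∃ i ∈ items, s ∈ S i} tr.reduceOption := by
  induction items with
  | nil => exact absurd rfl hne
  | cons i items ih =>
    obtain ⟨tr, h1, h2, h3⟩ := h i List.mem_cons_self
    by_cases he : items = []
    · subst he
      exact ⟨tr, h1 [], h2, by simpa using h3⟩
    · rw [List.nodup_cons] at hnd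
      obtain ⟨tr', h1', h2', h3'⟩ := ih he hnd.2 (fun j hj => h j (List.mem_cons_of_mem _ hj))
        (fun j hj k hk => hd j (List.mem_cons_of_mem _ hj) k (List.mem_cons_of_mem _ hk))
      refine ⟨tr ++ tr', fun K => (h1 _ K).trans (h1' K), h2.append h2' hab, ?_⟩
      rw [List.reduceOption_append]
      have : {s | ∃ j ∈ i :: items, s ∈ S j} = S i ∪ {s | ∃ j ∈ items, s ∈ S j} := by
        ext s
        simp
      rw [this]
      refine h3.append h3' (Set.disjoint_left.2 ?_)
      rintro s hs ⟨j, hj, hs'⟩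
      refine Set.disjoint_left.1 (hd i List.mem_cons_self j (List.mem_cons_of_mem _ hj) ?_) hs hs'
      rintro rfl
      exact hnd.1 hj

end Enumerate

/-! ### The calls of ENUMERATE -/

namespace ExtractionGrammar

open Symbol RefWord

variable {T : Type u} {X : Type v} {G : ExtractionGrammar T X} {d : List T}
  [Fintype X] [DecidableEq X]

/-- After a sequence of skippable rules, a rule that leaves exactly one non-stable non-terminal
handles at least one variable operation. -/
lemma Jumps.not_xor {p a b : PosTree G} {M : DecNT G.NT X} (h : Jumps p M a b) (hp : IsPart d p)
    (hs : ¬ Stable G (dec p)) (hab : between a b = ∅) :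
    ¬ Xor (Stable G (dec a)) (Stable G (dec b)) := by
  induction h with
  | here hc hk => exact fun hx => hk ((skippable_iff hp hc).2 ⟨hs, hab, hx⟩)
  | left hc _ hl _ ih => exact ih (hp.core hc).1 hl hab
  | right hc _ hr _ ih => exact ih (hp.core hc).2 hr hab

/-- The number of the variable operations that the calls for a sequence of non-terminals add. -/
noncomputable def totalRemaining (G : ExtractionGrammar T X) (α : List (DecNT G.NT X)) : ℕ :=
  (α.map (remaining G)).sum

/-- A bound for the depth of the recursion for a sequence of non-stable non-terminals: a rule adds a
variable operation or produces two non-stable non-terminals, and each of the latter yields at least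
one variable operation later on. -/
noncomputable def weight (G : ExtractionGrammar T X) (α : List (DecNT G.NT X)) : ℕ :=
  (α.map fun N => 2 * remaining G N - 1).sum

lemma stable_iff_remaining (hc : IsCNF G) (hf : IsFunctional G) {N : DecNT G.NT X}
    (h : Occurs G d N) : Stable G N ↔ remaining G N = 0 := by
  obtain ⟨p, hp, rfl⟩ := h.exists_part hc hf
  rw [stable_dec hc hf hp.follows h.reachable, remaining_dec hc hf hp.follows h.reachable,
    Finset.card_eq_zero]

/-- The progress made by a jump and the rule that follows. -/
lemma measure_of_jump (hc : IsCNF G) (hf : IsFunctional G) {N M : DecNT G.NT X}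
    (h : Occurs G d N) (hs : ¬ Stable G N) (hM : M ∈ jump G d N)
    {q : DecNT G.NT X × DecNT G.NT X} (hq : q ∈ nonSkippable G d M) :
    Occurs G d q.1 ∧ Occurs G d q.2 ∧
    totalRemaining G (nonStable G [q.1, q.2]) + (prodEntries q).length = remaining G N ∧
    weight G (nonStable G [q.1, q.2]) + 1 ≤ 2 * remaining G N - 1 := by
  obtain ⟨L, R⟩ := q
  obtain ⟨-, hL, hR, -⟩ := exists_of_rule hc hf hq.1
  obtain ⟨a, ha, rfl⟩ := hL.exists_part hc hf
  obtain ⟨b, hb, rfl⟩ := hR.exists_part hc hf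
  obtain ⟨p, hp, rfl, hJ⟩ := exists_of_jump hc hf hM ha hb hq
  obtain ⟨-, -, -, hcard⟩ := hJ.inner hc hf hp h
  have hx := hJ.not_xor hp hs
  rw [stable_iff_remaining hc hf h] at hs
  rw [← remaining_dec hc hf ha.follows hL.reachable, ← remaining_dec hc hf hb.follows hR.reachable,
    ← remaining_dec hc hf hp.follows h.reachable, ← length_prodEntries] at hcard
  have hx : (prodEntries (dec a, dec b)).length = 0 →
      ¬ Xor (Stable G (dec a)) (Stable G (dec b)) := by
    intro h0
    rw [length_prodEntries, Finset.card_eq_zero] at h0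
    exact hx (by rw [between, h0, Finset.image_empty])
  have hsa := stable_iff_remaining hc hf hL
  have hsb := stable_iff_remaining hc hf hR
  refine ⟨hL, hR, ?_⟩
  generalize (prodEntries (dec a, dec b)).length = k at hcard hx ⊢
  by_cases h1 : Stable G (dec a) <;> by_cases h2 : Stable G (dec b) <;>
    simp [h1, h2, nonStable, totalRemaining, weight, Xor] at hx hsa hsb ⊢ <;> omega

lemma occurs_of_jump (hc : IsCNF G) (hf : IsFunctional G) {N M : DecNT G.NT X}
    (h : Occurs G d N) (hs : ¬ Stable G N) (hM : M ∈ jump G d N) :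
    Occurs G d M ∧ ¬ Stable G M := by
  obtain ⟨hM, -⟩ := hM
  induction hM with
  | refl => exact ⟨h, hs⟩
  | tail _ hM _ =>
    obtain ⟨⟨N₀, α⟩, hR, hk, -, hM, hs⟩ := hM
    obtain ⟨A, B, C, i, i', j, x, y, x', z, z', y', hρ, -⟩ := hk
    injection hρ with hN hα
    subst hα
    obtain ⟨-, hoL, hoR, -⟩ := exists_of_rule hc hf hR
    simp only [List.mem_cons, nonterminal.injEq, List.not_mem_nil, or_false] at hM
    rcases hM with rfl | rfl
    exacts [⟨hoL, hs⟩, ⟨hoR, hs⟩]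

/-- The sequences of parse trees for a sequence of non-terminals. -/
def solutions (d : List T) (α : List (DecNT G.NT X)) : Set (List (PosTree G)) :=
  {q | q.map dec = α ∧ ∀ p ∈ q, IsPart d p}

/-- `out` consists of `map` and of the inner variable operations of the parse trees `q`. -/
def Extends (map out : List (Entry X)) (q : List (PosTree G)) : Prop :=
  ∀ e, e ∈ out ↔ e ∈ map ∨ ∃ p ∈ q, e ∈ inner p

/-- The solutions that begin with a jump to `M` and the rule `M → L R` for `m = (L, R)`. -/
def solutionsVia (d : List T) (α : List (DecNT G.NT X)) (M : DecNT G.NT X)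
    (m : DecNT G.NT X × DecNT G.NT X) : Set (List (PosTree G)) :=
  {q | q ∈ solutions d α ∧ ∃ t s a b, q = t :: s ∧ Jumps t M a b ∧ (dec a, dec b) = m}

/-- The trees `s` that remain to be chosen after a jump and a rule correspond one-to-one to the
solutions `q` that begin with this jump and this rule. This is where unambiguity is needed. -/
lemma lists_solutionsVia (hc : IsCNF G) (hf : IsFunctional G) (hu : IsUnambiguous G)
    {N M : DecNT G.NT X} {α : List (DecNT G.NT X)} (h : Occurs G d N)
    (hM : M ∈ jump G d N) {m : DecNT G.NT X × DecNT G.NT X} (hm : m ∈ nonSkippable G d M)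
    {map : List (Entry X)} {outs : List (List (Entry X))}
    (hl : Enumerate.Lists (Extends ((prodEntries m).reverse ++ map))
      (solutions d (nonStable G [m.1, m.2] ++ α)) outs) :
    Enumerate.Lists (Extends map) (solutionsVia d (N :: α) M m) outs := by
  obtain ⟨-, hL, hR, -⟩ := exists_of_rule hc hf hm.1
  -- The inner operations of a tree can be read off `m` and the remaining trees.
  have inner_iff : ∀ t a b, IsPart d t → dec t = N → Jumps t M a b → (dec a, dec b) = m →
      ∀ e, e ∈ inner t ↔ e ∈ prodEntries m ∨ ∃ p ∈ nonStableTrees [a, b], e ∈ inner p := by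
    rintro t a b ht rfl hJ rfl e
    obtain ⟨ha, hb⟩ := hJ.isPart ht
    rw [exists_mem_nonStableTrees hc hf (d := d)
      (by simpa only [List.forall_mem_cons, List.not_mem_nil, false_imp_iff, implies_true, and_true]
        using ⟨⟨ha, hL⟩, hb, hR⟩), (hJ.inner hc hf ht h).2.2.1, mem_prodEntries ha]
    simp only [List.mem_cons, List.not_mem_nil, or_false, exists_eq_or_imp, exists_eq_left]
    tauto
  refine hl.transport (fun q s => ∃ t r a b, q = t :: r ∧ s = nonStableTrees [a, b] ++ r ∧
    Jumps t M a b ∧ (dec a, dec b) = m) ?_ ?_ ?_ ?_ ?_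
  · rintro s ⟨hs, hp⟩
    obtain ⟨s, r, rfl, hs', rfl⟩ := List.map_eq_append_iff.1 hs
    simp only [List.mem_append] at hp
    obtain ⟨q, hq, hp', rfl⟩ := exists_nonStableTrees_eq hc hf (α := [m.1, m.2])
      (by simpa using ⟨hL, hR⟩) hs' (fun p h => hp p (.inl h))
    rcases q with - | ⟨a, - | ⟨b, - | ⟨c, q⟩⟩⟩ <;> simp only [List.map_cons, List.map_nil,
      List.cons.injEq, reduceCtorEq, and_false, List.nil_eq, and_true] at hq
    have hab : (dec a, dec b) = m := Prod.ext hq.1 hq.2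
    obtain ⟨t, ht, rfl, hJ⟩ := exists_of_jump hc hf hM (hp' a (by simp)) (hp' b (by simp))
      (hab ▸ hm)
    exact ⟨t :: r, ⟨⟨rfl, List.forall_mem_cons.2 ⟨ht, fun p h => hp p (.inr h)⟩⟩, t, r, a, b, rfl,
      hJ, hab⟩, t, r, a, b, rfl, rfl, hJ, hab⟩
  · rintro _ ⟨⟨hq, hp⟩, t, r, a, b, rfl, hJ, hab⟩
    simp only [List.map_cons, List.cons.injEq] at hq
    rw [List.forall_mem_cons] at hp
    refine ⟨nonStableTrees [a, b] ++ r, ⟨?_, ?_⟩, t, r, a, b, rfl, rfl, hJ, hab⟩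
    · rw [List.map_append, map_dec_nonStableTrees, hq.2, ← hab]
      rfl
    · intro p hp'
      rcases List.mem_append.1 hp' with hp' | hp'
      · rw [mem_nonStableTrees] at hp'
        obtain ⟨ha, hb⟩ := hJ.isPart hp.1
        have := hp'.1
        simp only [List.mem_cons, List.not_mem_nil, or_false] at this
        rcases this with rfl | rfl
        exacts [ha, hb]
      · exact hp.2 p hp'
  · rintro _ - s s' ⟨t, r, a, b, rfl, rfl, hJ, -⟩ ⟨t', r', a', b', ht, rfl, hJ', -⟩
    obtain ⟨rfl, rfl⟩ := List.cons.inj ht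
    obtain ⟨-, rfl, rfl⟩ := hJ.deterministic hJ'
    rfl
  · rintro _ ⟨⟨hq, hp⟩, -⟩ _ ⟨⟨hq', hp'⟩, -⟩ _ ⟨t, r, a, b, rfl, rfl, hJ, hab⟩
      ⟨t', r', a', b', rfl, hs, hJ', hab'⟩
    simp only [List.map_cons, List.cons.injEq] at hq hq'
    rw [List.forall_mem_cons] at hp hp'
    have hlen : (nonStableTrees [a, b]).length = (nonStableTrees [a', b']).length := by
      rw [← List.length_map dec, ← List.length_map (as := nonStableTrees [a', b']) dec,
        map_dec_nonStableTrees, map_dec_nonStableTrees]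
      have := hab.trans hab'.symm
      simp only [Prod.mk.injEq] at this
      simp [this]
    obtain ⟨hs', rfl⟩ := List.append_inj hs hlen
    congr 1
    refine hp.1.unique hf hu hp'.1 ?_ (hq.1.trans hq'.1.symm) ?_
    · rw [← hq.1] at h
      exact h.reachable
    · ext e
      rw [inner_iff t a b hp.1 hq.1 hJ hab, inner_iff t' a' b' hp'.1 hq'.1 hJ' hab', hs']
  · rintro out _ ⟨⟨hq, hp⟩, -⟩ _ ⟨t, r, a, b, rfl, rfl, hJ, hab⟩ hout e
    simp only [List.map_cons, List.cons.injEq] at hq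
    rw [List.forall_mem_cons] at hp
    have h1 := inner_iff t a b hp.1 hq.1 hJ hab e
    rw [hout e]
    simp only [List.mem_append, List.mem_reverse, or_and_right, exists_or, List.mem_cons,
      exists_eq_left, h1, or_assoc]
    exact or_left_comm

end ExtractionGrammar

namespace Enumerate

open ExtractionGrammar

variable {T : Type u} {X : Type v} [Fintype X] [DecidableEq X]
  {G : ExtractionGrammar T X} {d : List T} {P : Preprocessing G d}

lemma exec_call_nil {g b t : ℕ} (map : List (Entry X)) (ht : map.length ≤ t) :
    ∃ tr, (∀ K, Exec P ⟨.call [] map, K⟩ tr ⟨.resume, K⟩) ∧ Paced g b (t + 1) tr ∧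
      Lists (Extends map) (solutions d ([] : List (DecNT G.NT X))) tr.reduceOption := by
  refine ⟨List.replicate 1 none ++ (List.replicate map.length none ++ [some map]),
    fun K => .step rfl (exec_write map map K), ?_, ?_⟩
  · have h0 : Paced g b 0 [some map] := .last (by simp [Silent]) (by simp)
    exact ((h0.replicate_append map.length).replicate_append 1).mono (by omega) le_rfl
  · rw [reduceOption_replicate_append, reduceOption_replicate_append]
    refine ⟨[[]], by simp, ?_, ?_⟩
    · intro q
      simp only [List.mem_singleton, solutions, Set.mem_ofPred_eq, List.map_eq_nil_iff]
      constructor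
      · rintro rfl; simp
      · exact fun h => h.1
    · refine .cons (fun e => ?_) .nil
      simp

/-- A call outputs the extensions of `map` by all sequences of parse trees for `α`, one by one. Here
`n` bounds the depth of the recursion, and `t` the size of the outputs. A level of the recursion
takes two steps on the way out, and four steps and one for each new pair on the way in. -/
lemma exec_call (hc : IsCNF G) (hf : IsFunctional G) (hu : IsUnambiguous G) {g t : ℕ} (n : ℕ)
    (α : List (DecNT G.NT X)) (map : List (Entry X))
    (hα : ∀ N ∈ α, Occurs G d N ∧ ¬ Stable G N) (hn : weight G α ≤ n)
    (ht : map.length + totalRemaining G α ≤ t) (hg : 6 * n + 2 * t + 4 ≤ g) :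
    ∃ tr, (∀ K, Exec P ⟨.call α map, K⟩ tr ⟨.resume, K⟩) ∧
      Paced g (2 * n) (4 * n + totalRemaining G α + t + 2) tr ∧
      Lists (Extends map) (solutions d α) tr.reduceOption := by
  induction n generalizing α map with
  | zero =>
    cases α with
    | nil =>
      obtain ⟨tr, h1, h2, h3⟩ := exec_call_nil (P := P) (g := g) (b := 0) (t := t) map (by omega)
      exact ⟨tr, h1, h2.mono (by omega) (by omega), h3⟩
    | cons N α =>
      obtain ⟨h, hs⟩ := hα N List.mem_cons_self
      rw [stable_iff_remaining hc hf h] at hs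
      simp only [weight, List.map_cons, List.sum_cons] at hn
      omega
  | succ n ih =>
    cases α with
    | nil =>
      obtain ⟨tr, h1, h2, h3⟩ := exec_call_nil (P := P) (g := g) (b := 0) (t := t) map (by omega)
      exact ⟨tr, h1, h2.mono (by omega) (by omega), h3⟩
    | cons N α =>
      obtain ⟨h, hs⟩ := hα N List.mem_cons_self
      have hw : weight G (N :: α) = 2 * remaining G N - 1 + weight G α := by simp [weight]
      have hr : totalRemaining G (N :: α) = remaining G N + totalRemaining G α := by
        simp [totalRemaining]
      rw [hr] at ht
      -- The iteration of the inner loop for the rule `M → L R` with `m = (L, R)`.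
      have iter : ∀ M ∈ P.jumps N, ∀ m ∈ P.prods M, ∃ tr, (∀ todo K,
          Exec P ⟨.resume, .prods (m :: todo) α map :: K⟩ tr ⟨.resume, .prods todo α map :: K⟩) ∧
          Paced g (2 * n) (4 * n + totalRemaining G (N :: α) + t + 4) tr ∧
          Lists (Extends map) (solutionsVia d (N :: α) M m) tr.reduceOption := by
        intro M hM m hm
        rw [P.mem_jumps] at hM
        rw [P.mem_prods] at hm
        obtain ⟨hL, hR, h1, h2⟩ := measure_of_jump hc hf h hs hM hm
        have hw' : weight G (nonStable G [m.1, m.2] ++ α) =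
            weight G (nonStable G [m.1, m.2]) + weight G α := by simp [weight]
        have hr' : totalRemaining G (nonStable G [m.1, m.2] ++ α) =
            totalRemaining G (nonStable G [m.1, m.2]) + totalRemaining G α := by
          simp [totalRemaining]
        obtain ⟨tr, h3, h4, h5⟩ := ih (nonStable G [m.1, m.2] ++ α) ((prodEntries m).reverse ++ map)
          (by
            intro N' hN'
            rcases List.mem_append.1 hN' with hN' | hN'
            · rw [mem_nonStable] at hN'
              obtain ⟨hN', hs'⟩ := hN'
              simp only [List.mem_cons, List.not_mem_nil, or_false] at hN'
              rcases hN' with rfl | rfl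
              exacts [⟨hL, hs'⟩, ⟨hR, hs'⟩]
            · exact hα N' (List.mem_cons_of_mem _ hN'))
          (by omega) (by simp only [List.length_append, List.length_reverse]; omega) (by omega)
        refine ⟨List.replicate 1 none ++ (List.replicate ((prodEntries m).length + 1) none ++ tr),
          fun todo K => .step rfl ((exec_insert _ _ _ _).trans (h3 _)),
          ((h4.replicate_append _).replicate_append _).mono (by omega) le_rfl, ?_⟩
        rw [reduceOption_replicate_append, reduceOption_replicate_append]
        exact lists_solutionsVia hc hf hu h hM hm h5
      -- The iteration of the outer loop for the element `M` of the jump list.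
      have iter' : ∀ M ∈ P.jumps N, ∃ tr, (∀ todo K,
          Exec P ⟨.resume, .jumps (M :: todo) α map :: K⟩ tr ⟨.resume, .jumps todo α map :: K⟩) ∧
          Paced g (2 * n + 1) (4 * n + totalRemaining G (N :: α) + t + 5) tr ∧
          Lists (Extends map) {q | ∃ m ∈ P.prods M, q ∈ solutionsVia d (N :: α) M m}
            tr.reduceOption := by
        intro M hM
        obtain ⟨tr, h1, h2, h3⟩ := exec_loop (fun todo => .prods todo α map)
          (items := P.prods M) (by
            obtain ⟨hoM, hsM⟩ := occurs_of_jump hc hf h hs ((P.mem_jumps N M).1 hM)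
            obtain ⟨-, ⟨M', β⟩, hR, rfl, hk⟩ := (P.mem_jumps N M).1 hM
            obtain ⟨L, R, hβ⟩ := output_of_not_stable hc hf hR hoM hsM
            dsimp only at hβ
            subst hβ
            exact List.ne_nil_of_mem ((P.mem_prods _ (L, R)).2 ⟨hR, hk⟩))
          (P.prods_nodup M) (iter M hM) (by
            intro m hm m' hm' hne
            refine Set.disjoint_left.2 ?_
            rintro _ ⟨-, t, s, a, b, rfl, hJ, rfl⟩ ⟨-, t', s', a', b', ht', hJ', rfl⟩
            obtain ⟨rfl, rfl⟩ := List.cons.inj ht'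
            obtain ⟨-, rfl, rfl⟩ := hJ.deterministic hJ'
            exact hne rfl) (by omega)
        refine ⟨List.replicate 1 none ++ (tr ++ List.replicate 1 none),
          fun todo K => .step rfl ((h1 _).trans (.single rfl)),
          (h2.append_replicate 1).replicate_append 1, ?_⟩
        rw [reduceOption_replicate_append, List.reduceOption_append]
        simpa using h3
      obtain ⟨tr, h1, h2, h3⟩ := exec_loop (fun todo => .jumps todo α map)
        (items := P.jumps N) (by
          obtain ⟨p, hp, rfl⟩ := h.exists_part hc hf
          obtain ⟨M, a, b, -, hM, -⟩ := exists_jumps hc hf hp h hs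
          exact List.ne_nil_of_mem ((P.mem_jumps _ M).2 hM))
        (P.jumps_nodup N) iter' (by
          intro M hM M' hM' hne
          refine Set.disjoint_left.2 ?_
          rintro _ ⟨m, -, -, t, s, a, b, rfl, hJ, -⟩ ⟨m', -, -, t', s', a', b', ht', hJ', -⟩
          obtain ⟨rfl, rfl⟩ := List.cons.inj ht'
          exact hne (hJ.deterministic hJ').1) (by omega)
      refine ⟨List.replicate 1 none ++ (tr ++ List.replicate 1 none),
        fun K => .step rfl ((h1 _).trans (.single rfl)),
        ((h2.append_replicate 1).replicate_append 1).mono (by omega) (by omega), ?_⟩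
      rw [reduceOption_replicate_append, List.reduceOption_append]
      have hS : {q | ∃ M ∈ P.jumps N, q ∈ {q | ∃ m ∈ P.prods M, q ∈ solutionsVia d (N :: α) M m}} =
          solutions d (N :: α) := by
        ext q
        constructor
        · rintro ⟨M, -, m, -, hq, -⟩
          exact hq
        · intro hq
          have hq' := hq
          obtain ⟨hq1, hq2⟩ := hq
          cases q with
          | nil => simp at hq1
          | cons p q =>
            simp only [List.map_cons, List.cons.injEq] at hq1
            obtain ⟨rfl, -⟩ := hq1
            obtain ⟨M, a, b, hJ, hM, hab⟩ := exists_jumps hc hf (hq2 p List.mem_cons_self) h hs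
            exact ⟨M, (P.mem_jumps _ M).2 hM, _, (P.mem_prods M _).2 hab, hq', p, q, a, b, rfl, hJ,
              rfl⟩
      rw [hS] at h3
      simpa using h3

/-! ### The main algorithm -/

open RefWord

/-- The mappings of the parse trees of the whole document with the given decorated root. -/
def mappingsOf (d : List T) (N : DecNT G.NT X) : Set (SpanMapping X d) :=
  {μ | ∃ p : PosTree G, IsPart d p ∧ dec p = N ∧ Represents (entries p.1 p.2.yield) μ}

omit [DecidableEq X] in
lemma card_varOp : Fintype.card (VarOp X) = 2 * Fintype.card X := by
  let e : VarOp X ≃ X ⊕ X :=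
    { toFun := fun τ => match τ with
        | .op x => .inl x
        | .cl x => .inr x
      invFun := fun s => match s with
        | .inl x => .op x
        | .inr x => .cl x
      left_inv := by rintro (x | x) <;> rfl
      right_inv := by rintro (x | x) <;> rfl }
  rw [Fintype.card_congr e, Fintype.card_sum, two_mul]

omit [Fintype X] in
/-- The parse trees that start at the first letter and have the decorated root `S_{1,n}^{x,y}` are
parse trees of ref-words for the whole document. -/
lemma letters_eq_of_start {p : PosTree G} (hp : IsPart d p) {x y : Finset (VarOp X)}
    (h : dec p = .span G.initial 1 d.length x y) :
    p.1 = 1 ∧ p.2.root = G.initial ∧ letters p.2 = d := by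
  simp only [dec, DecNT.span.injEq] at h
  obtain ⟨h1, h2, h3, -⟩ := h
  refine ⟨h2, h1, ?_⟩
  obtain ⟨u, v, hd, hu⟩ := hp.factor
  have hlt := hp.lt_endPos
  have hlen := congrArg List.length hd
  rw [endPos] at h3 hlt
  simp only [List.length_append] at hlen
  obtain rfl : u = [] := List.length_eq_zero_iff.1 (by omega)
  obtain rfl : v = [] := List.length_eq_zero_iff.1 (by simp at hlen; omega)
  simpa using hd.symm

omit [Fintype X] in
lemma mem_startEntries {p : PosTree G} (hp : IsPart d p) {x y : Finset (VarOp X)}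
    (h : dec p = .span G.initial 1 d.length x y) (e : Entry X) :
    e ∈ entries p.1 p.2.yield ↔ e ∈ startEntries (dec p) ∨ e ∈ inner p := by
  have hlt := hp.lt_endPos
  obtain ⟨h1, -, -⟩ := letters_eq_of_start hp h
  have h2 : endPos p - 1 + 1 = endPos p := by omega
  have hs : ∀ e : Entry X, e ∈ startEntries (dec p) ↔
      (e.1 ∈ opsAt p.1 p.1 p.2.yield ∧ e.2 = p.1) ∨
      (e.1 ∈ opsAt p.1 (endPos p) p.2.yield ∧ e.2 = endPos p) := by
    rintro ⟨τ, q⟩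
    simp only [dec, startEntries, List.mem_append, List.mem_map, Finset.mem_toList, Prod.mk.injEq,
      h2]
    rw [← h1]
    constructor
    · rintro (⟨τ', h3, rfl, rfl⟩ | ⟨τ', h3, rfl, rfl⟩)
      exacts [.inl ⟨h3, rfl⟩, .inr ⟨h3, rfl⟩]
    · rintro (⟨h3, rfl⟩ | ⟨h3, rfl⟩)
      exacts [.inl ⟨τ, h3, rfl, rfl⟩, .inr ⟨τ, h3, rfl, rfl⟩]
  rw [mem_entries_iff_inner, hs, or_assoc]

omit [Fintype X] in
/-- Parse trees of the whole document with the same mapping have the same decorated root. -/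
lemma dec_eq_of_represents {p p' : PosTree G} (hp : IsPart d p) (hp' : IsPart d p')
    {x y x' y' : Finset (VarOp X)} (h : dec p = .span G.initial 1 d.length x y)
    (h' : dec p' = .span G.initial 1 d.length x' y')
    (he : ∀ e, e ∈ entries p.1 p.2.yield ↔ e ∈ entries p'.1 p'.2.yield) : dec p = dec p' := by
  obtain ⟨h1, h2, h3⟩ := letters_eq_of_start hp h
  obtain ⟨h1', h2', h3'⟩ := letters_eq_of_start hp' h'
  have h4 : endPos p = endPos p' := by simp only [endPos, h1, h1', h3, h3']
  have h5 : ∀ q, opsAt p.1 q p.2.yield = opsAt p'.1 q p'.2.yield := by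
    intro q
    ext τ
    rw [mem_opsAt, mem_opsAt, he]
  rw [h1, h1'] at h5
  simp only [dec, h2, h2', h4, h1, h1', h5]

/-- The trees that remain to be chosen after the choice of `S_{1,n}^{x,y}` correspond one-to-one to
mappings. -/
lemma lists_mappingsOf (hc : IsCNF G) (hf : IsFunctional G) (hu : IsUnambiguous G)
    {N : DecNT G.NT X} {x y : Finset (VarOp X)} (ho : Occurs G d N)
    (hN : N = .span G.initial 1 d.length x y) {outs : List (List (Entry X))}
    (hl : Lists (Extends ((startEntries N).reverse ++ [])) (solutions d (nonStable G [N])) outs) :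
    Lists Represents (mappingsOf d N) outs := by
  have hin : ∀ p : PosTree G, IsPart d p → dec p = N → ∀ e,
      e ∈ entries p.1 p.2.yield ↔ e ∈ startEntries N ∨ ∃ q ∈ nonStableTrees [p], e ∈ inner q := by
    rintro p hp rfl e
    rw [mem_startEntries hp hN, exists_mem_nonStableTrees hc hf (d := d)
      (by simpa only [List.forall_mem_cons, List.not_mem_nil, false_imp_iff, implies_true, and_true]
        using ⟨hp, ho⟩)]
    simp only [List.mem_singleton, exists_eq_left]
  have huniq : ∀ p p' : PosTree G, IsPart d p → IsPart d p' → dec p = N → dec p' = N →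
      (∀ e, e ∈ entries p.1 p.2.yield ↔ e ∈ entries p'.1 p'.2.yield) → p = p' := by
    rintro p p' hp hp' rfl hd he
    refine hp.unique hf hu hp' ho.reachable hd.symm ?_
    have h4 : p.1 = p'.1 ∧ endPos p = endPos p' := by
      obtain ⟨h1, -, h2⟩ := letters_eq_of_start hp hN
      obtain ⟨h1', -, h2'⟩ := letters_eq_of_start hp' (hd.trans hN)
      exact ⟨h1.trans h1'.symm, by simp only [endPos, h1, h1', h2, h2']⟩
    ext e
    rw [mem_inner, mem_inner, he, h4.1, h4.2]
  refine hl.transport (fun μ s => ∃ p : PosTree G, IsPart d p ∧ dec p = N ∧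
    Represents (entries p.1 p.2.yield) μ ∧ s = nonStableTrees [p]) ?_ ?_ ?_ ?_ ?_
  · rintro s ⟨hs, hp⟩
    obtain ⟨q, hq, hp', rfl⟩ := exists_nonStableTrees_eq hc hf (by simpa using ho) hs hp
    rcases q with - | ⟨p, - | ⟨p', q⟩⟩ <;> simp only [List.map_cons, List.map_nil,
      List.cons.injEq, reduceCtorEq, and_false, List.nil_eq, and_true] at hq
    have hp := hp' p (by simp)
    obtain ⟨h1, h2, h3⟩ := letters_eq_of_start hp (hq.trans hN)
    have hv := hf _ (PTree.mem_language hp.follows h2)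
    obtain ⟨μ, hμ⟩ := hv.exists_encodes h3
    rw [hv.encodes_iff, ← h1] at hμ
    exact ⟨μ, ⟨p, hp, hq, hμ⟩, p, hp, hq, hμ, rfl⟩
  · rintro μ ⟨p, hp, rfl, hμ⟩
    refine ⟨nonStableTrees [p], ⟨map_dec_nonStableTrees [p], ?_⟩, p, hp, rfl, hμ, rfl⟩
    intro q hq
    rw [mem_nonStableTrees, List.mem_singleton] at hq
    exact hq.1 ▸ hp
  · rintro μ - _ _ ⟨p, hp, hd, hμ, rfl⟩ ⟨p', hp', hd', hμ', rfl⟩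
    rw [huniq p p' hp hp' hd hd' fun e => (hμ e).trans (hμ' e).symm]
  · rintro μ - μ' - _ ⟨p, hp, hd, hμ, rfl⟩ ⟨p', hp', hd', hμ', hs⟩
    exact hμ.injective hμ' fun e => by rw [hin p hp hd, hin p' hp' hd', hs]
  · rintro out μ - _ ⟨p, hp, hd, hμ, rfl⟩ hout e
    rw [hout e, ← hμ e, hin p hp hd]
    simp

lemma mem_eval_iff (hc : IsCNF G) (hf : IsFunctional G) (hd : d ≠ []) (μ : SpanMapping X d) :
    μ ∈ eval G d ↔ ∃ N ∈ P.starts, μ ∈ mappingsOf d N := by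
  constructor
  · rintro ⟨r, ⟨hr, hv, hcl⟩, hμ⟩
    obtain ⟨t, ht, hroot, rfl⟩ := PTree.exists_of_derives hc.binary hr
    have hp : IsPart d ((1, t) : PosTree G) :=
      ⟨ht, fun h => hd (hcl ▸ h), [], [], by simpa using hcl.symm, rfl⟩
    obtain ⟨-, h1, h2⟩ := hp.start_mem hc hf hcl hroot
    exact ⟨_, (P.mem_starts _).2 ⟨h1, h2⟩, (1, t), hp, rfl, (hv.encodes_iff μ).1 hμ⟩
  · rintro ⟨N, hN, p, hp, rfl, hμ⟩
    obtain ⟨⟨x, y, hN⟩, -⟩ := (P.mem_starts _).1 hN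
    obtain ⟨h1, h2, h3⟩ := letters_eq_of_start hp hN
    have hL := PTree.mem_language hp.follows h2
    refine ⟨p.2.yield, ⟨hL, hf _ hL, h3⟩, ((hf _ hL).encodes_iff μ).2 ?_⟩
    rwa [h1] at hμ

omit [DecidableEq X] in
lemma startEntries_length_le (N : DecNT G.NT X) :
    (startEntries N).length ≤ 4 * Fintype.card X := by
  cases N with
  | span A i j x y =>
    have hx := Finset.card_le_univ x
    have hy := Finset.card_le_univ y
    rw [card_varOp] at hx hy
    simp [startEntries]
    omega
  | start | eps => simp [startEntries]

lemma remaining_le (N : DecNT G.NT X) : remaining G N ≤ 2 * Fintype.card X := by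
  cases N with
  | span A i j x y => exact card_varOp (X := X) ▸ Finset.card_le_univ _
  | start | eps => simp [remaining]

/-- The main loop outputs the mappings of `⟦G⟧(d)` one by one, without long pauses, unless there is
nothing to be output. The constants are those of `exec_call` for depth `4 * k` and outputs of at
most `6 * k` pairs, together with the insertion of at most `4 * k` pairs at the start. -/
lemma exec_init (hc : IsCNF G) (hf : IsFunctional G) (hu : IsUnambiguous G) (hd : d ≠ [])
    (hne : P.starts ≠ []) :
    ∃ tr, Run P (init P) tr ∧
      Paced (44 * Fintype.card X + 4) (8 * Fintype.card X + 1) (28 * Fintype.card X + 4) tr ∧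
      Lists Represents (eval G d) tr.reduceOption := by
  refine Exists.elim (exec_loop (P := P) (R := Represents (d := d)) (S := mappingsOf d)
    (g := 44 * Fintype.card X + 4) (b := 8 * Fintype.card X) (a := 28 * Fintype.card X + 4)
    Frame.starts hne P.starts_nodup ?_ ?_ (by omega)) ?_
  · intro N hN
    obtain ⟨⟨x, y, hx⟩, hR⟩ := (P.mem_starts N).1 hN
    have ho := exists_of_start hc hf hR
    have hse := startEntries_length_le N
    have hre := remaining_le N
    have hw : weight G (nonStable G [N]) ≤ 4 * Fintype.card X := by
      by_cases hs : Stable G N <;> simp [weight, nonStable, hs]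
      omega
    have hr : totalRemaining G (nonStable G [N]) ≤ 2 * Fintype.card X := by
      by_cases hs : Stable G N <;> simp [totalRemaining, nonStable, hs]
      omega
    obtain ⟨tr, h1, h2, h3⟩ := exec_call (P := P) hc hf hu (g := 44 * Fintype.card X + 4)
      (t := 6 * Fintype.card X) (4 * Fintype.card X) (nonStable G [N])
      ((startEntries N).reverse ++ []) (by
        intro M hM
        rw [mem_nonStable, List.mem_singleton] at hM
        obtain ⟨rfl, hM⟩ := hM
        exact ⟨ho, hM⟩) hw (by simp; omega) (by omega)
    refine ⟨List.replicate 1 none ++ (List.replicate ((startEntries N).length + 1) none ++ tr),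
      fun todo K => .step rfl ((exec_insert _ _ _ _).trans (h1 _)),
      ((h2.replicate_append _).replicate_append _).mono (by omega) (by omega), ?_⟩
    rw [reduceOption_replicate_append, reduceOption_replicate_append]
    exact lists_mappingsOf hc hf hu ho hx h3
  · intro N hN N' hN' hne
    obtain ⟨⟨x, y, hx⟩, -⟩ := (P.mem_starts N).1 hN
    obtain ⟨⟨x', y', hx'⟩, -⟩ := (P.mem_starts N').1 hN'
    refine Set.disjoint_left.2 ?_
    rintro μ ⟨p, hp, rfl, hμ⟩ ⟨p', hp', rfl, hμ'⟩
    exact hne (dec_eq_of_represents hp hp' hx hx' fun e => (hμ e).trans (hμ' e).symm)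
  · rintro tr ⟨h1, h2, h3⟩
    refine ⟨tr ++ List.replicate 1 none, ((h1 []).trans (.single rfl)).run rfl,
      h2.append_replicate 1, ?_⟩
    rw [List.reduceOption_append]
    have : eval G d = {μ | ∃ N ∈ P.starts, μ ∈ mappingsOf d N} :=
      Set.ext fun μ => mem_eval_iff hc hf hd μ
    rw [this]
    simpa using h3

end Enumerate

theorem mainTheorem2 :
    ∃ C : ℕ, ∀ (T : Type u) (X : Type v) [Fintype X] [DecidableEq X]
      (G : ExtractionGrammar T X) [Finite G.NT],
      ExtractionGrammar.IsCNF G → ExtractionGrammar.IsFunctional G →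
      ExtractionGrammar.IsUnambiguous G →
      ∀ d : List T, d ≠ [] → ∀ P : ExtractionGrammar.Preprocessing G d,
        ∃ tr : List (Option (List (ExtractionGrammar.Entry X))),
          Enumerate.Run P (Enumerate.init P) tr ∧
          (∃ μs : List (SpanMapping X d), μs.Nodup ∧
            (∀ μ : SpanMapping X d, μ ∈ μs ↔ μ ∈ ExtractionGrammar.eval G d) ∧
            List.Forall₂ Enumerate.Represents tr.reduceOption μs) ∧
          (∀ (l r gap : List (Option (List (ExtractionGrammar.Entry X))))
            (m m' : List (ExtractionGrammar.Entry X)),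
            tr = l ++ some m :: (gap ++ some m' :: r) → Enumerate.Silent gap →
            gap.length + 1 ≤ C * Fintype.card X) ∧
          (∀ l r gap : List (Option (List (ExtractionGrammar.Entry X))),
            tr = l ++ gap ++ r → Enumerate.Silent gap →
            gap.length ≤ C * (Fintype.card X + 1)) := by
  refine ⟨50, fun T X _ _ G _ hc hf hu d hd P => ?_⟩
  by_cases hne : P.starts = []
  · refine ⟨[none], .step (c' := ⟨.resume, []⟩) (by simp [Enumerate.init, hne, Enumerate.step])
      (.halt rfl), ⟨[], .nil, fun μ => ?_, .nil⟩, ?_, ?_⟩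
    · rw [Enumerate.mem_eval_iff (P := P) hc hf hd]
      simp [hne]
    · intro l r gap m m' htr
      rcases l with - | ⟨o, l⟩ <;> simp at htr
    · intro l r gap htr _
      have := congrArg List.length htr
      simp at this
      omega
  · obtain ⟨tr, h1, h2, μs, h3, h4, h5⟩ := Enumerate.exec_init hc hf hu hd hne
    refine ⟨tr, h1, ⟨μs, h3, h4, h5⟩, ?_, ?_⟩
    · intro l r gap m m' htr hs
      have h6 := h2.length_gap_le (n := 44 * Fintype.card X + 4) (by omega) (by omega) (by omega)
        (l := l ++ [some m]) (gap := gap) (r := some m' :: r) (by simp [htr]) hs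
      rcases Nat.eq_zero_or_pos (Fintype.card X) with h0 | h0
      · -- Without variables there is only one mapping, hence only one output.
        have := Fintype.card_eq_zero_iff.1 h0
        have h7 := h5.length_eq
        rw [htr] at h7
        simp [List.reduceOption_append, List.reduceOption_cons_of_some] at h7
        rcases μs with - | ⟨μ, - | ⟨μ', μs⟩⟩
        · simp at h7
        · simp at h7
          omega
        · simp [Subsingleton.elim μ μ'] at h3
      · omega
    · intro l r gap htr hs
      have h6 := h2.length_gap_le (n := 44 * Fintype.card X + 4) (by omega) (by omega) (by omega)
        htr hs
      omega
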